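/- **Setting.** Let $K$ secondary users (SUs) observe, at times $t=1,2,\dots$, random variables $y^k_t$ that are independent across time and users; under hypothesis $\mathsf H_i$ ($i=0,1$) $y^k_t$ has law $\mu^k_i$. For each $k$ the laws $\mu^k_0,\mu^k_1$ are mutually absolutely continuous, and for at least one $k$ they differ. Let $l^k_t=\log\frac{d\mu^k_1}{d\mu^k_0}(y^k_t)$, $L^k_t=\sum_{j\le t}l^k_j$, $L_t=\sum_{k=1}^K L^k_t$ and $\mathsf I_i=\frac1K|\mathsf E_i[L_1]|$. Assume that $|l^k_t|<\phi<\infty$ almost surely for all $k$, and that the log-likelihood ratios are symmetric: the law of $l^k_t$ under $\mathsf H_1$ is the law of $-l^k_t$ under $\mathsf H_0$. The *centralized SPRT* with thresholds $A,B>0$ stops at $\mathcal S=\inf\{t>0: L_t\notin(-B,A)\}$ and decides for $\mathsf H_1$ if $L_{\mathcal S}\ge A$ and for $\mathsf H_0$ if $L_{\mathcal S}\le -B$. The *RLT-SPRT* with parameters $\Delta>0$, $\hat r\in\{0,1,2,\dots\}$ and thresholds $\hat A,\hat B>0$ works as follows. SU $k$ samples at the times $t^k_0=0$, $t^k_n=\inf\{t>t^k_{n-1}:|L^k_t-L^k_{t^k_{n-1}}|\ge\Delta\}$.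 With $\lambda=L^k_{t^k_n}-L^k_{t^k_{n-1}}$ it sends at time $t^k_n$ the sign $b$ of $\lambda$ and a quantized version $\hat q$ of the overshoot $q=|\lambda|-\Delta$: if $\hat r\ge1$, put $\hat\epsilon=\phi/\hat r$, $m=\lfloor q/\hat\epsilon\rfloor$; independently of everything else, $\hat q=m\hat\epsilon$ with probability $\frac{1-\exp(q-(m+1)\hat\epsilon)}{1-\exp(-\hat\epsilon)}$ and $\hat q=(m+1)\hat\epsilon$ otherwise; if $\hat r=0$, $\hat q=0$. The fusion center adds up the increments $b(\Delta+\hat q)$ one message at a time (simultaneous messages are processed in an order of the SUs that is fixed, or is drawn in each time unit independently of everything else from a given distribution), stops at the time $\hat{\mathcal S}$ at which this sum first leaves $(-\hat B,\hat A)$, and decides for $\mathsf H_1$ if the sum is then $\ge\hat A$ and for $\mathsf H_0$ if it is $\le-\hat B$. **Theorem.** For every $\Delta_0>0$ there are a number $R_0$ and functions $e_1(\Delta,\hat r)$, $e_2(\Delta,\hat r)$ that tend to $0$ when $\max\{\Delta,\hat r\}\to\infty$ with $\Delta\ge\Delta_0$ (in particular when $\Delta$ is fixed and $\hat r\to\infty$),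 and for every $C$ there is a function $e_3$ with $e_3(x)\to0$ as $x\downarrow0$, such that the following holds whenever $\Delta\ge\Delta_0$, $\max\{\Delta,\hat r\}\ge R_0$, $\alpha,\beta\in(0,1)$ and $\alpha\le C\beta$, $\beta\le C\alpha$ (that is, when $\alpha,\beta\to0$, they do so at the same rate). If the thresholds of both tests are such that both have exactly the error probabilities $\mathsf P_0(\text{decide }\mathsf H_1)=\alpha$ and $\mathsf P_1(\text{decide }\mathsf H_0)=\beta$, then all expected stopping times below are finite and $$0\le\mathsf E_1[\hat{\mathcal S}]-\mathsf E_1[\mathcal S]\le\frac{|\log\alpha|}{K\mathsf I_1\Delta\tanh(\Delta/2)}\,\frac{\phi}{\max\{\hat r,1\}}\,\bigl(1+e_1(\Delta,\hat r)\bigr)+\frac{\Delta+\phi}{\mathsf I_1}+e_2(\Delta,\hat r)+e_3(\alpha),$$ $$0\le\mathsf E_0[\hat{\mathcal S}]-\mathsf E_0[\mathcal S]\le\frac{|\log\beta|}{K\mathsf I_0\Delta\tanh(\Delta/2)}\,\frac{\phi}{\max\{\hat r,1\}}\,\bigl(1+e_1(\Delta,\hat r)\bigr)+\frac{\Delta+\phi}{\mathsf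 I_0}+e_2(\Delta,\hat r)+e_3(\beta).$$ -/

import Mathlib

open MeasureTheory Filter
open scoped ENNReal Topology

noncomputable section

namespace Sensing

/-- The orders in which the fusion center may process simultaneous messages form a finite discrete
space. -/
instance permMeasurableSpace (K : ℕ) : MeasurableSpace (Equiv.Perm (Fin K)) := ⊤

/-- Everything that is drawn in one time unit: for each secondary user (SU) `k` an observation in
`Y k` and a uniform seed in `[0,1]` for its randomized quantizer, and the order in which the fusion
center processes the messages that arrive in this time unit. -/
abbrev Step {K : ℕ} (Y : Fin K → Type*) : Type _ :=
  ((k : Fin K) → Y k × unitInterval) × Equiv.Perm (Fin K)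

/-- A realization of the experiment; `ω t` is what is drawn at time `t + 1`, so that `ω 0` belongs
to time `1`. -/
abbrev Path {K : ℕ} (Y : Fin K → Type*) : Type _ := ℕ → Step Y

/-- The law `P_i` of the experiment when a single observation of SU `k` has law `μ i k` under the
hypothesis `H_i`: observations are independent across time and across SUs, the seeds are independent
uniform variables, and the processing orders are independent draws from `ρ` (a Dirac measure `ρ`
gives a fixed order). -/
def law {K : ℕ} {Y : Fin K → Type*} [∀ k, MeasurableSpace (Y k)]
    (μ : Fin 2 → (k : Fin K) → Measure (Y k)) (ρ : Measure (Equiv.Perm (Fin K))) (i : Fin 2) :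
    Measure (Path Y) :=
  Measure.infinitePi fun _ : ℕ =>
    (Measure.pi fun k => (μ i k).prod (volume : Measure unitInterval)).prod ρ

/-- The least natural number with property `p`, and `⊤` if there is none. -/
def firstTime (p : ℕ → Prop) : ℕ∞ := ⨅ (t : ℕ) (_ : p t), (t : ℕ∞)

section LLR

variable {K : ℕ} {Y : Fin K → Type*} [∀ k, MeasurableSpace (Y k)]

/-- The local cumulative log-likelihood ratio `L^k_t` of the first `t` observations of SU `k`. -/
def localLLR (μ : Fin 2 → (k : Fin K) → Measure (Y k)) (k : Fin K) (t : ℕ) (ω : Path Y) : ℝ :=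
  ∑ j ∈ Finset.range t, llr (μ 1 k) (μ 0 k) ((ω j).1 k).1

/-- The global log-likelihood ratio `L_t`. -/
def globalLLR (μ : Fin 2 → (k : Fin K) → Measure (Y k)) (t : ℕ) (ω : Path Y) : ℝ :=
  ∑ k, localLLR μ k t ω

/-- The average Kullback-Leibler information number `I_i = |E_i[L_1]| / K`. -/
def infoNumber (μ : Fin 2 → (k : Fin K) → Measure (Y k)) (ρ : Measure (Equiv.Perm (Fin K)))
    (i : Fin 2) : ℝ :=
  |∫ ω, globalLLR μ 1 ω ∂(law μ ρ i)| / K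

/-- The expectation `E_i[T]`, possibly infinite, of a random time `T`. -/
def expTime (μ : Fin 2 → (k : Fin K) → Measure (Y k)) (ρ : Measure (Equiv.Perm (Fin K)))
    (i : Fin 2) (T : Path Y → ℕ∞) : ℝ≥0∞ :=
  ∫⁻ ω, ((T ω : ℕ∞) : ℝ≥0∞) ∂(law μ ρ i)

/-! ### The centralized SPRT -/

/-- The stopping time `S = inf {t > 0 : L_t ∉ (-B, A)}` of the centralized SPRT. -/
def sprtTime (μ : Fin 2 → (k : Fin K) → Measure (Y k)) (A B : ℝ) (ω : Path Y) : ℕ∞ :=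
  firstTime fun t => 0 < t ∧ globalLLR μ t ω ∉ Set.Ioo (-B) A

/-- The event that the centralized SPRT stops and decides for `H_1`. -/
def sprtDecides1 (μ : Fin 2 → (k : Fin K) → Measure (Y k)) (A B : ℝ) : Set (Path Y) :=
  {ω | ∃ t : ℕ, sprtTime μ A B ω = t ∧ A ≤ globalLLR μ t ω}

/-- The event that the centralized SPRT stops and decides for `H_0`. -/
def sprtDecides0 (μ : Fin 2 → (k : Fin K) → Measure (Y k)) (A B : ℝ) : Set (Path Y) :=
  {ω | ∃ t : ℕ, sprtTime μ A B ω = t ∧ globalLLR μ t ω ≤ -B}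

/-! ### Level-triggered sampling at the SUs -/

/-- The last time `≤ t` at which SU `k` has sampled (`0` if it has not sampled yet): the SU samples
at a time `t` when `L^k_t` differs by at least `Δ` from its value at the previous sampling time. -/
def lastSample (μ : Fin 2 → (k : Fin K) → Measure (Y k)) (Δ : ℝ) (k : Fin K) (ω : Path Y) : ℕ → ℕ
  | 0 => 0
  | t + 1 =>
    if Δ ≤ |localLLR μ k (t + 1) ω - localLLR μ k (lastSample μ Δ k ω t) ω| then t + 1
    else lastSample μ Δ k ω t

/-- The randomized quantization of an overshoot `q ∈ [0, φ)`, with seed `u` uniform on `[0,1]`: with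
`ε = φ / r` and `m = ⌊q r / φ⌋`, it is `m ε` with probability
`p = (1 - exp (q - (m + 1) ε)) / (1 - exp (-ε))` and `(m + 1) ε` with probability `1 - p`. For
`r = 0` the overshoot is not transmitted at all. -/
def quantize (φ : ℝ) (r : ℕ) (q u : ℝ) : ℝ :=
  if r = 0 then 0
  else
    if u < (1 - Real.exp (q - ((⌊q * r / φ⌋ : ℝ) + 1) * (φ / r))) / (1 - Real.exp (-(φ / r))) then
      (⌊q * r / φ⌋ : ℝ) * (φ / r)
    else ((⌊q * r / φ⌋ : ℝ) + 1) * (φ / r)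

/-- The message that SU `k` sends at time `t + 1`, given through the increment `b (Δ + q̂)` that it
stands for, where `b` is the sign of the increment `λ` of the local log-likelihood ratio since the
previous sampling time and `q̂` is the quantized value of the overshoot `|λ| - Δ`; `none` if the SU
does not sample at time `t + 1`. -/
def message (μ : Fin 2 → (k : Fin K) → Measure (Y k)) (φ Δ : ℝ) (r : ℕ) (k : Fin K) (t : ℕ)
    (ω : Path Y) : Option ℝ :=
  let lam : ℝ := localLLR μ k (t + 1) ω - localLLR μ k (lastSample μ Δ k ω t) ω
  if Δ ≤ |lam| then
    some (Real.sign lam * (Δ + quantize φ r (|lam| - Δ) (((ω t).1 k).2 : ℝ)))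
  else none

/-! ### The fusion center and the RLT-SPRT -/

/-- The messages received by the fusion center up to time `t`, in the order in which it processes
them. -/
def received (μ : Fin 2 → (k : Fin K) → Measure (Y k)) (φ Δ : ℝ) (r : ℕ) (t : ℕ) (ω : Path Y) :
    List ℝ :=
  (List.range t).flatMap fun s =>
    ((List.finRange K).map (ω s).2).filterMap fun k => message μ φ Δ r k s ω

/-- The time `t_n` at which the fusion center receives the `n`-th message (`⊤` if it never does). -/
def commTime (μ : Fin 2 → (k : Fin K) → Measure (Y k)) (φ Δ : ℝ) (r : ℕ) (n : ℕ) (ω : Path Y) :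
    ℕ∞ :=
  firstTime fun t => n ≤ (received μ φ Δ r t ω).length

/-- The test statistic of the fusion center after it has processed the `n`-th message (meaningful if
there are `n` messages): the sum of the first `n` increments received. -/
def fusionLLR (μ : Fin 2 → (k : Fin K) → Measure (Y k)) (φ Δ : ℝ) (r : ℕ) (n : ℕ) (ω : Path Y) :
    ℝ :=
  ((received μ φ Δ r (commTime μ φ Δ r n ω).toNat ω).take n).sum

/-- The number `N` of messages that are processed until the test statistic leaves `(-B, A)`. -/
def rltCount (μ : Fin 2 → (k : Fin K) → Measure (Y k)) (φ Δ : ℝ) (r : ℕ) (A B : ℝ) (ω : Path Y) :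
    ℕ∞ :=
  firstTime fun n => 0 < n ∧ commTime μ φ Δ r n ω ≠ ⊤ ∧ fusionLLR μ φ Δ r n ω ∉ Set.Ioo (-B) A

/-- The stopping time `t_N` of the RLT-SPRT, in physical time units. -/
def rltTime (μ : Fin 2 → (k : Fin K) → Measure (Y k)) (φ Δ : ℝ) (r : ℕ) (A B : ℝ) (ω : Path Y) :
    ℕ∞ :=
  if rltCount μ φ Δ r A B ω = ⊤ then ⊤
  else commTime μ φ Δ r (rltCount μ φ Δ r A B ω).toNat ω

/-- The event that the RLT-SPRT stops and decides for `H_1`. -/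
def rltDecides1 (μ : Fin 2 → (k : Fin K) → Measure (Y k)) (φ Δ : ℝ) (r : ℕ) (A B : ℝ) :
    Set (Path Y) :=
  {ω | ∃ n : ℕ, rltCount μ φ Δ r A B ω = n ∧ A ≤ fusionLLR μ φ Δ r n ω}

/-- The event that the RLT-SPRT stops and decides for `H_0`. -/
def rltDecides0 (μ : Fin 2 → (k : Fin K) → Measure (Y k)) (φ Δ : ℝ) (r : ℕ) (A B : ℝ) :
    Set (Path Y) :=
  {ω | ∃ n : ℕ, rltCount μ φ Δ r A B ω = n ∧ fusionLLR μ φ Δ r n ω ≤ -B}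

end LLR

/-- The asymptotic regime in which the sampling threshold `Δ ≥ Δ₀` or the number of overshoot
quantization levels `r` (or both) tend to infinity. -/
def largeParams (Δ₀ : ℝ) : Filter (ℝ × ℕ) :=
  comap (fun p : ℝ × ℕ => max p.1 (p.2 : ℝ)) atTop ⊓ 𝓟 {p | Δ₀ ≤ p.1}

end Sensing

end

noncomputable section

namespace Sensing

/-! ### Resampling a coordinate of a product measure -/

section ProductMeasure

variable {ι : Type*} {X : ι → Type*} [∀ i, MeasurableSpace (X i)]

/-! Both tests depend on the observations only through their log-likelihood ratios, so the
observations are replaced by these. The quantizer seeds and the processing orders have the same law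
under both hypotheses; they stay in the path as extra randomness and do not change the likelihood
ratio. Symmetry turns `H_0` into `H_1` with all signs reversed and the two thresholds exchanged, so
the upper bounds are needed only under `H_1`.

The inequality `0 ≤ …` is the Wald-Wolfowitz theorem (`wald_wolfowitz`), applied to the RLT-SPRT as
one more sequential test with the same error probabilities. Its proof is Bayesian. Under `H_1` the
process `x = exp (-L_t)` is a multiplicative walk with mean-one factors. For any running cost `p₁ +
p₀ x` there are terminal costs `w₀ x` and `w₁` for which the continuation region of the SPRT is
optimal (`IsRatioLaw.exists_terminal_costs`). Equal error probabilities give equal terminal costs,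
so a weighted sum of the two expected times is minimal; letting one weight tend to `0` separates
them.

The upper bound is the difference of two estimates. Wald's inequality (`expected_sprt_ge`) bounds
the SPRT from below by about `|log α| / (K I₁)`, without any control of its thresholds. For the
RLT-SPRT put `ε = φ / max r 1` and `δ = ε / (Δ tanh (Δ / 2))` (`relStep`); two facts are needed.

First, its threshold is not much larger than `|log α|`. Sampling times and quantized overshoots are
unchanged when the log-likelihood ratios that an SU has accumulated since its last sample are all
reversed. By symmetry an accumulated value `±z` has, given `z`, the sign `+` with probability `1 /
(1 + exp (-z))` under `H_1`. The quantizer is unbiased for the exponential in one direction and has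
a bias of order `ε ^ 2` in the other; lowering the exponent to `1 - 2 δ ^ 2` absorbs it. So the
exponential of the fusion statistic is a supermartingale once the signs are randomized
(`RLTParams.DownBounded`), and the error probability is at most `exp (-(1 - 2 δ ^ 2) B)`
(`RLTParams.measure_down_le`).

Second, it reaches the threshold quickly. Rounding loses at most `ε` per message. The function `z +
c Δ (1 - exp (-z)) / sinh Δ` has the same drift as `z`, because `exp (-x)` has mean one under `H_1`,
and convexity of the exponential bounds it by `(1 + c) z - c Δ tanh (Δ / 2)` for `|z| ≥ Δ`. With `c
= δ / (1 - δ)` the last term pays for the rounding, and optional stopping bounds the expected time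
(`RLTParams.tsum_alive_le`).

Together the factor in front of `|log α|` is `(1 + c) / (1 - 2 δ ^ 2) ≤ 1 + δ (1 + 8 δ)`. Its excess
over one gives the main term with `e₁ = 8 δ`. The boundary terms of the potential give `(Δ + φ) /
I₁` and `e₂`, and the terms of order `β` in Wald's inequality give `e₃`. -/

theorem measurable_update_prod [DecidableEq ι] (i : ι) :
    Measurable (fun p : ((j : ι) → X j) × X i => Function.update p.1 i p.2) :=
  measurable_pi_iff.2 fun j => by
    by_cases hj : j = i
    · subst hj
      simpa using measurable_snd
    · simp only [Function.update_of_ne hj]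
      fun_prop

/-- Resampling one coordinate of a product measure preserves it. -/
theorem measurePreserving_update_infinitePi [DecidableEq ι] (μ : (i : ι) → Measure (X i))
    [∀ i, IsProbabilityMeasure (μ i)] (i : ι) :
    MeasurePreserving (fun p : ((j : ι) → X j) × X i => Function.update p.1 i p.2)
      ((Measure.infinitePi μ).prod (μ i)) (Measure.infinitePi μ) := by
  have hm := measurable_update_prod (X := X) i
  refine ⟨hm, Measure.eq_infinitePi _ fun s t ht => ?_⟩
  rw [Measure.map_apply hm (.pi s.countable_toSet fun _ _ => ht _)]
  by_cases hi : i ∈ s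
  · have : (fun p : ((j : ι) → X j) × X i => Function.update p.1 i p.2) ⁻¹' (s : Set ι).pi t
        = ((s.erase i : Finset ι) : Set ι).pi t ×ˢ t i := by
      ext ⟨x, y⟩
      simp only [Set.mem_preimage, Set.mem_pi, Set.mem_prod, Finset.coe_erase, Set.mem_sdiff,
        Set.mem_singleton_iff, Finset.mem_coe]
      constructor
      · intro h
        refine ⟨fun j hj => ?_, by simpa using h i hi⟩
        simpa [Function.update_of_ne hj.2] using h j hj.1
      · rintro ⟨h1, h2⟩ j hj
        by_cases hji : j = i
        · subst hji; simpa using h2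
        · simpa [Function.update_of_ne hji] using h1 j ⟨hj, hji⟩
    rw [this, Measure.prod_prod, Measure.infinitePi_pi _ fun j _ => ht j, mul_comm,
      Finset.mul_prod_erase s (fun j => μ j (t j)) hi]
  · have : (fun p : ((j : ι) → X j) × X i => Function.update p.1 i p.2) ⁻¹' (s : Set ι).pi t
        = (s : Set ι).pi t ×ˢ Set.univ := by
      ext ⟨x, y⟩
      simp only [Set.mem_preimage, Set.mem_pi, Set.mem_prod, Set.mem_univ, and_true]
      refine forall₂_congr fun j hj => ?_
      rw [Function.update_of_ne]
      rintro rfl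
      exact hi hj
    rw [this, Measure.prod_prod, Measure.infinitePi_pi _ fun j _ => ht j, measure_univ, mul_one]

/-- Takes the place of conditioning on the other coordinates. An event that depends on the
coordinates before `i` is unaffected by the update, so martingale arguments need no filtration. -/
theorem lintegral_infinitePi_update [DecidableEq ι] (μ : (i : ι) → Measure (X i))
    [∀ i, IsProbabilityMeasure (μ i)] (i : ι) {h : ((j : ι) → X j) → ℝ≥0∞} (hh : Measurable h) :
    ∫⁻ ω, h ω ∂(Measure.infinitePi μ) =
      ∫⁻ ω, ∫⁻ e, h (Function.update ω i e) ∂(μ i) ∂(Measure.infinitePi μ) := by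
  rw [← (measurePreserving_update_infinitePi μ i).lintegral_comp hh,
    lintegral_prod (fun p : ((j : ι) → X j) × X i => h (Function.update p.1 i p.2))
      (hh.comp (measurable_update_prod i)).aemeasurable]

theorem lintegral_pi_update [Fintype ι] [DecidableEq ι] (μ : (i : ι) → Measure (X i))
    [∀ i, IsProbabilityMeasure (μ i)] (i : ι) {h : ((j : ι) → X j) → ℝ≥0∞} (hh : Measurable h) :
    ∫⁻ ω, h ω ∂(Measure.pi μ) =
      ∫⁻ ω, ∫⁻ e, h (Function.update ω i e) ∂(μ i) ∂(Measure.pi μ) := by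
  simpa only [Measure.infinitePi_eq_pi] using lintegral_infinitePi_update μ i hh

theorem integral_infinitePi_update [DecidableEq ι] (μ : (i : ι) → Measure (X i))
    [∀ i, IsProbabilityMeasure (μ i)] (i : ι) {h : ((j : ι) → X j) → ℝ} (hm : Measurable h)
    (hh : Integrable h (Measure.infinitePi μ)) :
    ∫ ω, h ω ∂(Measure.infinitePi μ) =
      ∫ ω, ∫ e, h (Function.update ω i e) ∂(μ i) ∂(Measure.infinitePi μ) := by
  have mp := measurePreserving_update_infinitePi μ i
  have h2 : Integrable (fun p : ((j : ι) → X j) × X i => h (Function.update p.1 i p.2))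
      ((Measure.infinitePi μ).prod (μ i)) :=
    mp.integrable_comp_of_integrable hh
  rw [← integral_prod _ h2]
  conv_lhs => rw [← mp.map_eq]
  exact integral_map mp.measurable.aemeasurable (by rw [mp.map_eq]; exact hm.aestronglyMeasurable)

/-- On a box the product density is a product of functions of independent coordinates, so its
integral factorizes. -/
theorem pi_withDensity [Fintype ι] (μ : (i : ι) → Measure (X i))
    [∀ i, IsProbabilityMeasure (μ i)] {f : (i : ι) → X i → ℝ≥0∞} (hf : ∀ i, Measurable (f i))
    [∀ i, IsProbabilityMeasure ((μ i).withDensity (f i))] :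
    Measure.pi (fun i => (μ i).withDensity (f i)) =
      (Measure.pi μ).withDensity (fun y => ∏ i, f i (y i)) := by
  refine Measure.pi_eq fun s hs => ?_
  rw [withDensity_apply _ (.univ_pi hs), ← lintegral_indicator (.univ_pi hs)]
  have h1 : ∀ y : (i : ι) → X i, (Set.univ.pi s).indicator (fun y => ∏ i, f i (y i)) y =
      ∏ i, (s i).indicator (f i) (y i) := by
    intro y
    by_cases hy : y ∈ Set.univ.pi s
    · rw [Set.indicator_of_mem hy]
      refine Finset.prod_congr rfl fun i _ => ?_
      rw [Set.indicator_of_mem (hy i (Set.mem_univ i))]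
    · rw [Set.indicator_of_notMem hy]
      simp only [Set.mem_pi, Set.mem_univ, true_imp_iff, not_forall] at hy
      obtain ⟨i, hi⟩ := hy
      exact (Finset.prod_eq_zero (Finset.mem_univ i) (Set.indicator_of_notMem hi _)).symm
  simp_rw [h1]
  have hind := ProbabilityTheory.iIndepFun_pi (μ := μ) (X := fun i => (s i).indicator (f i))
    (fun i => ((hf i).indicator (hs i)).aemeasurable)
  have := ProbabilityTheory.lintegral_prod_eq_prod_lintegral_of_indepFun Finset.univ
    (fun i (y : (i : ι) → X i) => (s i).indicator (f i) (y i)) hind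
    (fun i => ((hf i).indicator (hs i)).comp (measurable_pi_apply i))
  rw [this]
  refine Finset.prod_congr rfl fun i _ => ?_
  rw [withDensity_apply _ (hs i), ← lintegral_indicator (hs i)]
  exact (measurePreserving_eval μ i).lintegral_comp ((hf i).indicator (hs i))

end ProductMeasure

/-! ### Exit problems for a multiplicative random walk -/

/-- `ζ` is the law of one factor of a nondegenerate likelihood ratio with bounded factors. -/
structure IsRatioLaw (ζ : Measure ℝ) : Prop where
  prob : IsProbabilityMeasure ζ
  pos : ∀ᵐ z ∂ζ, 0 < z
  bdd : ∃ M : ℝ, ∀ᵐ z ∂ζ, z ≤ M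
  mean : ∫ z, z ∂ζ = 1
  nontrivial : ¬ ∀ᵐ z ∂ζ, z = 1

namespace IsRatioLaw

variable {ζ : Measure ℝ}

theorem exists_bound (hζ : IsRatioLaw ζ) : ∃ M : ℝ, 1 ≤ M ∧ ∀ᵐ z ∂ζ, 0 < z ∧ z ≤ M := by
  obtain ⟨M, hM⟩ := hζ.bdd
  refine ⟨max M 1, le_max_right _ _, ?_⟩
  filter_upwards [hζ.pos, hM] with z h1 h2 using ⟨h1, h2.trans (le_max_left _ _)⟩

theorem integrable_of_bdd (hζ : IsRatioLaw ζ) {f : ℝ → ℝ} (hf : Measurable f) {C : ℝ}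
    (hC : ∀ᵐ z ∂ζ, |f z| ≤ C) : Integrable f ζ :=
  have := hζ.prob
  Integrable.of_bound hf.aestronglyMeasurable C (by simpa using hC)

theorem integrable_id (hζ : IsRatioLaw ζ) : Integrable (fun z => z) ζ := by
  obtain ⟨M, -, hM⟩ := hζ.exists_bound
  refine hζ.integrable_of_bdd measurable_id (C := M) ?_
  filter_upwards [hM] with z hz
  simpa [abs_of_pos hz.1] using hz.2

theorem integrable_sq (hζ : IsRatioLaw ζ) : Integrable (fun z => z ^ 2) ζ := by
  obtain ⟨M, -, hM⟩ := hζ.exists_bound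
  refine hζ.integrable_of_bdd (by fun_prop) (C := M ^ 2) ?_
  filter_upwards [hM] with z hz
  rw [abs_of_nonneg (sq_nonneg z)]
  exact pow_le_pow_left₀ hz.1.le hz.2 2

theorem lintegral_ofReal_mul (hζ : IsRatioLaw ζ) (x : ℝ) :
    ∫⁻ z, ENNReal.ofReal (x * z) ∂ζ = ENNReal.ofReal x := by
  have := hζ.prob
  rcases le_or_gt 0 x with hx | hx
  · simp_rw [ENNReal.ofReal_mul hx]
    rw [lintegral_const_mul _ (by fun_prop), ← ofReal_integral_eq_lintegral_ofReal
      hζ.integrable_id (hζ.pos.mono fun z hz => hz.le), hζ.mean]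
    simp
  · rw [ENNReal.ofReal_of_nonpos hx.le, lintegral_eq_zero_iff (by fun_prop)]
    filter_upwards [hζ.pos] with z hz
    simp only [Pi.zero_apply, ENNReal.ofReal_eq_zero]
    nlinarith

/-- The variance is positive. Hence the square of the walk has a strictly positive drift, which
forces it out of every bounded interval away from `0`. -/
theorem one_lt_integral_sq (hζ : IsRatioLaw ζ) : 1 < ∫ z, z ^ 2 ∂ζ := by
  have := hζ.prob
  have h1 : ∫ z, (z - 1) ^ 2 ∂ζ = ∫ z, z ^ 2 ∂ζ - 1 := by
    have : ∀ z : ℝ, (z - 1) ^ 2 = z ^ 2 - 2 * z + 1 := fun z => by ring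
    have hi : Integrable (fun z : ℝ => z ^ 2 - 2 * z) ζ :=
      hζ.integrable_sq.sub (hζ.integrable_id.const_mul 2)
    simp_rw [this]
    rw [integral_add hi (integrable_const _),
      integral_sub hζ.integrable_sq (hζ.integrable_id.const_mul 2), integral_const_mul, hζ.mean]
    simp
    ring
  have h2 : 0 < ∫ z, (z - 1) ^ 2 ∂ζ := by
    refine lt_of_le_of_ne (integral_nonneg fun z => sq_nonneg _) fun h => hζ.nontrivial ?_
    have hi : Integrable (fun z : ℝ => (z - 1) ^ 2) ζ := by
      have : ∀ z : ℝ, (z - 1) ^ 2 = z ^ 2 - 2 * z + 1 := fun z => by ring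
      simp_rw [this]
      exact (hζ.integrable_sq.sub (hζ.integrable_id.const_mul 2)).add (integrable_const _)
    have := (integral_eq_zero_iff_of_nonneg (fun z => sq_nonneg (z - 1)) hi).1 h.symm
    filter_upwards [this] with z hz
    have : z - 1 = 0 := by simpa using hz
    linarith
  linarith

theorem measure_gt_one (hζ : IsRatioLaw ζ) : ζ {z | 1 < z} ≠ 0 := by
  have := hζ.prob
  intro h
  have h1 : ∀ᵐ z ∂ζ, z ≤ 1 := by
    rw [ae_iff]; simpa using h
  have h2 : ∫ z, (1 - z) ∂ζ = 0 := by
    rw [integral_sub (integrable_const _) hζ.integrable_id, hζ.mean]; simp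
  have h3 := (integral_eq_zero_iff_of_nonneg_ae (f := fun z : ℝ => 1 - z)
    (by filter_upwards [h1] with z hz; simpa using hz)
    ((integrable_const _).sub hζ.integrable_id)).1 h2
  refine hζ.nontrivial ?_
  filter_upwards [h3] with z hz
  have : 1 - z = 0 := by simpa using hz
  linarith

theorem measure_lt_one (hζ : IsRatioLaw ζ) : ζ {z | z < 1} ≠ 0 := by
  have := hζ.prob
  intro h
  have h1 : ∀ᵐ z ∂ζ, 1 ≤ z := by
    rw [ae_iff]; simpa using h
  have h2 : ∫ z, (z - 1) ∂ζ = 0 := by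
    rw [integral_sub hζ.integrable_id (integrable_const _), hζ.mean]; simp
  have h3 := (integral_eq_zero_iff_of_nonneg_ae (f := fun z : ℝ => z - 1)
    (by filter_upwards [h1] with z hz; simpa using hz)
    (hζ.integrable_id.sub (integrable_const _))).1 h2
  refine hζ.nontrivial ?_
  filter_upwards [h3] with z hz
  have : z - 1 = 0 := by simpa using hz
  linarith

/-- A uniform factor `q`, so that a bounded number of favourable steps carries the walk past `b`. -/
theorem exists_measure_ge (hζ : IsRatioLaw ζ) : ∃ q : ℝ, 1 < q ∧ ζ {z | q ≤ z} ≠ 0 := by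
  by_contra! h
  refine hζ.measure_gt_one ?_
  have : {z : ℝ | 1 < z} ⊆ ⋃ n : ℕ, {z | 1 + 1 / ((n : ℝ) + 1) ≤ z} := by
    intro z hz
    obtain ⟨n, hn⟩ := exists_nat_one_div_lt (K := ℝ) (sub_pos.2 hz)
    exact Set.mem_iUnion.2 ⟨n, by simp only [Set.mem_ofPred_eq]; linarith⟩
  refine measure_mono_null this (measure_iUnion_null fun n => h _ ?_)
  have : 0 < 1 / ((n : ℝ) + 1) := by positivity
  linarith

theorem exists_measure_le (hζ : IsRatioLaw ζ) : ∃ q : ℝ, 0 < q ∧ q < 1 ∧ ζ {z | z ≤ q} ≠ 0 := by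
  by_contra! h
  refine hζ.measure_lt_one ?_
  have : {z : ℝ | z < 1} ⊆ ⋃ n : ℕ, {z | z ≤ 1 - 1 / ((n : ℝ) + 2)} := by
    intro z hz
    obtain ⟨n, hn⟩ := exists_nat_one_div_lt (K := ℝ) (sub_pos.2 hz)
    refine Set.mem_iUnion.2 ⟨n, ?_⟩
    have : 1 / ((n : ℝ) + 2) ≤ 1 / ((n : ℝ) + 1) := by gcongr; norm_num
    simp only [Set.mem_ofPred_eq]; linarith
  refine measure_mono_null this (measure_iUnion_null fun n => h _ ?_ ?_)
  · have : 1 / ((n : ℝ) + 2) < 1 := by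
      rw [div_lt_one (by positivity)]
      have : (0 : ℝ) ≤ n := n.cast_nonneg
      linarith
    linarith
  · have : 0 < 1 / ((n : ℝ) + 2) := by positivity
    linarith

end IsRatioLaw

/-! ### Rewards of the killed walk, supersolutions and the minimum principle -/

section Potential

variable (ζ : Measure ℝ) (a b : ℝ)

/-- One step of the multiplicative walk, killed when it leaves `(a, b)`. -/
def killed (u : ℝ → ℝ≥0∞) (x : ℝ) : ℝ≥0∞ := ∫⁻ z, (Set.Ioo a b).indicator u (x * z) ∂ζ

/-- The total reward `r` collected in the first `n` steps before leaving `(a, b)`. -/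
def partialPotential (r : ℝ → ℝ≥0∞) : ℕ → ℝ → ℝ≥0∞
  | 0 => fun _ => 0
  | n + 1 => fun x => r x + killed ζ a b (partialPotential r n) x

/-- The total reward `r` collected before leaving `(a, b)`. -/
def potential (r : ℝ → ℝ≥0∞) (x : ℝ) : ℝ≥0∞ := ⨆ n, partialPotential ζ a b r n x

variable {ζ a b}

theorem measurable_killed [SFinite ζ] {u : ℝ → ℝ≥0∞} (hu : Measurable u) :
    Measurable (killed ζ a b u) := by
  unfold killed
  exact Measurable.lintegral_prod_right' (f := fun p : ℝ × ℝ => (Set.Ioo a b).indicator u (p.1 * p.2))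
    ((hu.indicator measurableSet_Ioo).comp (by fun_prop))

theorem killed_mono {u v : ℝ → ℝ≥0∞} (huv : ∀ x ∈ Set.Ioo a b, u x ≤ v x) (x : ℝ) :
    killed ζ a b u x ≤ killed ζ a b v x := by
  refine lintegral_mono fun z => ?_
  by_cases hz : x * z ∈ Set.Ioo a b
  · simpa only [Set.indicator_of_mem hz] using huv _ hz
  · simp only [Set.indicator_of_notMem hz, le_refl]

theorem killed_add_mul {u v : ℝ → ℝ≥0∞} (hu : Measurable u) (hv : Measurable v) (C : ℝ≥0∞) (x : ℝ) :
    killed ζ a b u x + C * killed ζ a b v x = killed ζ a b (fun y => u y + C * v y) x := by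
  unfold killed
  have h1 : Measurable fun z => (Set.Ioo a b).indicator u (x * z) :=
    (hu.indicator measurableSet_Ioo).comp (by fun_prop)
  have h2 : Measurable fun z => (Set.Ioo a b).indicator v (x * z) :=
    (hv.indicator measurableSet_Ioo).comp (by fun_prop)
  rw [← lintegral_const_mul C h2, ← lintegral_add_left h1]
  refine lintegral_congr fun z => ?_
  by_cases hz : x * z ∈ Set.Ioo a b
  · simp only [Set.indicator_of_mem hz]
  · simp only [Set.indicator_of_notMem hz, mul_zero, add_zero]

theorem measurable_partialPotential [SFinite ζ] {r : ℝ → ℝ≥0∞} (hr : Measurable r) (n : ℕ) :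
    Measurable (partialPotential ζ a b r n) := by
  induction n with
  | zero => exact measurable_const
  | succ n ih => exact hr.add (measurable_killed ih)

theorem measurable_potential [SFinite ζ] {r : ℝ → ℝ≥0∞} (hr : Measurable r) :
    Measurable (potential ζ a b r) := by
  unfold potential
  exact Measurable.iSup fun n => measurable_partialPotential hr n

theorem partialPotential_mono (r : ℝ → ℝ≥0∞) (x : ℝ) :
    Monotone fun n => partialPotential ζ a b r n x := by
  refine monotone_nat_of_le_succ fun n => ?_
  induction n generalizing x with
  | zero => exact zero_le
  | succ n ih => exact add_le_add le_rfl (killed_mono (fun y _ => ih y) x)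

/-- Monotone convergence in the number of steps. -/
theorem potential_eq [SFinite ζ] {r : ℝ → ℝ≥0∞} (hr : Measurable r) (x : ℝ) :
    potential ζ a b r x = r x + killed ζ a b (potential ζ a b r) x := by
  have h1 : killed ζ a b (potential ζ a b r) x =
      ⨆ n, killed ζ a b (partialPotential ζ a b r n) x := by
    unfold killed
    rw [← lintegral_iSup]
    · refine lintegral_congr fun z => ?_
      by_cases hz : x * z ∈ Set.Ioo a b
      · simp only [Set.indicator_of_mem hz, potential]
      · simp only [Set.indicator_of_notMem hz, ENNReal.iSup_zero]
    · exact fun n => ((measurable_partialPotential hr n).indicator measurableSet_Ioo).comp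
        (by fun_prop)
    · intro m n hmn z
      exact Set.indicator_le_indicator (partialPotential_mono r _ hmn)
  rw [h1, ENNReal.add_iSup]
  refine le_antisymm (iSup_le fun n => ?_) (iSup_le fun n => ?_)
  · exact (partialPotential_mono r x n.le_succ).trans
      (le_iSup (fun n => r x + killed ζ a b (partialPotential ζ a b r n) x) n)
  · exact le_iSup (fun n => partialPotential ζ a b r n x) (n + 1)

/-- Induction on the number of steps: a supersolution dominates every partial reward. It need only
be one on `I`, since a killed step evaluates it inside `(a, b)`. Two rewards are treated together
because exit estimates come in weighted pairs. -/
theorem potential_add_mul_le [SFinite ζ] {r r' s : ℝ → ℝ≥0∞} (hr : Measurable r)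
    (hr' : Measurable r') (C : ℝ≥0∞) {I : Set ℝ} (hI : Set.Ioo a b ⊆ I)
    (h : ∀ x ∈ I, r x + C * r' x + killed ζ a b s x ≤ s x) {x : ℝ} (hx : x ∈ I) :
    potential ζ a b r x + C * potential ζ a b r' x ≤ s x := by
  have key : ∀ n, ∀ x ∈ I,
      partialPotential ζ a b r n x + C * partialPotential ζ a b r' n x ≤ s x := by
    intro n
    induction n with
    | zero => intro x _; simp [partialPotential]
    | succ n ih =>
      intro x hx
      refine le_trans ?_ (h x hx)
      simp only [partialPotential]
      rw [mul_add, add_add_add_comm, killed_add_mul (measurable_partialPotential hr n)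
        (measurable_partialPotential hr' n)]
      exact add_le_add le_rfl (killed_mono (fun y hy => ih y (hI hy)) x)
  unfold potential
  rw [ENNReal.mul_iSup, ENNReal.iSup_add_iSup_of_monotone (partialPotential_mono r x)
    fun m n hmn => mul_le_mul_right (partialPotential_mono r' x hmn) _]
  exact iSup_le fun n => key n x hx

/-- A bounded function that dominates one plus its own value after a killed step. -/
theorem IsRatioLaw.exists_supersolution (hζ : IsRatioLaw ζ) (ha : 0 < a) (hab : a < b) :
    ∃ (s : ℝ → ℝ) (S : ℝ), Measurable s ∧ (∀ x, 0 ≤ s x ∧ s x ≤ S) ∧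
      ∀ x ∈ Set.Icc a b, 1 + ∫ z, (Set.Ioo a b).indicator s (x * z) ∂ζ ≤ s x := by
  have := hζ.prob
  obtain ⟨M, hM1, hM⟩ := hζ.exists_bound
  have hE := hζ.one_lt_integral_sq
  set E := ∫ z, z ^ 2 ∂ζ
  -- One step lowers `-C x ^ 2` on average by `C x ^ 2 (E - 1)`; this `C` makes the decrease at
  -- least `1` for all `x ≥ a`.
  set C := 1 / (a ^ 2 * (E - 1)) with hC
  have hC0 : 0 < C := by
    have : 0 < E - 1 := by linarith
    positivity
  -- No single step from `[a, b]` leads above `b M`, so the formula stays nonnegative after an exit,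
  -- where the killed value is `0`.
  set s : ℝ → ℝ := (Set.Icc a b).indicator fun x => C * (b ^ 2 * M ^ 2 - x ^ 2) with hs
  have hb : 0 < b := ha.trans hab
  have hnn : ∀ x, 0 ≤ s x ∧ s x ≤ C * (b ^ 2 * M ^ 2) := by
    intro x
    by_cases hx : x ∈ Set.Icc a b
    · simp only [hs, Set.indicator_of_mem hx]
      have h1 : x ^ 2 ≤ b ^ 2 := pow_le_pow_left₀ (ha.le.trans hx.1) hx.2 2
      have h2 : b ^ 2 * 1 ≤ b ^ 2 * M ^ 2 := by
        gcongr; exact one_le_pow₀ hM1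
      constructor
      · apply mul_nonneg hC0.le; linarith
      · apply mul_le_mul_of_nonneg_left _ hC0.le; nlinarith [sq_nonneg x]
    · simp only [hs, Set.indicator_of_notMem hx]
      exact ⟨le_rfl, by positivity⟩
  have hsm : Measurable s := Measurable.indicator (by fun_prop) measurableSet_Icc
  refine ⟨s, _, hsm, hnn, fun x hx => ?_⟩
  have hx0 : 0 < x := ha.trans_le hx.1
  have h1 : ∫ z, (Set.Ioo a b).indicator s (x * z) ∂ζ ≤
      ∫ z, C * (b ^ 2 * M ^ 2 - x ^ 2 * z ^ 2) ∂ζ := by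
    refine integral_mono_ae ?_ ?_ ?_
    · refine hζ.integrable_of_bdd (C := C * (b ^ 2 * M ^ 2))
        ((hsm.indicator measurableSet_Ioo).comp (by fun_prop)) (ae_of_all _ fun z => ?_)
      by_cases hz : x * z ∈ Set.Ioo a b
      · rw [Set.indicator_of_mem hz, abs_of_nonneg (hnn _).1]
        exact (hnn _).2
      · rw [Set.indicator_of_notMem hz, abs_zero]; positivity
    · exact ((integrable_const _).sub (hζ.integrable_sq.const_mul _)).const_mul _
    · filter_upwards [hM] with z hz
      by_cases hxz : x * z ∈ Set.Ioo a b
      · rw [Set.indicator_of_mem hxz, hs, Set.indicator_of_mem (Set.Ioo_subset_Icc_self hxz),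
          mul_pow]
      · rw [Set.indicator_of_notMem hxz]
        have h3 : x ^ 2 ≤ b ^ 2 := pow_le_pow_left₀ hx0.le hx.2 2
        have h4 : z ^ 2 ≤ M ^ 2 := pow_le_pow_left₀ hz.1.le hz.2 2
        have : x ^ 2 * z ^ 2 ≤ b ^ 2 * M ^ 2 := by gcongr
        apply mul_nonneg hC0.le; linarith
  have h2 : ∫ z, C * (b ^ 2 * M ^ 2 - x ^ 2 * z ^ 2) ∂ζ = C * (b ^ 2 * M ^ 2 - x ^ 2 * E) := by
    have h0 : ∫ z, x ^ 2 * z ^ 2 ∂ζ = x ^ 2 * E := integral_const_mul _ _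
    rw [integral_const_mul, integral_sub (integrable_const _) (hζ.integrable_sq.const_mul _), h0]
    simp
  have h3 : s x = C * (b ^ 2 * M ^ 2 - x ^ 2) := by
    simp only [hs, Set.indicator_of_mem hx]
  have h4 : 1 ≤ C * (x ^ 2 * (E - 1)) := by
    have : a ^ 2 ≤ x ^ 2 := pow_le_pow_left₀ ha.le hx.1 2
    have h5 : 0 < E - 1 := by linarith
    rw [hC, one_div, inv_mul_eq_div, one_le_div (by positivity)]
    gcongr
  rw [h3]
  nlinarith

/-- Minimum principle. -/
theorem IsRatioLaw.nonneg_of_superharmonic (hζ : IsRatioLaw ζ) (ha : 0 < a) (hab : a < b)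
    {d : ℝ → ℝ} (hd : Measurable d) {M : ℝ} (hM : ∀ x, |d x| ≤ M)
    (hout : ∀ x, 0 < x → x ∉ Set.Ioo a b → 0 ≤ d x)
    (hin : ∀ x ∈ Set.Ioo a b, ∫ z, d (x * z) ∂ζ ≤ d x) {x : ℝ} (hx : 0 < x) : 0 ≤ d x := by
  have := hζ.prob
  by_cases hxm : x ∈ Set.Ioo a b
  swap
  · exact hout x hx hxm
  obtain ⟨s, S, hs, hsb, hsuper⟩ := hζ.exists_supersolution ha hab
  have hM0 : 0 ≤ M := (abs_nonneg _).trans (hM 0)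
  have hs1 : ∀ y ∈ Set.Icc a b, 1 ≤ s y := by
    intro y hy
    refine le_trans ?_ (hsuper y hy)
    have : 0 ≤ ∫ z, (Set.Ioo a b).indicator s (y * z) ∂ζ :=
      integral_nonneg fun z => Set.indicator_nonneg (fun w _ => (hsb w).1) _
    linarith
  have hS : 1 ≤ S := (hs1 a ⟨le_rfl, hab.le⟩).trans (hsb a).2
  -- On the interval `s ≤ S` gives `s - 1 ≤ ρ s`, so each use of the supersolution inequality
  -- improves the lower bound `-M s` for `d` by the factor `ρ < 1`.
  set ρ := 1 - 1 / S
  have hρ0 : 0 ≤ ρ := by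
    have : 1 / S ≤ 1 := by rw [div_le_one (by linarith)]; exact hS
    simp only [ρ]; linarith
  have hρ1 : ρ < 1 := by
    have : 0 < 1 / S := by positivity
    simp only [ρ]; linarith
  have key : ∀ n : ℕ, ∀ y ∈ Set.Ioo a b, -(M * ρ ^ n * s y) ≤ d y := by
    intro n
    induction n with
    | zero =>
      intro y hy
      have h1 := (abs_le.1 (hM y)).1
      have h2 := hs1 y (Set.Ioo_subset_Icc_self hy)
      simp only [pow_zero, mul_one]
      nlinarith
    | succ n ih =>
      intro y hy
      have hy0 : 0 < y := ha.trans hy.1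
      have hm : 0 ≤ M * ρ ^ n := by positivity
      have hind : Integrable (fun z => (Set.Ioo a b).indicator s (y * z)) ζ := by
        refine hζ.integrable_of_bdd (C := S)
          ((hs.indicator measurableSet_Ioo).comp (by fun_prop)) (ae_of_all _ fun z => ?_)
        by_cases hz : y * z ∈ Set.Ioo a b
        · rw [Set.indicator_of_mem hz, abs_of_nonneg (hsb _).1]
          exact (hsb _).2
        · rw [Set.indicator_of_notMem hz, abs_zero]; linarith
      have h1 : ∫ z, -(M * ρ ^ n) * (Set.Ioo a b).indicator s (y * z) ∂ζ ≤
          ∫ z, d (y * z) ∂ζ := by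
        refine integral_mono_ae (hind.const_mul _) ?_ ?_
        · exact hζ.integrable_of_bdd (hd.comp (by fun_prop)) (ae_of_all _ fun z => hM _)
        · filter_upwards [hζ.pos] with z hz
          by_cases hyz : y * z ∈ Set.Ioo a b
          · rw [Set.indicator_of_mem hyz]
            have := ih _ hyz
            linarith
          · rw [Set.indicator_of_notMem hyz, mul_zero]
            exact hout _ (by positivity) hyz
      rw [integral_const_mul] at h1
      have h2 := hsuper y (Set.Ioo_subset_Icc_self hy)
      have h3 : ρ * s y ≥ s y - 1 := by
        have : s y / S ≤ 1 := by rw [div_le_one (by linarith)]; exact (hsb y).2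
        have : ρ * s y = s y - s y / S := by simp only [ρ]; ring
        linarith
      have h4 := hin y hy
      have h5 : (M * ρ ^ n) * (∫ z, (Set.Ioo a b).indicator s (y * z) ∂ζ) ≤
          (M * ρ ^ n) * (ρ * s y) := by
        apply mul_le_mul_of_nonneg_left _ hm; linarith
      have : M * ρ ^ (n + 1) * s y = (M * ρ ^ n) * (ρ * s y) := by ring
      rw [this]
      linarith
  have hlim : Tendsto (fun n : ℕ => -(M * ρ ^ n * s x)) atTop (𝓝 (-(M * 0 * s x))) :=
    (((tendsto_pow_atTop_nhds_zero_of_lt_one hρ0 hρ1).const_mul M).mul_const _).neg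
  simp only [mul_zero, zero_mul, neg_zero] at hlim
  exact le_of_tendsto' hlim fun n => key n x hxm

end Potential

/-! ### Exit distributions and weights of indifference -/

section ExitRewards

variable {ζ : Measure ℝ} {a b : ℝ}

/-- The expected value of the walk after one step on the event that it is then at most `a`. -/
def rewardBelow (ζ : Measure ℝ) (a x : ℝ) : ℝ≥0∞ :=
  ∫⁻ z, (Set.Iic a).indicator ENNReal.ofReal (x * z) ∂ζ

/-- The probability that the walk is at least `b` after one step. -/
def rewardAbove (ζ : Measure ℝ) (b x : ℝ) : ℝ≥0∞ :=
  ∫⁻ z, (Set.Ici b).indicator (fun _ => 1) (x * z) ∂ζ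

theorem measurable_indicator_mul {s : Set ℝ} (hs : MeasurableSet s) {f : ℝ → ℝ≥0∞}
    (hf : Measurable f) (x : ℝ) : Measurable fun z => s.indicator f (x * z) :=
  (hf.indicator hs).comp (measurable_const.mul measurable_id)

theorem measurable_rewardBelow [SFinite ζ] : Measurable (rewardBelow ζ a) := by
  unfold rewardBelow
  exact Measurable.lintegral_prod_right'
    (f := fun p : ℝ × ℝ => (Set.Iic a).indicator ENNReal.ofReal (p.1 * p.2))
    ((ENNReal.measurable_ofReal.indicator measurableSet_Iic).comp (by fun_prop))

theorem measurable_rewardAbove [SFinite ζ] : Measurable (rewardAbove ζ b) := by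
  unfold rewardAbove
  exact Measurable.lintegral_prod_right'
    (f := fun p : ℝ × ℝ => (Set.Ici b).indicator (fun _ => (1 : ℝ≥0∞)) (p.1 * p.2))
    ((measurable_const.indicator measurableSet_Ici).comp (by fun_prop))

/-- The walk is a nonnegative martingale, so its mean at the exit is at most `x`; exit values above
are replaced by the smaller `b`. -/
theorem IsRatioLaw.below_add_above_le (hζ : IsRatioLaw ζ) (hab : a < b) (x : ℝ) :
    potential ζ a b (rewardBelow ζ a) x + ENNReal.ofReal b * potential ζ a b (rewardAbove ζ b) x ≤
      ENNReal.ofReal x := by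
  have := hζ.prob
  refine potential_add_mul_le measurable_rewardBelow measurable_rewardAbove _ (I := Set.univ)
    (Set.subset_univ _) (fun x _ => ?_) (Set.mem_univ x)
  rw [← hζ.lintegral_ofReal_mul x, rewardBelow, rewardAbove, killed, ← lintegral_const_mul _
    (measurable_indicator_mul measurableSet_Ici measurable_const x), ← lintegral_add_left
    (measurable_indicator_mul measurableSet_Iic ENNReal.measurable_ofReal x), ← lintegral_add_right]
  · refine lintegral_mono fun z => ?_
    rcases le_or_gt (x * z) a with h1 | h1
    · have h2 : x * z < b := h1.trans_lt hab
      simp [h1, h1.not_gt, h2.not_ge]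
    · rcases le_or_gt b (x * z) with h2 | h2
      · simp [h1.not_ge, h2, h2.not_gt, ENNReal.ofReal_le_ofReal h2]
      · simp [h1.not_ge, h2, h1, h2.not_ge]
  · exact measurable_indicator_mul measurableSet_Ioo ENNReal.measurable_ofReal x

/-- The two exit probabilities add up to at most one, and on a downward exit the value divided by
`a` is at most one. -/
theorem IsRatioLaw.above_add_below_le (hζ : IsRatioLaw ζ) (ha : 0 < a) (hab : a < b) (x : ℝ) :
    potential ζ a b (rewardAbove ζ b) x +
      ENNReal.ofReal (1 / a) * potential ζ a b (rewardBelow ζ a) x ≤ 1 := by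
  have := hζ.prob
  refine potential_add_mul_le (s := fun _ => 1) measurable_rewardAbove measurable_rewardBelow _
    (I := Set.univ) (Set.subset_univ _) (fun x _ => ?_) (Set.mem_univ x)
  have h1 : (1 : ℝ≥0∞) = ∫⁻ _, 1 ∂ζ := by simp
  conv_rhs => rw [h1]
  rw [rewardBelow, rewardAbove, killed, ← lintegral_const_mul _
    (measurable_indicator_mul measurableSet_Iic ENNReal.measurable_ofReal x), ← lintegral_add_left
    (measurable_indicator_mul measurableSet_Ici measurable_const x), ← lintegral_add_right]
  · refine lintegral_mono fun z => ?_
    rcases le_or_gt (x * z) a with h1 | h1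
    · have h2 : x * z < b := h1.trans_lt hab
      simp only [Set.mem_Ici, h2.not_ge, not_false_eq_true, Set.indicator_of_notMem, Set.mem_Iic,
        h1, Set.indicator_of_mem, zero_add, Set.mem_Ioo, h1.not_gt, false_and, add_zero]
      rw [← ENNReal.ofReal_mul (by positivity), ← ENNReal.ofReal_one]
      apply ENNReal.ofReal_le_ofReal
      rw [one_div, inv_mul_eq_div, div_le_one ha]
      exact h1
    · rcases le_or_gt b (x * z) with h2 | h2
      · simp [h1.not_ge, h2, h2.not_gt]
      · simp [h1.not_ge, h2, h1, h2.not_ge]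
  · exact measurable_indicator_mul measurableSet_Ioo measurable_const x

theorem lintegral_ne_zero_of_pos_on {f : ℝ → ℝ≥0∞} (hf : Measurable f) {s : Set ℝ} (hs : ζ s ≠ 0)
    (h : ∀ᵐ z ∂ζ, z ∈ s → f z ≠ 0) : ∫⁻ z, f z ∂ζ ≠ 0 := by
  intro h0
  rw [lintegral_eq_zero_iff hf] at h0
  refine hs (measure_mono_null ?_ (ae_iff.1 (h.and h0)))
  intro z hz hz2
  exact hz2.1 hz hz2.2

/-- Enough consecutive factors at least `q > 1` lead from `x` past `b` and have positive
probability. -/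
theorem IsRatioLaw.above_pos (hζ : IsRatioLaw ζ) (ha : 0 < a) {x : ℝ} (hx : a ≤ x) :
    potential ζ a b (rewardAbove ζ b) x ≠ 0 := by
  have := hζ.prob
  obtain ⟨q, hq1, hq⟩ := hζ.exists_measure_ge
  have key : ∀ n : ℕ, ∀ x, a ≤ x → b ≤ x * q ^ n → potential ζ a b (rewardAbove ζ b) x ≠ 0 := by
    intro n
    induction n with
    | zero =>
      intro x hx hb
      rw [potential_eq measurable_rewardAbove, rewardAbove]
      refine fun h => lintegral_ne_zero_of_pos_on (measurable_indicator_mul measurableSet_Ici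
        measurable_const x) hq (ae_of_all _ fun z hz => ?_) (add_eq_zero.1 h).1
      have : b ≤ x * z := by
        have h1 : (1 : ℝ) ≤ z := hq1.le.trans hz
        have h2 : x * 1 ≤ x * z := mul_le_mul_of_nonneg_left h1 (ha.le.trans hx)
        simp only [pow_zero] at hb
        linarith
      simp [this]
    | succ n ih =>
      intro x hx hb
      rw [potential_eq measurable_rewardAbove, rewardAbove, killed, ← lintegral_add_left
        (measurable_indicator_mul measurableSet_Ici measurable_const x)]
      refine lintegral_ne_zero_of_pos_on ((measurable_indicator_mul measurableSet_Ici
        measurable_const x).add (measurable_indicator_mul measurableSet_Ioo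
        (measurable_potential measurable_rewardAbove) x)) hq (ae_of_all _ fun z hz => ?_)
      have hz' : q ≤ z := hz
      have h0 : x * q ≤ x * z := mul_le_mul_of_nonneg_left hz' (ha.le.trans hx)
      have h1 : a < x * z := by nlinarith
      rcases le_or_gt b (x * z) with h2 | h2
      · simp [h2]
      · have h3 := ih (x * z) h1.le <| by
          refine hb.trans ?_
          rw [pow_succ', ← mul_assoc]
          exact mul_le_mul_of_nonneg_right h0 (by positivity)
        simp [h1, h2, h3]
  have hx0 : 0 < x := ha.trans_le hx
  obtain ⟨n, hn⟩ := pow_unbounded_of_one_lt (b / x) hq1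
  refine key n x hx ?_
  rw [div_lt_iff₀ hx0] at hn
  linarith

theorem IsRatioLaw.below_pos (hζ : IsRatioLaw ζ) (ha : 0 < a) {x : ℝ} (hx0 : 0 < x) (hx : x ≤ b) :
    potential ζ a b (rewardBelow ζ a) x ≠ 0 := by
  have := hζ.prob
  obtain ⟨q, hq0, hq1, hq⟩ := hζ.exists_measure_le
  have key : ∀ n : ℕ, ∀ x, 0 < x → x ≤ b → x * q ^ n ≤ a →
      potential ζ a b (rewardBelow ζ a) x ≠ 0 := by
    intro n
    induction n with
    | zero =>
      intro x hx0 hx hb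
      rw [potential_eq measurable_rewardBelow, rewardBelow]
      refine fun h => lintegral_ne_zero_of_pos_on (measurable_indicator_mul measurableSet_Iic
        ENNReal.measurable_ofReal x) hq (hζ.pos.mono fun z hz0 hz => ?_) (add_eq_zero.1 h).1
      have hz' : z ≤ q := hz
      have h2 : x * z ≤ a := by
        have h2 : x * z ≤ x * 1 := mul_le_mul_of_nonneg_left (hz'.trans hq1.le) hx0.le
        simp only [pow_zero] at hb
        linarith
      have h3 : 0 < x * z := by positivity
      simp [h2, h3]
    | succ n ih =>
      intro x hx0 hx hb
      rw [potential_eq measurable_rewardBelow, rewardBelow, killed, ← lintegral_add_left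
        (measurable_indicator_mul measurableSet_Iic ENNReal.measurable_ofReal x)]
      refine lintegral_ne_zero_of_pos_on ((measurable_indicator_mul measurableSet_Iic
        ENNReal.measurable_ofReal x).add (measurable_indicator_mul measurableSet_Ioo
        (measurable_potential measurable_rewardBelow) x)) hq (hζ.pos.mono fun z hz0 hz => ?_)
      have hz' : z ≤ q := hz
      have h0 : x * z ≤ x * q := mul_le_mul_of_nonneg_left hz' hx0.le
      have h1 : x * z < b := by nlinarith
      have h4 : 0 < x * z := by positivity
      rcases le_or_gt (x * z) a with h2 | h2
      · simp [h2, h4]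
      · have h3 := ih (x * z) h4 h1.le <| by
          refine le_trans ?_ hb
          rw [pow_succ', ← mul_assoc]
          exact mul_le_mul_of_nonneg_right h0 (by positivity)
        simp [h1, h2, h3]
  obtain ⟨n, hn⟩ := exists_pow_lt_of_lt_one (div_pos ha hx0) hq1
  refine key n x hx0 hx ?_
  rw [lt_div_iff₀ hx0] at hn
  linarith

/-- Cramer's rule. Multiplying the two hypotheses gives `(a - α₀) (1 - β₁) ≥ (b / a) α₁ β₀ > α₁ β₀`,
so the determinant is positive, and so are both numerators. -/
theorem exists_pos_solution {a b α₀ α₁ β₀ β₁ g g' : ℝ} (ha : 0 < a) (hab : a < b)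
    (hα₁ : 0 < α₁) (hβ₀ : 0 < β₀) (hg : 0 < g) (hg' : 0 < g')
    (h1 : α₀ + b * α₁ ≤ a) (h2 : β₁ + 1 / a * β₀ ≤ 1) :
    ∃ w₀ w₁ : ℝ, 0 < w₀ ∧ 0 < w₁ ∧ w₀ * α₀ + w₁ * α₁ + g = w₀ * a ∧
      w₀ * β₀ + w₁ * β₁ + g' = w₁ := by
  have hb : 0 < b := ha.trans hab
  have e1 : b * α₁ ≤ a - α₀ := by linarith
  have e2 : 1 / a * β₀ ≤ 1 - β₁ := by linarith
  have e3 : (b * α₁) * (1 / a * β₀) ≤ (a - α₀) * (1 - β₁) :=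
    mul_le_mul e1 e2 (by positivity) (le_trans (by positivity) e1)
  have e4 : α₁ * β₀ < (b * α₁) * (1 / a * β₀) := by
    have : (b * α₁) * (1 / a * β₀) = (b / a) * (α₁ * β₀) := by ring
    rw [this]
    have : 1 < b / a := by rw [one_lt_div ha]; exact hab
    have h0 : 0 < α₁ * β₀ := by positivity
    nlinarith
  have hD : 0 < (a - α₀) * (1 - β₁) - α₁ * β₀ := by linarith
  have p1 : 0 < a - α₀ := lt_of_lt_of_le (by positivity) e1
  have p2 : 0 < 1 - β₁ := lt_of_lt_of_le (by positivity) e2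
  obtain ⟨D, hDe⟩ : ∃ D, D = (a - α₀) * (1 - β₁) - α₁ * β₀ := ⟨_, rfl⟩
  rw [← hDe] at hD
  refine ⟨(g * (1 - β₁) + α₁ * g') / D, ((a - α₀) * g' + β₀ * g) / D, by positivity,
    by positivity, ?_, ?_⟩
  · field_simp
    rw [hDe]
    ring
  · field_simp
    rw [hDe]
    ring

/-- Terminal weights that make stopping and continuing equally costly at both ends of `[a, b]`,
together with the expected cost `J` of stopping at the exit from `(a, b)`. -/
theorem IsRatioLaw.exists_indifferent (hζ : IsRatioLaw ζ) (ha : 0 < a) (hab : a < b) {p₀ p₁ : ℝ}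
    (hp₀ : 0 < p₀) (hp₁ : 0 < p₁) :
    ∃ w₀ w₁ : ℝ, 0 < w₀ ∧ 0 < w₁ ∧ ∃ (J : ℝ → ℝ) (C : ℝ), Measurable J ∧
      (∀ x, 0 < x → |J x| ≤ C) ∧ (∀ x, 0 < x → x ≤ a → J x = w₀ * x) ∧ (∀ x, b ≤ x → J x = w₁) ∧
      ∀ x ∈ Set.Icc a b, J x = p₁ + p₀ * x + ∫ z, J (x * z) ∂ζ := by
  have := hζ.prob
  have hb : 0 < b := ha.trans hab
  obtain ⟨s, S, hs, hsb, hsuper⟩ := hζ.exists_supersolution ha hab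
  set c : ℝ → ℝ≥0∞ := fun x => ENNReal.ofReal (p₁ + p₀ * x) with hc
  have hcm : Measurable c := by fun_prop
  set h0 := potential ζ a b (rewardBelow ζ a) with hh0
  set h1 := potential ζ a b (rewardAbove ζ b) with hh1
  set G := potential ζ a b c with hG
  have hh0m : Measurable h0 := measurable_potential measurable_rewardBelow
  have hh1m : Measurable h1 := measurable_potential measurable_rewardAbove
  have hGm : Measurable G := measurable_potential hcm
  set C₀ := p₁ + p₀ * b with hC₀
  have hC₀0 : 0 < C₀ := by positivity
  have hGle : ∀ x ∈ Set.Icc a b, G x ≤ ENNReal.ofReal (C₀ * S) := by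
    intro x hx
    -- The running cost is at most `C₀` on `[a, b]`, so `C₀ s` is a supersolution for it; the second
    -- reward gets weight `0`.
    have : G x + 0 * potential ζ a b c x ≤ ENNReal.ofReal (C₀ * s x) := by
      refine potential_add_mul_le (s := fun x => ENNReal.ofReal (C₀ * s x)) hcm hcm 0
        Set.Ioo_subset_Icc_self (fun x hx => ?_) hx
      have hind : Integrable (fun z => (Set.Ioo a b).indicator s (x * z)) ζ := by
        refine hζ.integrable_of_bdd (C := S)
          ((hs.indicator measurableSet_Ioo).comp (by fun_prop)) (ae_of_all _ fun z => ?_)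
        by_cases hz : x * z ∈ Set.Ioo a b
        · rw [Set.indicator_of_mem hz, abs_of_nonneg (hsb _).1]
          exact (hsb _).2
        · rw [Set.indicator_of_notMem hz, abs_zero]; exact (hsb 0).1.trans (hsb 0).2
      have h3 : killed ζ a b (fun x => ENNReal.ofReal (C₀ * s x)) x =
          ENNReal.ofReal (∫ z, C₀ * (Set.Ioo a b).indicator s (x * z) ∂ζ) := by
        rw [ofReal_integral_eq_lintegral_ofReal (hind.const_mul _)]
        · refine lintegral_congr fun z => ?_
          by_cases hz : x * z ∈ Set.Ioo a b
          · simp only [Set.indicator_of_mem hz]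
          · simp only [Set.indicator_of_notMem hz, mul_zero, ENNReal.ofReal_zero]
        · exact ae_of_all _ fun z => mul_nonneg hC₀0.le
            (Set.indicator_nonneg (fun w _ => (hsb w).1) _)
      rw [h3, zero_mul, add_zero, hc, ← ENNReal.ofReal_add, integral_const_mul]
      · apply ENNReal.ofReal_le_ofReal
        have h4 := hsuper x hx
        have h5 : p₁ + p₀ * x ≤ C₀ := by
          have := mul_le_mul_of_nonneg_left hx.2 hp₀.le
          linarith
        nlinarith
      · have := ha.trans_le hx.1
        positivity
      · exact integral_nonneg fun z => mul_nonneg hC₀0.le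
            (Set.indicator_nonneg (fun w _ => (hsb w).1) _)
    rw [zero_mul, add_zero] at this
    exact this.trans (ENNReal.ofReal_le_ofReal (mul_le_mul_of_nonneg_left (hsb x).2 hC₀0.le))
  have hh0le : ∀ x, h0 x ≤ ENNReal.ofReal x := fun x =>
    le_self_add.trans (hζ.below_add_above_le hab x)
  have hh1le : ∀ x, h1 x ≤ 1 := fun x => le_self_add.trans (hζ.above_add_below_le ha hab x)
  have hh0t : ∀ x, h0 x ≠ ⊤ := fun x => ne_top_of_le_ne_top ENNReal.ofReal_ne_top (hh0le x)
  have hh1t : ∀ x, h1 x ≠ ⊤ := fun x => ne_top_of_le_ne_top ENNReal.one_ne_top (hh1le x)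
  have hGt : ∀ x ∈ Set.Icc a b, G x ≠ ⊤ := fun x hx =>
    ne_top_of_le_ne_top ENNReal.ofReal_ne_top (hGle x hx)
  have hGpos : ∀ x ∈ Set.Icc a b, 0 < (G x).toReal := by
    intro x hx
    refine ENNReal.toReal_pos (fun h => ?_) (hGt x hx)
    rw [hG, potential_eq hcm] at h
    have h5 := (add_eq_zero.1 h).1
    have hx0 := ha.trans_le hx.1
    simp only [hc, ENNReal.ofReal_eq_zero] at h5
    have : 0 < p₁ + p₀ * x := by positivity
    linarith
  have haI : a ∈ Set.Icc a b := ⟨le_rfl, hab.le⟩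
  have hbI : b ∈ Set.Icc a b := ⟨hab.le, le_rfl⟩
  -- The two equations say that, started at `a` or at `b`, the expected terminal plus running cost
  -- of waiting for the exit equals the cost of stopping at once, `w₀ a` or `w₁`.
  obtain ⟨w₀, w₁, hw₀, hw₁, hea, heb⟩ := exists_pos_solution ha hab
    (ENNReal.toReal_pos (hζ.above_pos (b := b) ha le_rfl) (hh1t a))
    (ENNReal.toReal_pos (hζ.below_pos (a := a) ha hb le_rfl) (hh0t b))
    (hGpos a haI) (hGpos b hbI) (α₀ := (h0 a).toReal) (β₁ := (h1 b).toReal)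
    (by
      have := ENNReal.toReal_mono ENNReal.ofReal_ne_top (hζ.below_add_above_le hab a)
      rwa [ENNReal.toReal_add (hh0t a) (ENNReal.mul_ne_top ENNReal.ofReal_ne_top (hh1t a)),
        ENNReal.toReal_mul, ENNReal.toReal_ofReal hb.le, ENNReal.toReal_ofReal ha.le] at this)
    (by
      have := ENNReal.toReal_mono ENNReal.one_ne_top (hζ.above_add_below_le ha hab b)
      rwa [ENNReal.toReal_add (hh1t b) (ENNReal.mul_ne_top ENNReal.ofReal_ne_top (hh0t b)),
        ENNReal.toReal_mul, ENNReal.toReal_ofReal (by positivity), ENNReal.toReal_one] at this)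
  refine ⟨w₀, w₁, hw₀, hw₁, ?_⟩
  set Jp : ℝ → ℝ≥0∞ := fun x => ENNReal.ofReal w₀ * h0 x + ENNReal.ofReal w₁ * h1 x + G x with hJp
  have hJpm : Measurable Jp := by fun_prop
  set JE : ℝ → ℝ≥0∞ := fun y => ENNReal.ofReal w₀ * (Set.Iic a).indicator ENNReal.ofReal y +
    ENNReal.ofReal w₁ * (Set.Ici b).indicator (fun _ => 1) y + (Set.Ioo a b).indicator Jp y with hJE
  have hJEm : Measurable JE :=
    (((ENNReal.measurable_ofReal.indicator measurableSet_Iic).const_mul _).add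
      ((measurable_const.indicator measurableSet_Ici).const_mul _)).add
      (hJpm.indicator measurableSet_Ioo)
  have hJpeq : ∀ x, Jp x = c x + ∫⁻ z, JE (x * z) ∂ζ := by
    intro x
    have e1 : ∫⁻ z, JE (x * z) ∂ζ = ENNReal.ofReal w₀ * rewardBelow ζ a x +
        ENNReal.ofReal w₁ * rewardAbove ζ b x + killed ζ a b Jp x := by
      have m1 := measurable_indicator_mul (s := Set.Iic a) measurableSet_Iic
        ENNReal.measurable_ofReal x
      have m2 := measurable_indicator_mul (s := Set.Ici b) measurableSet_Ici
        (measurable_const (a := (1 : ℝ≥0∞))) x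
      have m3 : Measurable fun z =>
          ENNReal.ofReal w₀ * (Set.Iic a).indicator ENNReal.ofReal (x * z) +
            ENNReal.ofReal w₁ * (Set.Ici b).indicator (fun _ => (1 : ℝ≥0∞)) (x * z) :=
        (m1.const_mul _).add (m2.const_mul _)
      simp only [hJE]
      rw [lintegral_add_left m3,
        lintegral_add_left (m1.const_mul _), lintegral_const_mul _ m1, lintegral_const_mul _ m2]
      rfl
    have e2 : killed ζ a b Jp x = ENNReal.ofReal w₀ * killed ζ a b h0 x +
        ENNReal.ofReal w₁ * killed ζ a b h1 x + killed ζ a b G x := by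
      have m4 : Measurable fun y => G y + ENNReal.ofReal w₀ * h0 y := by fun_prop
      have e5 : Jp = fun y => (G y + ENNReal.ofReal w₀ * h0 y) + ENNReal.ofReal w₁ * h1 y := by
        funext y; simp only [hJp]; ring
      rw [e5, ← killed_add_mul m4 hh1m, ← killed_add_mul hGm hh0m]
      ring
    rw [e1, e2]
    simp only [hJp]
    rw [hh0, potential_eq measurable_rewardBelow, hh1, potential_eq measurable_rewardAbove, hG,
      potential_eq hcm]
    ring
  set C := w₀ * b + w₁ + C₀ * S with hC
  have hCS : 0 ≤ C₀ * S := mul_nonneg hC₀0.le ((hsb 0).1.trans (hsb 0).2)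
  have hJEle : ∀ y, JE y ≤ ENNReal.ofReal C := by
    intro y
    rcases le_or_gt y a with h2 | h2
    · have h3 : y < b := h2.trans_lt hab
      simp only [hJE, Set.mem_Iic, h2, Set.indicator_of_mem, Set.mem_Ici, h3.not_ge,
        not_false_eq_true, Set.indicator_of_notMem, Set.mem_Ioo, h2.not_gt, false_and, mul_zero,
        add_zero]
      rw [← ENNReal.ofReal_mul hw₀.le]
      apply ENNReal.ofReal_le_ofReal
      have := mul_le_mul_of_nonneg_left h3.le hw₀.le
      linarith
    · rcases le_or_gt b y with h3 | h3
      · simp only [hJE, Set.mem_Iic, h2.not_ge, Set.indicator_of_mem, Set.mem_Ici, h3,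
          not_false_eq_true, Set.indicator_of_notMem, Set.mem_Ioo, h3.not_gt, and_false, mul_zero,
          add_zero, zero_add, mul_one]
        apply ENNReal.ofReal_le_ofReal
        have : 0 ≤ w₀ * b := by positivity
        linarith
      · have hy : y ∈ Set.Ioo a b := ⟨h2, h3⟩
        simp only [hJE, Set.mem_Iic, h2.not_ge, Set.indicator_of_mem hy, Set.mem_Ici, h3.not_ge,
          not_false_eq_true, Set.indicator_of_notMem, mul_zero, zero_add, hJp]
        rw [hC, ENNReal.ofReal_add (by positivity) hCS, ENNReal.ofReal_add (by positivity) hw₁.le,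
          ENNReal.ofReal_mul hw₀.le]
        refine add_le_add (add_le_add ?_ ?_) (hGle y (Set.Ioo_subset_Icc_self hy))
        · exact mul_le_mul_right ((hh0le y).trans (ENNReal.ofReal_le_ofReal h3.le)) _
        · exact (mul_le_mul_right (hh1le y) _).trans (by rw [mul_one])
  have hJEt : ∀ y, JE y ≠ ⊤ := fun y => ne_top_of_le_ne_top ENNReal.ofReal_ne_top (hJEle y)
  have hbelow : ∀ x, 0 < x → x ≤ a → (JE x).toReal = w₀ * x := by
    intro x hx0 hx
    have h3 : x < b := hx.trans_lt hab
    simp only [hJE, Set.mem_Iic, hx, Set.indicator_of_mem, Set.mem_Ici, h3.not_ge,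
        not_false_eq_true, Set.indicator_of_notMem, Set.mem_Ioo, hx.not_gt, false_and, mul_zero,
        add_zero]
    rw [ENNReal.toReal_mul, ENNReal.toReal_ofReal hw₀.le, ENNReal.toReal_ofReal hx0.le]
  have habove : ∀ x, b ≤ x → (JE x).toReal = w₁ := by
    intro x hx
    have h2 : a < x := hab.trans_le hx
    simp only [hJE, Set.mem_Iic, h2.not_ge, Set.indicator_of_mem, Set.mem_Ici, hx,
          not_false_eq_true, Set.indicator_of_notMem, Set.mem_Ioo, hx.not_gt, and_false, mul_zero,
          add_zero, zero_add, mul_one]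
    rw [ENNReal.toReal_ofReal hw₁.le]
  have hJpr : ∀ x ∈ Set.Icc a b, (Jp x).toReal =
      w₀ * (h0 x).toReal + w₁ * (h1 x).toReal + (G x).toReal := by
    intro x hx
    have t1 := ENNReal.mul_ne_top (ENNReal.ofReal_ne_top (r := w₀)) (hh0t x)
    have t2 := ENNReal.mul_ne_top (ENNReal.ofReal_ne_top (r := w₁)) (hh1t x)
    simp only [hJp]
    rw [ENNReal.toReal_add (ENNReal.add_ne_top.2 ⟨t1, t2⟩) (hGt x hx), ENNReal.toReal_add t1 t2,
      ENNReal.toReal_mul, ENNReal.toReal_mul, ENNReal.toReal_ofReal hw₀.le,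
      ENNReal.toReal_ofReal hw₁.le]
  refine ⟨fun x => (JE x).toReal, C, hJEm.ennreal_toReal, fun x _ => ?_, hbelow, habove,
    fun x hx => ?_⟩
  · rw [abs_of_nonneg ENNReal.toReal_nonneg]
    exact ENNReal.toReal_le_of_le_ofReal (by positivity) (hJEle x)
  -- `JE` pays the terminal cost at the end points and `Jp` the cost of going on; they agree there
  -- by indifference. So the one-step equation holds on the closed interval.
  · have e1 : (JE x).toReal = (Jp x).toReal := by
      rcases hx.1.eq_or_lt with h2 | h2
      · rw [← h2, hbelow a ha le_rfl, hJpr a haI, hea]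
      · rcases hx.2.eq_or_lt with h3 | h3
        · rw [h3, habove b le_rfl, hJpr b hbI, heb]
        · have hy : x ∈ Set.Ioo a b := ⟨h2, h3⟩
          simp only [hJE, Set.mem_Iic, h2.not_ge, Set.indicator_of_mem hy, Set.mem_Ici, h3.not_ge,
            not_false_eq_true, Set.indicator_of_notMem, mul_zero, zero_add]
    have hx0 := ha.trans_le hx.1
    simp only []
    rw [e1, hJpeq x, ENNReal.toReal_add ENNReal.ofReal_ne_top, integral_toReal,
      ENNReal.toReal_ofReal (by positivity)]
    · exact (hJEm.comp (measurable_const.mul measurable_id)).aemeasurable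
    · exact ae_of_all _ fun z => (hJEle _).trans_lt ENNReal.ofReal_lt_top
    · refine ne_top_of_le_ne_top (b := ∫⁻ _, ENNReal.ofReal C ∂ζ) ?_
        (lintegral_mono fun z => hJEle _)
      simp

end ExitRewards

/-! ### The optimal stopping problem behind the SPRT -/

section ValueFunction

variable {ζ : Measure ℝ} {w₀ w₁ p₀ p₁ : ℝ}

/-- The optimal cost when at most `n` further observations may be taken. -/
def valueIter (ζ : Measure ℝ) (w₀ w₁ p₀ p₁ : ℝ) : ℕ → ℝ → ℝ
  -- The truncation `max x 0` keeps the cost nonnegative on all of `ℝ`; only `x ≥ 0` matters.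
  | 0 => fun x => min w₁ (w₀ * max x 0)
  | n + 1 => fun x => min (min w₁ (w₀ * max x 0))
      (p₁ + p₀ * max x 0 + ∫ z, valueIter ζ w₀ w₁ p₀ p₁ n (x * z) ∂ζ)

theorem measurable_integral_mul [SFinite ζ] {f : ℝ → ℝ} (hf : Measurable f) :
    Measurable fun x => ∫ z, f (x * z) ∂ζ :=
  ((hf.comp (measurable_fst.mul measurable_snd)).stronglyMeasurable.integral_prod_right'
    (f := fun p : ℝ × ℝ => f (p.1 * p.2))).measurable

/-- Concavity survives the iteration because averages of `x ↦ V (x z)` over positive `z` and minima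
with affine functions are concave. -/
theorem valueIter_spec (hζ : IsRatioLaw ζ) (hw₀ : 0 < w₀) (hw₁ : 0 < w₁) (hp₀ : 0 < p₀)
    (hp₁ : 0 < p₁) (n : ℕ) :
    Measurable (valueIter ζ w₀ w₁ p₀ p₁ n) ∧
      (∀ x, 0 ≤ valueIter ζ w₀ w₁ p₀ p₁ n x) ∧
      (∀ x, valueIter ζ w₀ w₁ p₀ p₁ n x ≤ min w₁ (w₀ * max x 0)) ∧
      ConcaveOn ℝ (Set.Ici 0) (valueIter ζ w₀ w₁ p₀ p₁ n) := by
  have := hζ.prob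
  have hmax : ∀ x : ℝ, 0 ≤ max x 0 := fun x => le_max_right _ _
  have hlin : ∀ c : ℝ, ConcaveOn ℝ (Set.Ici (0 : ℝ)) fun x => c * max x 0 := by
    intro c
    refine ⟨convex_Ici 0, fun x hx y hy s t hs ht hst => ?_⟩
    have hx' : (0 : ℝ) ≤ x := hx
    have hy' : (0 : ℝ) ≤ y := hy
    simp only [smul_eq_mul]
    rw [max_eq_left hx', max_eq_left hy', max_eq_left (by positivity)]
    exact le_of_eq (by ring)
  have hg : ConcaveOn ℝ (Set.Ici (0 : ℝ)) fun x => min w₁ (w₀ * max x 0) :=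
    (concaveOn_const w₁ (convex_Ici 0)).inf (hlin w₀)
  induction n with
  | zero =>
    refine ⟨by simp only [valueIter]; fun_prop, fun x => ?_, fun x => le_rfl, hg⟩
    exact le_min hw₁.le (mul_nonneg hw₀.le (hmax x))
  | succ n ih =>
    obtain ⟨hm, hnn, hle, hconc⟩ := ih
    set V := valueIter ζ w₀ w₁ p₀ p₁ n
    have hint : ∀ x, Integrable (fun z => V (x * z)) ζ := fun x =>
      hζ.integrable_of_bdd (C := w₁) (hm.comp (by fun_prop)) (ae_of_all _ fun z => by
        rw [abs_of_nonneg (hnn _)]; exact (hle _).trans (min_le_left _ _))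
    refine ⟨?_, fun x => ?_, fun x => min_le_left _ _, ?_⟩
    · simp only [valueIter]
      have := measurable_integral_mul (ζ := ζ) hm
      fun_prop
    · refine le_min (le_min hw₁.le (mul_nonneg hw₀.le (hmax x))) ?_
      have h1 : 0 ≤ ∫ z, V (x * z) ∂ζ := integral_nonneg fun z => hnn _
      have h2 := mul_nonneg hp₀.le (hmax x)
      linarith
    · refine hg.inf (ConcaveOn.add ((concaveOn_const p₁ (convex_Ici 0)).add (hlin p₀)) ?_)
      refine ⟨convex_Ici 0, fun x hx y hy s t hs ht hst => ?_⟩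
      simp only [smul_eq_mul]
      rw [← integral_const_mul, ← integral_const_mul, ← integral_add ((hint x).const_mul s)
        ((hint y).const_mul t)]
      refine integral_mono_ae (((hint x).const_mul s).add ((hint y).const_mul t)) (hint _) ?_
      filter_upwards [hζ.pos] with z hz
      have h1 := hconc.2 (x := x * z) (y := y * z) (mul_nonneg hx hz.le) (mul_nonneg hy hz.le)
        hs ht hst
      simp only [smul_eq_mul] at h1
      calc _ ≤ _ := h1
        _ = _ := by congr 1; ring

theorem valueIter_anti (hζ : IsRatioLaw ζ) (hw₀ : 0 < w₀) (hw₁ : 0 < w₁) (hp₀ : 0 < p₀)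
    (hp₁ : 0 < p₁) (x : ℝ) : Antitone fun n => valueIter ζ w₀ w₁ p₀ p₁ n x := by
  have := hζ.prob
  refine antitone_nat_of_succ_le fun n => ?_
  induction n generalizing x with
  | zero => exact min_le_left _ _
  | succ n ih =>
    have hint : ∀ m, Integrable (fun z => valueIter ζ w₀ w₁ p₀ p₁ m (x * z)) ζ := fun m => by
      obtain ⟨hm, hnn, hle, -⟩ := valueIter_spec hζ hw₀ hw₁ hp₀ hp₁ m
      exact hζ.integrable_of_bdd (C := w₁) (hm.comp (by fun_prop)) (ae_of_all _ fun z => by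
        rw [abs_of_nonneg (hnn _)]; exact (hle _).trans (min_le_left _ _))
    refine min_le_min le_rfl (add_le_add le_rfl ?_)
    exact integral_mono (hint _) (hint _) fun z => ih _

/-- A concave solution of the optimality equation of the stopping problem with terminal cost
`min w₁ (w₀ x)` and running cost `p₁ + p₀ x`. -/
theorem IsRatioLaw.exists_value (hζ : IsRatioLaw ζ) (hw₀ : 0 < w₀) (hw₁ : 0 < w₁) (hp₀ : 0 < p₀)
    (hp₁ : 0 < p₁) :
    ∃ V : ℝ → ℝ, Measurable V ∧ (∀ x, 0 ≤ V x) ∧ ConcaveOn ℝ (Set.Ici 0) V ∧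
      ∀ x, V x = min (min w₁ (w₀ * max x 0)) (p₁ + p₀ * max x 0 + ∫ z, V (x * z) ∂ζ) := by
  have := hζ.prob
  have hspec := valueIter_spec hζ hw₀ hw₁ hp₀ hp₁
  set v := valueIter ζ w₀ w₁ p₀ p₁ with hv
  have hlim : ∀ x, Tendsto (fun n => v n x) atTop (𝓝 (⨅ n, v n x)) := fun x =>
    tendsto_atTop_ciInf (valueIter_anti hζ hw₀ hw₁ hp₀ hp₁ x)
      ⟨0, by rintro _ ⟨n, rfl⟩; exact (hspec n).2.1 x⟩
  refine ⟨fun x => ⨅ n, v n x, ?_, fun x => ?_, ?_, fun x => ?_⟩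
  · exact measurable_of_tendsto_metrizable (fun n => (hspec n).1) (tendsto_pi_nhds.2 hlim)
  · exact ge_of_tendsto' (hlim x) fun n => (hspec n).2.1 x
  · refine ⟨convex_Ici 0, fun x hx y hy s t hs ht hst => ?_⟩
    exact le_of_tendsto_of_tendsto' (((hlim x).const_smul s).add ((hlim y).const_smul t))
      (hlim _) fun n => (hspec n).2.2.2.2 hx hy hs ht hst
  · have h1 : Tendsto (fun n => ∫ z, v n (x * z) ∂ζ) atTop (𝓝 (∫ z, ⨅ n, v n (x * z) ∂ζ)) := by
      refine tendsto_integral_of_dominated_convergence (fun _ => w₁) (fun n => ?_)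
        (integrable_const _) (fun n => ae_of_all _ fun z => ?_) (ae_of_all _ fun z => hlim _)
      · exact ((hspec n).1.comp (by fun_prop)).aestronglyMeasurable
      · rw [Real.norm_eq_abs, abs_of_nonneg ((hspec n).2.1 _)]
        exact ((hspec n).2.2.1 _).trans (min_le_left _ _)
    have h2 : Tendsto (fun n => v (n + 1) x) atTop
        (𝓝 (min (min w₁ (w₀ * max x 0)) (p₁ + p₀ * max x 0 + ∫ z, ⨅ n, v n (x * z) ∂ζ))) :=
      tendsto_const_nhds.min (tendsto_const_nhds.add h1)
    exact tendsto_nhds_unique ((tendsto_add_atTop_iff_nat 1).2 (hlim x)) h2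

/-- For all thresholds and all running costs there are terminal costs for which leaving `(a, b)` is
the optimal stopping rule. -/
theorem IsRatioLaw.exists_terminal_costs (hζ : IsRatioLaw ζ) {a b : ℝ} (ha : 0 < a) (hab : a < b)
    (hp₀ : 0 < p₀) (hp₁ : 0 < p₁) :
    ∃ w₀ w₁ : ℝ, 0 < w₀ ∧ 0 < w₁ ∧ ∃ V : ℝ → ℝ, Measurable V ∧ (∀ x, 0 ≤ V x) ∧
      (∀ x, 0 < x → V x ≤ w₀ * x) ∧ (∀ x, V x ≤ w₁) ∧
      (∀ x, 0 < x → V x ≤ p₁ + p₀ * x + ∫ z, V (x * z) ∂ζ) ∧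
      (∀ x ∈ Set.Ioo a b, V x = p₁ + p₀ * x + ∫ z, V (x * z) ∂ζ) ∧
      (∀ x, 0 < x → x ≤ a → V x = w₀ * x) ∧ (∀ x, b ≤ x → V x = w₁) := by
  have := hζ.prob
  have hb : 0 < b := ha.trans hab
  obtain ⟨w₀, w₁, hw₀, hw₁, J, C, hJm, hJC, hJa, hJb, hJeq⟩ := hζ.exists_indifferent ha hab hp₀ hp₁
  obtain ⟨V, hVm, hV0, hVc, hVeq⟩ := hζ.exists_value hw₀ hw₁ hp₀ hp₁
  refine ⟨w₀, w₁, hw₀, hw₁, V, hVm, hV0, ?_⟩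
  set P : ℝ → ℝ := fun x => ∫ z, V (x * z) ∂ζ with hP
  have hV1 : ∀ x, V x ≤ w₁ := fun x => by
    rw [hVeq]; exact (min_le_left _ _).trans (min_le_left _ _)
  have hVl : ∀ x, 0 < x → V x ≤ w₀ * x := fun x hx => by
    rw [hVeq, max_eq_left hx.le]; exact (min_le_left _ _).trans (min_le_right _ _)
  have hVp : ∀ x, 0 < x → V x ≤ p₁ + p₀ * x + P x := fun x hx => by
    rw [hVeq, max_eq_left hx.le]; exact min_le_right _ _
  have hVmin : ∀ x, 0 < x → V x = min (min w₁ (w₀ * x)) (p₁ + p₀ * x + P x) := fun x hx => by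
    rw [hVeq x, max_eq_left hx.le]
  have hVz : V 0 = 0 := by
    refine le_antisymm ?_ (hV0 0)
    rw [hVeq]
    refine (min_le_left _ _).trans ((min_le_right _ _).trans ?_)
    simp
  have hVint : ∀ x, Integrable (fun z => V (x * z)) ζ := fun x =>
    hζ.integrable_of_bdd (C := w₁) (hVm.comp (by fun_prop)) (ae_of_all _ fun z => by
      rw [abs_of_nonneg (hV0 _)]; exact hV1 _)
  have hPc : ConcaveOn ℝ (Set.Ici 0) P := by
    refine ⟨convex_Ici 0, fun x hx y hy s t hs ht hst => ?_⟩
    simp only [smul_eq_mul, hP]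
    rw [← integral_const_mul, ← integral_const_mul, ← integral_add ((hVint x).const_mul s)
      ((hVint y).const_mul t)]
    refine integral_mono_ae (((hVint x).const_mul s).add ((hVint y).const_mul t)) (hVint _) ?_
    filter_upwards [hζ.pos] with z hz
    have h1 := hVc.2 (x := x * z) (y := y * z) (mul_nonneg hx hz.le) (mul_nonneg hy hz.le)
      hs ht hst
    simp only [smul_eq_mul] at h1
    calc _ ≤ _ := h1
      _ = _ := by congr 1; ring
  have hP0 : ∀ x, 0 ≤ P x := fun x => integral_nonneg fun z => hV0 _
  -- the difference between the cost of the two-sided exit and the optimal cost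
  set d : ℝ → ℝ := fun x => if 0 < x then J x - V x else 0 with hd
  have hdm : Measurable d := Measurable.ite measurableSet_Ioi (hJm.sub hVm) measurable_const
  have hdC : ∀ x, |d x| ≤ C + w₁ := by
    intro x
    simp only [hd]
    split_ifs with hx
    · refine (abs_sub _ _).trans (add_le_add (hJC x hx) ?_)
      rw [abs_of_nonneg (hV0 x)]; exact hV1 x
    · rw [abs_zero]
      have := (abs_nonneg _).trans (hJC 1 one_pos)
      linarith
  have hdpos : ∀ x, 0 < x → d x = J x - V x := fun x hx => by simp only [hd, if_pos hx]
  have hJint : ∀ x, 0 < x → Integrable (fun z => J (x * z)) ζ := fun x hx =>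
    hζ.integrable_of_bdd (C := C) (hJm.comp (by fun_prop)) (hζ.pos.mono fun z hz =>
      hJC _ (by positivity))
  have hdint : ∀ x, Integrable (fun z => d (x * z)) ζ := fun x =>
    hζ.integrable_of_bdd (C := C + w₁) (hdm.comp (by fun_prop)) (ae_of_all _ fun z => hdC _)
  have hdP : ∀ x, 0 < x → ∫ z, d (x * z) ∂ζ = ∫ z, J (x * z) ∂ζ - P x := by
    intro x hx
    rw [hP, ← integral_sub (hJint x hx) (hVint x)]
    refine integral_congr_ae ?_
    filter_upwards [hζ.pos] with z hz
    exact hdpos _ (by positivity)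
  -- Optimality of `V`: outside the interval `J` is one of the two stopping costs, and inside `J`
  -- solves the one-step equation with equality and `V` with `≤`.
  have hd0 : ∀ x, 0 < x → 0 ≤ d x := by
    intro x hx
    refine hζ.nonneg_of_superharmonic ha hab hdm hdC (fun y hy hyo => ?_) (fun y hy => ?_) hx
    · rw [hdpos y hy]
      rcases le_or_gt y a with h | h
      · rw [hJa y hy h]; linarith [hVl y hy]
      · have : b ≤ y := by
          by_contra! h2
          exact hyo ⟨h, h2⟩
        rw [hJb y this]; linarith [hV1 y]
    · have hy0 : 0 < y := ha.trans hy.1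
      rw [hdP y hy0, hdpos y hy0, hJeq y (Set.Ioo_subset_Icc_self hy)]
      linarith [hVp y hy0]
  have hPJ : ∀ x, 0 < x → P x ≤ ∫ z, J (x * z) ∂ζ := by
    intro x hx
    have h1 := hdP x hx
    have h2 : 0 ≤ ∫ z, d (x * z) ∂ζ := integral_nonneg_of_ae (hζ.pos.mono fun z hz =>
      hd0 _ (by positivity))
    linarith
  -- At `a` and `b` continuing with cost `J` is as good as stopping, and continuing optimally is no
  -- worse.
  have hca : p₁ + p₀ * a + P a ≤ w₀ * a := by
    have h1 := hJeq a ⟨le_rfl, hab.le⟩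
    rw [hJa a ha le_rfl] at h1
    linarith [hPJ a ha]
  have hcb : p₁ + p₀ * b + P b ≤ w₁ := by
    have h1 := hJeq b ⟨hab.le, le_rfl⟩
    rw [hJb b le_rfl] at h1
    linarith [hPJ b hb]
  -- Concavity with `P 0 ≥ 0` gives `P x ≤ (x / a) P a`; the bound at `a` then extends to `x > a`,
  -- strictly because the constant part `p₁` of the cost does not grow with `x`.
  have hlt0 : ∀ x, a < x → p₁ + p₀ * x + P x < w₀ * x := by
    intro x hx
    have hx0 := ha.trans hx
    have h1 := hPc.2 (Set.mem_Ici.2 (le_refl (0 : ℝ))) (Set.mem_Ici.2 hx0.le)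
      (show 0 ≤ 1 - a / x by rw [sub_nonneg, div_le_one hx0]; exact hx.le)
      (show 0 ≤ a / x by positivity) (by ring)
    simp only [smul_eq_mul, mul_zero, zero_add] at h1
    rw [div_mul_cancel₀ _ hx0.ne'] at h1
    have h2 : (1 - a / x) * 0 ≤ (1 - a / x) * P 0 := mul_le_mul_of_nonneg_left (hP0 0)
      (by rw [sub_nonneg, div_le_one hx0]; exact hx.le)
    have h3 : a / x * P x ≤ w₀ * a - p₀ * a - p₁ := by linarith
    have h4 : P x ≤ x / a * (w₀ * a - p₀ * a - p₁) := by
      have := mul_le_mul_of_nonneg_left h3 (show 0 ≤ x / a by positivity)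
      have e : x / a * (a / x * P x) = P x := by field_simp
      linarith
    have e2 : x / a * (w₀ * a - p₀ * a - p₁) = w₀ * x - p₀ * x - x / a * p₁ := by
      field_simp
    have h5 : p₁ < x / a * p₁ := by
      have : 1 < x / a := by rw [one_lt_div ha]; exact hx
      nlinarith
    linarith
  have hPmono : ∀ x y, 0 < x → x ≤ y → P x ≤ P y := by
    intro x y hx hxy
    rcases hxy.eq_or_lt with h | hxy
    · rw [h]
    by_contra! hlt
    -- a concave function that decreases somewhere becomes negative
    set D := P x - P y with hD
    have hD0 : 0 < D := by linarith
    -- Where the line through the values at `x` and `y` has dropped to `-1`.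
    set T := y + (y - x) * (P y + 1) / D with hT
    have hyx : 0 < y - x := by linarith
    have hTy : y < T := by
      have : 0 < (y - x) * (P y + 1) / D := by
        have := hP0 y
        positivity
      linarith
    have h1 := hPc.slope_anti_adjacent (x := x) (y := y) (z := T) hx.le
      (show (0 : ℝ) ≤ T by linarith) hxy hTy
    have e1 : T - y = (y - x) * (P y + 1) / D := by rw [hT]; ring
    have h2 : (P T - P y) / (T - y) * (T - y) ≤ (P y - P x) / (y - x) * (T - y) :=
      mul_le_mul_of_nonneg_right h1 (by linarith)
    rw [div_mul_cancel₀ _ (by linarith : T - y ≠ 0)] at h2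
    have e2 : (P y - P x) / (y - x) * (T - y) = -(P y + 1) := by
      rw [e1, show P y - P x = -D by rw [hD]; ring]
      field_simp
    have := hP0 T
    linarith
  have hlt1 : ∀ x, 0 < x → x < b → p₁ + p₀ * x + P x < w₁ := by
    intro x hx hxb
    have h1 := hPmono x b hx hxb.le
    have h2 := mul_lt_mul_of_pos_left hxb hp₀
    linarith
  have hVin : ∀ x ∈ Set.Icc a b, V x = p₁ + p₀ * x + P x := by
    intro x hx
    have hx0 := ha.trans_le hx.1
    rw [hVmin x hx0]
    refine min_eq_right (le_min ?_ ?_)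
    · rcases hx.2.eq_or_lt with h | h
      · rw [h]; exact hcb
      · exact (hlt1 x hx0 h).le
    · rcases hx.1.eq_or_lt with h | h
      · rw [← h]; exact hca
      · exact (hlt0 x h).le
  have hVmono : ∀ x y, 0 < x → x ≤ y → V x ≤ V y := by
    intro x y hx hxy
    rw [hVmin x hx, hVmin y (hx.trans_le hxy)]
    have h1 := mul_le_mul_of_nonneg_left hxy hw₀.le
    have h2 := mul_le_mul_of_nonneg_left hxy hp₀.le
    exact min_le_min (min_le_min le_rfl h1) (add_le_add (add_le_add le_rfl h2) (hPmono x y hx hxy))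
  have hVstar : ∀ x t, 0 ≤ x → 0 ≤ t → t ≤ 1 → t * V x ≤ V (t * x) := by
    intro x t hx ht0 ht1
    have h1 := hVc.2 (Set.mem_Ici.2 (le_refl (0 : ℝ))) (Set.mem_Ici.2 hx)
      (show 0 ≤ 1 - t by linarith) ht0 (by ring)
    simpa [hVz] using h1
  -- Continuing is optimal on all of `[a, b]`, so both `J` and `V` satisfy the equation with the
  -- same running cost, and the difference is harmonic, end points included.
  have hdharm : ∀ x ∈ Set.Icc a b, d x = ∫ z, d (x * z) ∂ζ := by
    intro x hx
    have hx0 := ha.trans_le hx.1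
    rw [hdP x hx0, hdpos x hx0, hJeq x hx, hVin x hx]
    ring
  set M := max (d a) (d b) with hM
  -- Below `a` this is `V (t a) ≥ t V a` for `t ≤ 1`; above `b` it is monotonicity of `V`.
  have hdout : ∀ x, 0 < x → x ∉ Set.Ioo a b → d x ≤ M := by
    intro y hy hyo
    rcases le_or_gt y a with h | h
    · refine le_trans ?_ (le_max_left _ _)
      rw [hdpos y hy, hdpos a ha, hJa y hy h, hJa a ha le_rfl]
      have h1 := hVstar a (y / a) ha.le (by positivity) (by rw [div_le_one ha]; exact h)
      rw [div_mul_cancel₀ _ ha.ne'] at h1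
      have h2 : (1 - y / a) * V a ≤ (1 - y / a) * (w₀ * a) :=
        mul_le_mul_of_nonneg_left (hVl a ha) (by rw [sub_nonneg, div_le_one ha]; exact h)
      have e : (1 - y / a) * (w₀ * a) = w₀ * a - w₀ * y := by field_simp
      linarith
    · have hby : b ≤ y := by
        by_contra! h2
        exact hyo ⟨h, h2⟩
      refine le_trans ?_ (le_max_right _ _)
      rw [hdpos y hy, hdpos b hb, hJb y hby, hJb b le_rfl]
      linarith [hVmono b y hb hby]
  have hdM : ∀ x, 0 < x → d x ≤ M := by
    intro x hx
    have hM' : |M| ≤ C + w₁ := by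
      rcases max_choice (d a) (d b) with h | h <;> rw [hM, h] <;> exact hdC _
    have := hζ.nonneg_of_superharmonic (d := fun x => M - d x) ha hab (measurable_const.sub hdm)
      (M := (C + w₁) + (C + w₁)) (fun y => (abs_sub _ _).trans (add_le_add hM' (hdC y)))
      (fun y hy hyo => sub_nonneg.2 (hdout y hy hyo)) (fun y hy => ?_) hx
    · linarith
    · rw [integral_sub (integrable_const _) (hdint y), hdharm y (Set.Ioo_subset_Icc_self hy)]
      simp
  have hmax : ∀ x ∈ Set.Icc a b, d x = M → ∀ᵐ z ∂ζ, d (x * z) = M := by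
    intro x hx hxM
    have hx0 := ha.trans_le hx.1
    have h1 : ∫ z, (M - d (x * z)) ∂ζ = 0 := by
      rw [integral_sub (integrable_const _) (hdint x), ← hdharm x hx, hxM]
      simp
    have h2 := (integral_eq_zero_iff_of_nonneg_ae (f := fun z => M - d (x * z))
      (hζ.pos.mono fun z hz => sub_nonneg.2 (hdM _ (by positivity)))
      ((integrable_const _).sub (hdint x))).1 h1
    filter_upwards [h2] with z hz
    have : M - d (x * z) = 0 := hz
    linarith
  -- Strong maximum principle. If `M > 0` were attained at `a` or `b`, it would be attained at
  -- almost every `x z`, in particular after a factor that leads out of the interval; there the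
  -- shape of `V` forbids it.
  have hM0 : M ≤ 0 := by
    by_contra! hMpos
    have hex : ∀ s : Set ℝ, ζ s ≠ 0 → ∀ x, (∀ᵐ z ∂ζ, d (x * z) = M) →
        ∃ z ∈ s, 0 < z ∧ d (x * z) = M := by
      intro s hs x hx
      by_contra! hcon
      refine hs (measure_mono_null ?_ (ae_iff.1 (hζ.pos.and hx)))
      intro z hz hz2
      exact hcon z hz hz2.1 hz2.2
    rcases max_choice (d a) (d b) with h | h
    · have hda : d a = M := by rw [hM, h]
      obtain ⟨z, hz1, hz0, hz⟩ := hex _ hζ.measure_lt_one a (hmax a ⟨le_rfl, hab.le⟩ hda)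
      have hz1' : z < 1 := hz1
      have haz : a * z ≤ a := by nlinarith
      rw [hdpos _ (by positivity), hJa _ (by positivity) haz] at hz
      rw [hdpos a ha, hJa a ha le_rfl] at hda
      have h1 := hVstar a z ha.le hz0.le hz1'.le
      rw [mul_comm z a] at h1
      have h2 : (1 - z) * (w₀ * a - V a) = 0 * (w₀ * a - V a) ∨ 0 < (1 - z) * (w₀ * a - V a) :=
        Or.inr (mul_pos (by linarith) (by linarith))
      nlinarith
    · have hdb : d b = M := by rw [hM, h]
      obtain ⟨z, hz1, hz0, hz⟩ := hex _ hζ.measure_gt_one b (hmax b ⟨hab.le, le_rfl⟩ hdb)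
      have hz1' : 1 < z := hz1
      have hbz : b < b * z := by nlinarith
      rw [hdpos _ (by positivity), hJb _ hbz.le] at hz
      rw [hdpos b hb, hJb b le_rfl] at hdb
      -- `V` is constant on `[b, b z]`, below its eventual value `w₁`
      set T := b * z + w₁ / w₀ + w₁ / p₀ with hT
      have hTpos : b * z < T := by
        have : 0 < w₁ / w₀ := by positivity
        have : 0 < w₁ / p₀ := by positivity
        linarith
      have hT0 : 0 < T := lt_trans (by positivity) hTpos
      -- `T` is so large that `w₀ T` and `p₀ T` both exceed `w₁`, so stopping for `w₁` is cheapest.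
      -- A concave function that is flat on `[b, b z]` cannot rise to this value later.
      have hVT : V T = w₁ := by
        rw [hVmin T hT0]
        have hbz0 : 0 < b * z := by positivity
        have h3 : w₁ ≤ w₀ * T := by
          have e : w₀ * (w₁ / w₀) = w₁ := by field_simp
          have : w₀ * (w₁ / w₀) ≤ w₀ * T := mul_le_mul_of_nonneg_left (by
            have : 0 < w₁ / p₀ := by positivity
            linarith) hw₀.le
          linarith
        have h4 : w₁ ≤ p₀ * T := by
          have e : p₀ * (w₁ / p₀) = w₁ := by field_simp
          have : p₀ * (w₁ / p₀) ≤ p₀ * T := mul_le_mul_of_nonneg_left (by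
            have : 0 < w₁ / w₀ := by positivity
            linarith) hp₀.le
          linarith
        rw [min_eq_left h3]
        exact min_eq_left (by linarith [hP0 T])
      have h1 := hVc.slope_anti_adjacent (x := b) (y := b * z) (z := T) hb.le hT0.le hbz hTpos
      have h2 : V (b * z) - V b = 0 := by linarith
      rw [h2, zero_div, div_nonpos_iff] at h1
      rcases h1 with ⟨-, h1⟩ | ⟨h1, -⟩
      · linarith
      · linarith
  have hVJ : ∀ x, 0 < x → V x = J x := by
    intro x hx
    have h1 := hd0 x hx
    have h2 := (hdM x hx).trans hM0
    rw [hdpos x hx] at h1 h2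
    linarith
  refine ⟨hVl, hV1, hVp, fun x hx => hVin x (Set.Ioo_subset_Icc_self hx), fun x hx hxa => ?_,
    fun x hx => ?_⟩
  · rw [hVJ x hx, hJa x hx hxa]
  · rw [hVJ x (hb.trans_le hx), hJb x hx]

end ValueFunction

/-! ### Sequential tests and the Wald-Wolfowitz theorem -/

section SequentialTests

variable {E : Type*}

/-- The random walk with steps `x (ω t)`. -/
def walk (x : E → ℝ) (t : ℕ) (ω : ℕ → E) : ℝ := ∑ s ∈ Finset.range t, x (ω s)

theorem walk_succ (x : E → ℝ) (t : ℕ) (ω : ℕ → E) : walk x (t + 1) ω = walk x t ω + x (ω t) :=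
  Finset.sum_range_succ _ _

theorem walk_update (x : E → ℝ) (t : ℕ) (ω : ℕ → E) (e : E) :
    walk x t (Function.update ω t e) = walk x t ω :=
  Finset.sum_congr rfl fun s hs => by rw [Function.update_of_ne (Finset.mem_range.1 hs).ne]

/-- The random walk, frozen when it has left `(-B, A)`. -/
def frozenWalk (x : E → ℝ) (A B : ℝ) : ℕ → (ℕ → E) → ℝ
  | 0 => fun _ => 0
  | t + 1 => fun ω =>
    if frozenWalk x A B t ω ∈ Set.Ioo (-B) A then frozenWalk x A B t ω + x (ω t)
    else frozenWalk x A B t ω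

theorem frozenWalk_eq_walk (x : E → ℝ) {A B : ℝ} (t : ℕ) (ω : ℕ → E)
    (h : frozenWalk x A B t ω ∈ Set.Ioo (-B) A) : frozenWalk x A B t ω = walk x t ω := by
  induction t with
  | zero => simp [frozenWalk, walk]
  | succ t ih =>
    by_cases h2 : frozenWalk x A B t ω ∈ Set.Ioo (-B) A
    · rw [walk_succ, ← ih h2]
      simp only [frozenWalk, if_pos h2]
    · simp only [frozenWalk, if_neg h2] at h
      exact absurd h h2

theorem frozenWalk_succ_eq_walk (x : E → ℝ) {A B : ℝ} (t : ℕ) (ω : ℕ → E)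
    (h : frozenWalk x A B t ω ∈ Set.Ioo (-B) A) :
    frozenWalk x A B (t + 1) ω = walk x (t + 1) ω := by
  rw [walk_succ, ← frozenWalk_eq_walk x t ω h]
  simp only [frozenWalk, if_pos h]

variable [MeasurableSpace E]

theorem measurable_walk {x : E → ℝ} (hx : Measurable x) (t : ℕ) : Measurable (walk x t) :=
  Finset.measurable_sum _ fun s _ => hx.comp (measurable_pi_apply s)

/-- `G` is the statistic of a sequential test that stops when `G` leaves `(-B, A)`; it is frozen
from then on. -/
structure IsTest (G : ℕ → (ℕ → E) → ℝ) (A B : ℝ) : Prop where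
  posA : 0 < A
  posB : 0 < B
  meas : ∀ t, Measurable (G t)
  dep : ∀ t ω ω', (∀ s < t, ω s = ω' s) → G t ω = G t ω'
  zero : ∀ ω, G 0 ω = 0
  frozen : ∀ t ω, G t ω ∉ Set.Ioo (-B) A → G (t + 1) ω = G t ω

/-- The event that the test has not stopped by time `t`. -/
def alive (G : ℕ → (ℕ → E) → ℝ) (A B : ℝ) (t : ℕ) : Set (ℕ → E) := {ω | G t ω ∈ Set.Ioo (-B) A}

theorem isTest_frozenWalk {x : E → ℝ} (hx : Measurable x) {A B : ℝ} (hA : 0 < A) (hB : 0 < B) :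
    IsTest (frozenWalk x A B) A B where
  posA := hA
  posB := hB
  meas t := by
    induction t with
    | zero => exact measurable_const
    | succ t ih =>
      exact Measurable.ite (ih measurableSet_Ioo) (ih.add (hx.comp (measurable_pi_apply t))) ih
  dep t ω ω' h := by
    induction t with
    | zero => rfl
    | succ t ih =>
      have := ih fun s hs => h s (hs.trans t.lt_succ_self)
      simp only [frozenWalk, this, h t t.lt_succ_self]
  zero ω := rfl
  frozen t ω h := by simp only [frozenWalk, if_neg h]

namespace IsTest

variable {G : ℕ → (ℕ → E) → ℝ} {A B : ℝ}

theorem measurableSet_alive (hG : IsTest G A B) (t : ℕ) : MeasurableSet (alive G A B t) :=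
  hG.meas t measurableSet_Ioo

theorem alive_zero (hG : IsTest G A B) : alive G A B 0 = Set.univ := by
  ext ω
  simp [alive, hG.zero, hG.posA, hG.posB]

theorem alive_anti (hG : IsTest G A B) : Antitone (alive G A B) := by
  refine antitone_nat_of_succ_le fun t ω h => ?_
  by_contra h2
  simp only [alive, Set.mem_ofPred_eq] at h h2
  rw [hG.frozen t ω h2] at h
  exact h2 h

/-- Survival up to time `t` does not involve the observation `ω t`; this is how the stopping-time
property is used. -/
theorem mem_alive_update_iff (hG : IsTest G A B) (t : ℕ) (ω : ℕ → E) (e : E) :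
    Function.update ω t e ∈ alive G A B t ↔ ω ∈ alive G A B t := by
  simp only [alive, Set.mem_ofPred_eq]
  rw [hG.dep t (Function.update ω t e) ω fun s hs => Function.update_of_ne hs.ne _ _]

theorem up_mono (hG : IsTest G A B) : Monotone fun t => {ω | A ≤ G t ω} := by
  refine monotone_nat_of_le_succ fun t ω h => ?_
  simp only [Set.mem_ofPred_eq] at h ⊢
  rwa [hG.frozen t ω fun h2 => absurd h2.2 (not_lt.2 h)]

theorem down_mono (hG : IsTest G A B) : Monotone fun t => {ω | G t ω ≤ -B} := by
  refine monotone_nat_of_le_succ fun t ω h => ?_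
  simp only [Set.mem_ofPred_eq] at h ⊢
  rwa [hG.frozen t ω fun h2 => absurd h2.1 (not_lt.2 h)]

theorem measurableSet_up (hG : IsTest G A B) (t : ℕ) : MeasurableSet {ω | A ≤ G t ω} :=
  hG.meas t measurableSet_Ici

theorem measurableSet_down (hG : IsTest G A B) (t : ℕ) : MeasurableSet {ω | G t ω ≤ -B} :=
  hG.meas t measurableSet_Iic

theorem tendsto_measure_up (hG : IsTest G A B) (P : Measure (ℕ → E)) :
    Tendsto (fun t => P {ω | A ≤ G t ω}) atTop (𝓝 (P {ω | ∃ t, A ≤ G t ω})) := by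
  have h := tendsto_measure_iUnion_atTop (μ := P) hG.up_mono
  have e : (⋃ t, {ω | A ≤ G t ω}) = {ω | ∃ t, A ≤ G t ω} := by ext ω; simp
  rwa [e] at h

theorem tendsto_measure_down (hG : IsTest G A B) (P : Measure (ℕ → E)) :
    Tendsto (fun t => P {ω | G t ω ≤ -B}) atTop (𝓝 (P {ω | ∃ t, G t ω ≤ -B})) := by
  have h := tendsto_measure_iUnion_atTop (μ := P) hG.down_mono
  have e : (⋃ t, {ω | G t ω ≤ -B}) = {ω | ∃ t, G t ω ≤ -B} := by ext ω; simp
  rwa [e] at h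

theorem up_succ (hG : IsTest G A B) (t : ℕ) :
    {ω | A ≤ G (t + 1) ω} = {ω | A ≤ G t ω} ∪ (alive G A B t ∩ {ω | A ≤ G (t + 1) ω}) := by
  ext ω
  simp only [alive, Set.mem_ofPred_eq, Set.mem_union, Set.mem_inter_iff]
  by_cases h : G t ω ∈ Set.Ioo (-B) A
  · have : ¬ A ≤ G t ω := not_le.2 h.2
    tauto
  · rw [hG.frozen t ω h]; tauto

theorem down_succ (hG : IsTest G A B) (t : ℕ) :
    {ω | G (t + 1) ω ≤ -B} = {ω | G t ω ≤ -B} ∪ (alive G A B t ∩ {ω | G (t + 1) ω ≤ -B}) := by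
  ext ω
  simp only [alive, Set.mem_ofPred_eq, Set.mem_union, Set.mem_inter_iff]
  by_cases h : G t ω ∈ Set.Ioo (-B) A
  · have : ¬ G t ω ≤ -B := not_le.2 h.1
    tauto
  · rw [hG.frozen t ω h]; tauto

theorem disjoint_up (G : ℕ → (ℕ → E) → ℝ) (A B : ℝ) (t : ℕ) :
    Disjoint {ω | A ≤ G t ω} (alive G A B t ∩ {ω | A ≤ G (t + 1) ω}) := by
  rw [Set.disjoint_left]
  exact fun ω h h2 => absurd h2.1.2 (not_lt.2 h)

theorem disjoint_down (G : ℕ → (ℕ → E) → ℝ) (A B : ℝ) (t : ℕ) :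
    Disjoint {ω | G t ω ≤ -B} (alive G A B t ∩ {ω | G (t + 1) ω ≤ -B}) := by
  rw [Set.disjoint_left]
  exact fun ω h h2 => absurd h2.1.1 (not_lt.2 h)

theorem measure_up_succ (hG : IsTest G A B) (P : Measure (ℕ → E)) (t : ℕ) :
    P {ω | A ≤ G (t + 1) ω} = P {ω | A ≤ G t ω} + P (alive G A B t ∩ {ω | A ≤ G (t + 1) ω}) := by
  rw [← measure_union (disjoint_up G A B t)
    ((hG.measurableSet_alive t).inter (hG.measurableSet_up _)), ← hG.up_succ]

theorem measure_down_succ (hG : IsTest G A B) (P : Measure (ℕ → E)) (t : ℕ) :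
    P {ω | G (t + 1) ω ≤ -B} =
      P {ω | G t ω ≤ -B} + P (alive G A B t ∩ {ω | G (t + 1) ω ≤ -B}) := by
  rw [← measure_union (disjoint_down G A B t)
    ((hG.measurableSet_alive t).inter (hG.measurableSet_down _)), ← hG.down_succ]

theorem setLIntegral_alive (hG : IsTest G A B) (P : Measure (ℕ → E)) (t : ℕ)
    (F : (ℕ → E) → ℝ≥0∞) :
    ∫⁻ ω in alive G A B t, F ω ∂P = ∫⁻ ω in alive G A B (t + 1), F ω ∂P +
      ∫⁻ ω in alive G A B t ∩ {ω | G (t + 1) ω ≤ -B}, F ω ∂P +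
      ∫⁻ ω in alive G A B t ∩ {ω | A ≤ G (t + 1) ω}, F ω ∂P := by
  rw [← lintegral_union, ← lintegral_union]
  · congr 2
    ext ω
    have h1 : ω ∈ alive G A B (t + 1) → ω ∈ alive G A B t := fun h => hG.alive_anti t.le_succ h
    have h2 : ω ∈ alive G A B (t + 1) ↔ -B < G (t + 1) ω ∧ G (t + 1) ω < A := Iff.rfl
    simp only [Set.mem_union, Set.mem_inter_iff, Set.mem_ofPred_eq]
    rcases le_or_gt (G (t + 1) ω) (-B) with h3 | h3 <;>
      rcases le_or_gt A (G (t + 1) ω) with h4 | h4 <;> tauto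
  · exact (hG.measurableSet_alive t).inter (hG.measurableSet_up _)
  · rw [Set.disjoint_left]
    rintro ω (h | h) h2
    · exact absurd h.2 (not_lt.2 h2.2)
    · have h3 : G (t + 1) ω ≤ -B := h.2
      have h4 : A ≤ G (t + 1) ω := h2.2
      linarith [hG.posA, hG.posB]
  · exact (hG.measurableSet_alive t).inter (hG.measurableSet_down _)
  · rw [Set.disjoint_left]
    intro ω h h2
    exact absurd h.1 (not_lt.2 h2.2)

end IsTest

variable {ν₀ ν₁ : Measure E} [IsProbabilityMeasure ν₀] [IsProbabilityMeasure ν₁] {x : E → ℝ}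

/-- The likelihood ratio of the first `t` observations. -/
theorem lintegral_change_measure (hx : Measurable x)
    (hν : ν₀ = ν₁.withDensity fun e => ENNReal.ofReal (Real.exp (-x e))) (t : ℕ)
    {h : (ℕ → E) → ℝ≥0∞} (hm : Measurable h)
    (hdep : ∀ ω ω', (∀ s < t, ω s = ω' s) → h ω = h ω') :
    ∫⁻ ω, h ω ∂(Measure.infinitePi fun _ : ℕ => ν₀) =
      ∫⁻ ω, h ω * ENNReal.ofReal (Real.exp (-walk x t ω)) ∂(Measure.infinitePi fun _ : ℕ => ν₁) := by
  induction t generalizing h with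
  | zero =>
    have h1 : ∀ ω ω', h ω = h ω' := fun ω ω' => hdep ω ω' (by simp)
    have : Nonempty (ℕ → E) := by
      by_contra hne
      rw [not_nonempty_iff] at hne
      have := measure_univ (μ := Measure.infinitePi fun _ : ℕ => ν₀)
      rw [Set.univ_eq_empty_iff.2 hne, measure_empty] at this
      exact zero_ne_one this
    obtain ⟨ω₀⟩ := this
    simp_rw [fun ω => h1 ω ω₀]
    simp [walk]
  | succ t ih =>
    have hz : Measurable fun e => ENNReal.ofReal (Real.exp (-x e)) := by fun_prop
    have hup : Measurable fun p : (ℕ → E) × E => Function.update p.1 t p.2 :=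
      measurable_update_prod (X := fun _ : ℕ => E) t
    have hm2 : Measurable fun ω => h ω * ENNReal.ofReal (Real.exp (-walk x (t + 1) ω)) :=
      hm.mul ((measurable_walk hx (t + 1)).neg.exp.ennreal_ofReal)
    -- Coordinate `t` is averaged first, under `ν₀` and `ν₁` respectively. The `ν₀` average depends
    -- on earlier coordinates only, and the density of `ν₀` supplies the last factor.
    rw [lintegral_infinitePi_update _ t hm, lintegral_infinitePi_update _ t hm2, ih]
    · refine lintegral_congr fun ω => ?_
      have hmu : Measurable fun e => h (Function.update ω t e) := hm.comp (measurable_update ω)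
      rw [hν, lintegral_withDensity_eq_lintegral_mul _ hz hmu, ← lintegral_mul_const _ (hz.mul hmu)]
      refine lintegral_congr fun e => ?_
      rw [walk_succ, walk_update, Function.update_self, neg_add, Real.exp_add,
        ENNReal.ofReal_mul (Real.exp_pos _).le]
      simp only [Pi.mul_apply]
      ring
    · exact Measurable.lintegral_prod_right'
        (f := fun p : (ℕ → E) × E => h (Function.update p.1 t p.2)) (hm.comp hup)
    · intro ω ω' hω
      refine lintegral_congr fun e => hdep _ _ fun s hs => ?_
      rcases (Nat.lt_succ_iff.1 hs).eq_or_lt with h2 | h2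
      · subst h2; simp
      · rw [Function.update_of_ne h2.ne, Function.update_of_ne h2.ne, hω s h2]

theorem measure_change_measure (hx : Measurable x)
    (hν : ν₀ = ν₁.withDensity fun e => ENNReal.ofReal (Real.exp (-x e))) (t : ℕ)
    {S : Set (ℕ → E)} (hS : MeasurableSet S)
    (hdep : ∀ ω ω', (∀ s < t, ω s = ω' s) → (ω ∈ S ↔ ω' ∈ S)) :
    (Measure.infinitePi fun _ : ℕ => ν₀) S =
      ∫⁻ ω in S, ENNReal.ofReal (Real.exp (-walk x t ω)) ∂(Measure.infinitePi fun _ : ℕ => ν₁) := by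
  rw [← lintegral_indicator_one hS, lintegral_change_measure hx hν t
    (measurable_one.indicator hS), ← lintegral_indicator hS]
  · refine lintegral_congr fun ω => ?_
    by_cases h : ω ∈ S <;> simp [h]
  · intro ω ω' h
    by_cases h1 : ω ∈ S
    · simp [h1, (hdep ω ω' h).1 h1]
    · simp [h1, mt (hdep ω ω' h).2 h1]

/-- **Wald-Wolfowitz theorem**, for weighted sums of the two expected sample sizes: among all tests
with given error probabilities the sequential probability ratio test is optimal. -/
theorem wald_wolfowitz_weighted (hx : Measurable x)
    (hν : ν₀ = ν₁.withDensity fun e => ENNReal.ofReal (Real.exp (-x e)))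
    (hζ : IsRatioLaw (ν₁.map fun e => Real.exp (-x e)))
    {A B A' B' : ℝ} (hA : 0 < A) (hB : 0 < B) {G : ℕ → (ℕ → E) → ℝ} (hG : IsTest G A' B')
    (hup : (Measure.infinitePi fun _ : ℕ => ν₀) {ω | ∃ t, A' ≤ G t ω} ≤
      (Measure.infinitePi fun _ : ℕ => ν₀) {ω | ∃ t, A ≤ frozenWalk x A B t ω})
    (hdown : (Measure.infinitePi fun _ : ℕ => ν₁) {ω | ∃ t, G t ω ≤ -B'} ≤
      (Measure.infinitePi fun _ : ℕ => ν₁) {ω | ∃ t, frozenWalk x A B t ω ≤ -B})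
    (h1 : ∑' t, (Measure.infinitePi fun _ : ℕ => ν₁) (alive G A' B' t) ≠ ⊤)
    {p₀ p₁ : ℝ} (hp₀ : 0 < p₀) (hp₁ : 0 < p₁) :
    ENNReal.ofReal p₁ * ∑' t, (Measure.infinitePi fun _ : ℕ => ν₁) (alive (frozenWalk x A B) A B t) +
      ENNReal.ofReal p₀ *
        ∑' t, (Measure.infinitePi fun _ : ℕ => ν₀) (alive (frozenWalk x A B) A B t) ≤
    ENNReal.ofReal p₁ * ∑' t, (Measure.infinitePi fun _ : ℕ => ν₁) (alive G A' B' t) +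
      ENNReal.ofReal p₀ * ∑' t, (Measure.infinitePi fun _ : ℕ => ν₀) (alive G A' B' t) := by
  set P₀ := Measure.infinitePi fun _ : ℕ => ν₀ with hP₀
  set P₁ := Measure.infinitePi fun _ : ℕ => ν₁ with hP₁
  -- In terms of `exp (-L)` the SPRT decides for `H_1` at or below `exp (-A)` and for `H_0` at or
  -- above `exp B`.
  have hab : Real.exp (-A) < Real.exp B := Real.exp_lt_exp.2 (by linarith)
  obtain ⟨w₀, w₁, hw₀, hw₁, V, hVm, hV0, hVl, hV1, hVp, hVin, hVa, hVb⟩ :=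
    hζ.exists_terminal_costs (Real.exp_pos (-A)) hab hp₀ hp₁
  set ζ := ν₁.map fun e => Real.exp (-x e) with hζd
  have := hζ.prob
  have hxe : Measurable fun e => Real.exp (-x e) := by fun_prop
  set q : ℝ → ℝ := fun y => ∫ z, V (y * z) ∂ζ with hq
  have hq0 : ∀ y, 0 ≤ q y := fun y => integral_nonneg fun z => hV0 _
  have hqm : Measurable q := measurable_integral_mul hVm
  have hqw : ∀ y, q y ≤ w₁ := fun y => by
    calc q y ≤ ∫ _, w₁ ∂ζ := integral_mono_of_nonneg (ae_of_all _ fun z => hV0 _)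
          (integrable_const _) (ae_of_all _ fun z => hV1 _)
      _ = w₁ := by simp
  set Z : ℕ → (ℕ → E) → ℝ := fun t ω => Real.exp (-walk x t ω) with hZ
  have hZm : ∀ t, Measurable (Z t) := fun t => (measurable_walk hx t).neg.exp
  have hZ0 : ∀ t ω, 0 < Z t ω := fun t ω => Real.exp_pos _
  -- the cost so far plus the optimal continuation cost
  set Ψ : (ℕ → (ℕ → E) → ℝ) → ℝ → ℝ → ℕ → ℝ≥0∞ := fun G A B t =>
    ∫⁻ ω in alive G A B t, ENNReal.ofReal (q (Z t ω)) ∂P₁ +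
      ENNReal.ofReal w₁ * P₁ {ω | G t ω ≤ -B} + ENNReal.ofReal w₀ * P₀ {ω | A ≤ G t ω} +
      ∑ s ∈ Finset.range (t + 1), (ENNReal.ofReal p₁ * P₁ (alive G A B s) +
        ENNReal.ofReal p₀ * P₀ (alive G A B s)) with hΨ
  -- `q` is the mean of `V` after one more factor; resampling `ω t` makes this exact on the event of
  -- survival.
  have hcont : ∀ {G : ℕ → (ℕ → E) → ℝ} {A B : ℝ}, IsTest G A B → ∀ t,
      ∫⁻ ω in alive G A B t, ENNReal.ofReal (q (Z t ω)) ∂P₁ =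
        ∫⁻ ω in alive G A B t, ENNReal.ofReal (V (Z (t + 1) ω)) ∂P₁ := by
    intro G A B hG t
    rw [← lintegral_indicator (hG.measurableSet_alive t),
      ← lintegral_indicator (hG.measurableSet_alive t), hP₁, lintegral_infinitePi_update _ t
      (h := (alive G A B t).indicator fun ω => ENNReal.ofReal (V (Z (t + 1) ω)))
      ((hVm.comp (hZm _)).ennreal_ofReal.indicator (hG.measurableSet_alive t))]
    refine lintegral_congr fun ω => ?_
    by_cases h : ω ∈ alive G A B t
    · simp only [Set.indicator, hG.mem_alive_update_iff, h, if_true]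
      have e1 : ∀ e, Z (t + 1) (Function.update ω t e) = Z t ω * Real.exp (-x e) := fun e => by
        simp only [hZ]
        rw [walk_succ, walk_update, Function.update_self, neg_add, Real.exp_add]
      simp_rw [e1]
      rw [hq, ofReal_integral_eq_lintegral_ofReal, hζd, lintegral_map _ hxe]
      · exact (hVm.comp (measurable_const.mul measurable_id)).ennreal_ofReal
      · exact hζ.integrable_of_bdd (C := w₁) (hVm.comp (by fun_prop)) (ae_of_all _ fun z => by
          rw [abs_of_nonneg (hV0 _)]; exact hV1 _)
      · exact ae_of_all _ fun z => hV0 _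
    · simp only [Set.indicator, hG.mem_alive_update_iff, h, if_false,
        lintegral_zero]
  -- The change of measure turns the running cost `p₀ Z` under `P₁` into `p₀` under `P₀`, so one
  -- stopping problem under `P₁` sees both expected times.
  have hcost : ∀ {G : ℕ → (ℕ → E) → ℝ} {A B : ℝ}, IsTest G A B → ∀ t,
      ∫⁻ ω in alive G A B t, ENNReal.ofReal (p₁ + p₀ * Z t ω) ∂P₁ =
        ENNReal.ofReal p₁ * P₁ (alive G A B t) + ENNReal.ofReal p₀ * P₀ (alive G A B t) := by
    intro G A B hG t
    have e : ∀ ω, ENNReal.ofReal (p₁ + p₀ * Z t ω) =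
        ENNReal.ofReal p₁ + ENNReal.ofReal p₀ * ENNReal.ofReal (Z t ω) := fun ω => by
      rw [ENNReal.ofReal_add hp₁.le (mul_nonneg hp₀.le (hZ0 t ω).le), ENNReal.ofReal_mul hp₀.le]
    simp_rw [e]
    rw [lintegral_add_left measurable_const, lintegral_const_mul _ (hZm t).ennreal_ofReal,
      setLIntegral_const, hP₀, measure_change_measure hx hν t (hG.measurableSet_alive t)]
    intro ω ω' h
    simp only [alive, Set.mem_ofPred_eq, hG.dep t ω ω' h]
  have hupeq : ∀ {G : ℕ → (ℕ → E) → ℝ} {A B : ℝ}, IsTest G A B → ∀ t,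
      ∫⁻ ω in alive G A B t ∩ {ω | A ≤ G (t + 1) ω}, ENNReal.ofReal (w₀ * Z (t + 1) ω) ∂P₁ =
        ENNReal.ofReal w₀ * P₀ (alive G A B t ∩ {ω | A ≤ G (t + 1) ω}) := by
    intro G A B hG t
    simp_rw [ENNReal.ofReal_mul hw₀.le]
    rw [lintegral_const_mul _ (hZm _).ennreal_ofReal, hP₀, measure_change_measure hx hν (t + 1)
      ((hG.measurableSet_alive t).inter (hG.measurableSet_up (t + 1)))]
    intro ω ω' h
    simp only [alive, Set.mem_inter_iff, Set.mem_ofPred_eq, hG.dep (t + 1) ω ω' h,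
      hG.dep t ω ω' fun s hs => h s (hs.trans t.lt_succ_self)]
  have hsplit : ∀ y, 0 < y → ENNReal.ofReal (p₁ + p₀ * y + q y) =
      ENNReal.ofReal (p₁ + p₀ * y) + ENNReal.ofReal (q y) := fun y hy =>
    ENNReal.ofReal_add (by positivity) (hq0 y)
  have hvalue : ∀ {G : ℕ → (ℕ → E) → ℝ} {A B : ℝ}, IsTest G A B → ∀ t,
      ∫⁻ ω in alive G A B t, ENNReal.ofReal (p₁ + p₀ * Z t ω + q (Z t ω)) ∂P₁ =
        ENNReal.ofReal p₁ * P₁ (alive G A B t) + ENNReal.ofReal p₀ * P₀ (alive G A B t) +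
        ∫⁻ ω in alive G A B t, ENNReal.ofReal (q (Z t ω)) ∂P₁ := by
    intro G A B hG t
    rw [← hcost hG t, ← lintegral_add_left]
    · exact lintegral_congr fun ω => hsplit _ (hZ0 t ω)
    · exact ((measurable_const.add ((hZm t).const_mul _))).ennreal_ofReal
  have hstart : ∀ {G : ℕ → (ℕ → E) → ℝ} {A B : ℝ}, IsTest G A B →
      Ψ G A B 0 = ENNReal.ofReal (q 1) + ENNReal.ofReal p₁ + ENNReal.ofReal p₀ := by
    intro G A B hG
    have e1 : {ω : ℕ → E | G 0 ω ≤ -B} = ∅ := by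
      ext ω; simp [hG.zero, hG.posB]
    have e2 : {ω : ℕ → E | A ≤ G 0 ω} = ∅ := by
      ext ω; simp [hG.zero, hG.posA]
    simp only [hΨ, e1, e2, hG.alive_zero, hZ, walk, zero_add, Finset.sum_range_one]
    simp [hP₁, hP₀, add_assoc]
  -- For an arbitrary test, `V` is at most the cost of whichever action is taken: continuing,
  -- stopping for `H_0`, stopping for `H_1`.
  have hstep : ∀ t, Ψ G A' B' t ≤ Ψ G A' B' (t + 1) := by
    intro t
    simp only [hΨ]
    rw [Finset.sum_range_succ _ (t + 1), hcont hG t, hG.setLIntegral_alive P₁ t,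
      hG.measure_up_succ P₀ t, hG.measure_down_succ P₁ t]
    have i1 : ∫⁻ ω in alive G A' B' (t + 1), ENNReal.ofReal (V (Z (t + 1) ω)) ∂P₁ ≤ _ :=
      (lintegral_mono fun ω => ENNReal.ofReal_le_ofReal (hVp _ (hZ0 (t + 1) ω))).trans_eq
        (hvalue hG (t + 1))
    have i2 : ∫⁻ ω in alive G A' B' t ∩ {ω | G (t + 1) ω ≤ -B'},
        ENNReal.ofReal (V (Z (t + 1) ω)) ∂P₁ ≤
          ENNReal.ofReal w₁ * P₁ (alive G A' B' t ∩ {ω | G (t + 1) ω ≤ -B'}) :=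
      (lintegral_mono fun ω => ENNReal.ofReal_le_ofReal (hV1 _)).trans_eq
        (by rw [setLIntegral_const])
    have i3 : ∫⁻ ω in alive G A' B' t ∩ {ω | A' ≤ G (t + 1) ω},
        ENNReal.ofReal (V (Z (t + 1) ω)) ∂P₁ ≤ _ :=
      (lintegral_mono fun ω => ENNReal.ofReal_le_ofReal (hVl _ (hZ0 (t + 1) ω))).trans_eq
        (hupeq hG t)
    refine (add_le_add (add_le_add (add_le_add (add_le_add (add_le_add i1 i2) i3) le_rfl) le_rfl)
      le_rfl).trans_eq ?_
    ring
  have hS := isTest_frozenWalk hx hA hB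
  -- For the SPRT each of these three comparisons is an equality, since its action is the optimal
  -- one.
  have hstepS : ∀ t, Ψ (frozenWalk x A B) A B (t + 1) ≤ Ψ (frozenWalk x A B) A B t := by
    intro t
    simp only [hΨ]
    rw [Finset.sum_range_succ _ (t + 1), hcont hS t, hS.setLIntegral_alive P₁ t,
      hS.measure_up_succ P₀ t, hS.measure_down_succ P₁ t]
    have i1 : _ ≤ ∫⁻ ω in alive (frozenWalk x A B) A B (t + 1),
        ENNReal.ofReal (V (Z (t + 1) ω)) ∂P₁ :=
      (hvalue hS (t + 1)).symm.trans_le (setLIntegral_mono' (hS.measurableSet_alive (t + 1))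
        fun ω hω => ENNReal.ofReal_le_ofReal (by
          rw [hVin]
          have h2 : frozenWalk x A B (t + 1) ω ∈ Set.Ioo (-B) A := hω
          rw [frozenWalk_eq_walk x _ ω h2] at h2
          exact ⟨Real.exp_lt_exp.2 (by linarith [h2.2]), Real.exp_lt_exp.2 (by linarith [h2.1])⟩))
    have i2 : ENNReal.ofReal w₁ * P₁ (alive (frozenWalk x A B) A B t ∩
          {ω | frozenWalk x A B (t + 1) ω ≤ -B}) ≤
        ∫⁻ ω in alive (frozenWalk x A B) A B t ∩ {ω | frozenWalk x A B (t + 1) ω ≤ -B},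
        ENNReal.ofReal (V (Z (t + 1) ω)) ∂P₁ := by
      rw [← setLIntegral_const]
      refine setLIntegral_mono' ((hS.measurableSet_alive t).inter (hS.measurableSet_down _))
        fun ω hω => ENNReal.ofReal_le_ofReal ?_
      have h2 : frozenWalk x A B (t + 1) ω ≤ -B := hω.2
      rw [frozenWalk_succ_eq_walk x _ ω hω.1] at h2
      rw [hVb]
      exact Real.exp_le_exp.2 (by linarith)
    have i3 : _ ≤ ∫⁻ ω in alive (frozenWalk x A B) A B t ∩ {ω | A ≤ frozenWalk x A B (t + 1) ω},
        ENNReal.ofReal (V (Z (t + 1) ω)) ∂P₁ :=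
      (hupeq hS t).symm.trans_le (setLIntegral_mono'
        ((hS.measurableSet_alive t).inter (hS.measurableSet_up _))
        fun ω hω => ENNReal.ofReal_le_ofReal (by
          have h2 : A ≤ frozenWalk x A B (t + 1) ω := hω.2
          rw [frozenWalk_succ_eq_walk x _ ω hω.1] at h2
          rw [hVa _ (hZ0 _ ω)]
          exact Real.exp_le_exp.2 (by linarith)))
    refine le_trans (le_of_eq ?_) (add_le_add (add_le_add (add_le_add (add_le_add
      (add_le_add i1 i2) i3) le_rfl) le_rfl) le_rfl)
    ring
  -- pass to the limit
  set aS := P₀ {ω | ∃ t, A ≤ frozenWalk x A B t ω} with haS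
  set bS := P₁ {ω | ∃ t, frozenWalk x A B t ω ≤ -B} with hbS
  -- Here the remaining continuation cost is simply dropped, so finiteness of the SPRT's expected
  -- times is a consequence and not an assumption.
  have hlow : ENNReal.ofReal p₁ * ∑' t, P₁ (alive (frozenWalk x A B) A B t) +
      ENNReal.ofReal p₀ * ∑' t, P₀ (alive (frozenWalk x A B) A B t) +
      (ENNReal.ofReal w₁ * bS + ENNReal.ofReal w₀ * aS) ≤
        ENNReal.ofReal (q 1) + ENNReal.ofReal p₁ + ENNReal.ofReal p₀ := by
    have hle : ∀ t, Ψ (frozenWalk x A B) A B t ≤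
        ENNReal.ofReal (q 1) + ENNReal.ofReal p₁ + ENNReal.ofReal p₀ := fun t =>
      (antitone_nat_of_succ_le hstepS (Nat.zero_le t)).trans_eq (hstart hS)
    have ht1 := hS.tendsto_measure_down P₁
    have ht0 := hS.tendsto_measure_up P₀
    have ht2 := (ENNReal.tendsto_nat_tsum fun s => (ENNReal.ofReal p₁ *
      P₁ (alive (frozenWalk x A B) A B s) + ENNReal.ofReal p₀ *
      P₀ (alive (frozenWalk x A B) A B s))).comp (tendsto_add_atTop_nat 1)
    rw [ENNReal.tsum_add, ENNReal.tsum_mul_left, ENNReal.tsum_mul_left] at ht2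
    refine le_of_tendsto' (ht2.add ((ENNReal.Tendsto.const_mul ht1 (Or.inr ENNReal.ofReal_ne_top)).add
      (ENNReal.Tendsto.const_mul ht0 (Or.inr ENNReal.ofReal_ne_top)))) fun t =>
        le_trans ?_ (hle t)
    simp only [hΨ, Function.comp_apply]
    have hadd : ∀ u v w y : ℝ≥0∞, y + (v + w) ≤ u + v + w + y := fun u v w y => by
      rw [add_assoc u, add_assoc u, add_comm y]
      exact le_add_left le_rfl
    exact hadd _ _ _ _
  -- For the competitor the remaining continuation cost is at most `w₁ P₁ (alive)`, which tends to
  -- `0` because its expected time under `P₁` is finite.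
  have hhigh : ENNReal.ofReal (q 1) + ENNReal.ofReal p₁ + ENNReal.ofReal p₀ ≤
      ENNReal.ofReal p₁ * ∑' t, P₁ (alive G A' B' t) +
      ENNReal.ofReal p₀ * ∑' t, P₀ (alive G A' B' t) +
      (ENNReal.ofReal w₁ * bS + ENNReal.ofReal w₀ * aS) := by
    have hle : ∀ t, ENNReal.ofReal (q 1) + ENNReal.ofReal p₁ + ENNReal.ofReal p₀ ≤
        Ψ G A' B' t := fun t =>
      (hstart hG).symm.trans_le (monotone_nat_of_le_succ hstep (Nat.zero_le t))
    have ht : Tendsto (fun t => ENNReal.ofReal w₁ * P₁ (alive G A' B' t) +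
        (ENNReal.ofReal p₁ * ∑' t, P₁ (alive G A' B' t) +
        ENNReal.ofReal p₀ * ∑' t, P₀ (alive G A' B' t) +
        (ENNReal.ofReal w₁ * bS + ENNReal.ofReal w₀ * aS))) atTop (𝓝 (ENNReal.ofReal w₁ * 0 +
        (ENNReal.ofReal p₁ * ∑' t, P₁ (alive G A' B' t) +
        ENNReal.ofReal p₀ * ∑' t, P₀ (alive G A' B' t) +
        (ENNReal.ofReal w₁ * bS + ENNReal.ofReal w₀ * aS)))) :=
      (ENNReal.Tendsto.const_mul (ENNReal.tendsto_atTop_zero_of_tsum_ne_top h1)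
        (Or.inr ENNReal.ofReal_ne_top)).add tendsto_const_nhds
    rw [mul_zero, zero_add] at ht
    refine ge_of_tendsto' ht fun t => (hle t).trans ?_
    simp only [hΨ]
    rw [add_assoc, add_assoc, ← add_assoc (ENNReal.ofReal w₁ * P₁ {ω | G t ω ≤ -B'}),
      add_comm (ENNReal.ofReal w₁ * P₁ {ω | G t ω ≤ -B'} + ENNReal.ofReal w₀ * P₀ {ω | A' ≤ G t ω})]
    refine add_le_add ?_ (add_le_add ?_ (add_le_add ?_ ?_))
    · rw [← setLIntegral_const]
      exact lintegral_mono fun ω => ENNReal.ofReal_le_ofReal (hqw _)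
    · rw [← ENNReal.tsum_mul_left, ← ENNReal.tsum_mul_left, ← ENNReal.tsum_add]
      exact ENNReal.sum_le_tsum _
    · refine mul_le_mul_right (le_trans (measure_mono fun ω hω => ?_) hdown) _
      exact ⟨t, hω⟩
    · refine mul_le_mul_right (le_trans (measure_mono fun ω hω => ?_) hup) _
      exact ⟨t, hω⟩
  refine (ENNReal.add_le_add_iff_right ?_).1 (hlow.trans hhigh)
  exact ENNReal.add_ne_top.2 ⟨ENNReal.mul_ne_top ENNReal.ofReal_ne_top (measure_ne_top _ _),
    ENNReal.mul_ne_top ENNReal.ofReal_ne_top (measure_ne_top _ _)⟩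

/-- **Wald-Wolfowitz theorem**: among all tests with given error probabilities the sequential
probability ratio test has the smallest expected sample size under both hypotheses. -/
theorem wald_wolfowitz (hx : Measurable x)
    (hν : ν₀ = ν₁.withDensity fun e => ENNReal.ofReal (Real.exp (-x e)))
    (hζ : IsRatioLaw (ν₁.map fun e => Real.exp (-x e)))
    {A B A' B' : ℝ} (hA : 0 < A) (hB : 0 < B) {G : ℕ → (ℕ → E) → ℝ} (hG : IsTest G A' B')
    (hup : (Measure.infinitePi fun _ : ℕ => ν₀) {ω | ∃ t, A' ≤ G t ω} ≤
      (Measure.infinitePi fun _ : ℕ => ν₀) {ω | ∃ t, A ≤ frozenWalk x A B t ω})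
    (hdown : (Measure.infinitePi fun _ : ℕ => ν₁) {ω | ∃ t, G t ω ≤ -B'} ≤
      (Measure.infinitePi fun _ : ℕ => ν₁) {ω | ∃ t, frozenWalk x A B t ω ≤ -B})
    (h0 : ∑' t, (Measure.infinitePi fun _ : ℕ => ν₀) (alive G A' B' t) ≠ ⊤)
    (h1 : ∑' t, (Measure.infinitePi fun _ : ℕ => ν₁) (alive G A' B' t) ≠ ⊤) :
    ∑' t, (Measure.infinitePi fun _ : ℕ => ν₁) (alive (frozenWalk x A B) A B t) ≤
        ∑' t, (Measure.infinitePi fun _ : ℕ => ν₁) (alive G A' B' t) ∧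
      ∑' t, (Measure.infinitePi fun _ : ℕ => ν₀) (alive (frozenWalk x A B) A B t) ≤
        ∑' t, (Measure.infinitePi fun _ : ℕ => ν₀) (alive G A' B' t) := by
  have key := fun {p₀ p₁ : ℝ} => wald_wolfowitz_weighted hx hν hζ hA hB hG hup hdown h1
    (p₀ := p₀) (p₁ := p₁)
  -- The weight of the other hypothesis is `1 / (n + 1)`; its contribution vanishes because the
  -- competitor's expected time is finite there.
  have hlim : ∀ {u v : ℝ≥0∞}, v ≠ ⊤ →
      Tendsto (fun n : ℕ => u + ENNReal.ofReal (1 / ((n : ℝ) + 1)) * v) atTop (𝓝 u) := by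
    intro u v hv
    have h2 := ENNReal.tendsto_ofReal (tendsto_one_div_add_atTop_nhds_zero_nat (𝕜 := ℝ))
    have h3 := (tendsto_const_nhds (x := u)).add (ENNReal.Tendsto.mul_const h2 (Or.inr hv))
    simpa using h3
  constructor
  · refine ge_of_tendsto' (hlim h0) fun n => ?_
    have h2 := key (p₀ := 1 / ((n : ℝ) + 1)) (p₁ := 1) (by positivity) one_pos
    simp only [ENNReal.ofReal_one, one_mul] at h2
    exact le_self_add.trans h2
  · refine ge_of_tendsto' (hlim h1) fun n => ?_
    have h2 := key (p₀ := 1) (p₁ := 1 / ((n : ℝ) + 1)) one_pos (by positivity)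
    simp only [ENNReal.ofReal_one, one_mul] at h2
    rw [add_comm] at h2
    rw [add_comm (∑' t, (Measure.infinitePi fun _ : ℕ => ν₀) (alive G A' B' t))]
    exact le_self_add.trans h2

end SequentialTests

/-! ### Wald's identity and the lower bound for the SPRT -/

section WaldIdentity

variable {E : Type*} [MeasurableSpace E] {ν₀ ν₁ : Measure E} [IsProbabilityMeasure ν₀]
  [IsProbabilityMeasure ν₁] {x : E → ℝ}

/-- Wald's identity for one step: the expectation of an increment before stopping. -/
theorem IsTest.integral_indicator_alive {G : ℕ → (ℕ → E) → ℝ} {A B : ℝ} (hG : IsTest G A B) (t : ℕ)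
    {F : (ℕ → E) → ℝ} (hF : Measurable F)
    (hFi : Integrable F (Measure.infinitePi fun _ : ℕ => ν₁)) {c : ℝ}
    (hc : ∀ ω, ∫ e, F (Function.update ω t e) ∂ν₁ = c) :
    ∫ ω, (alive G A B t).indicator F ω ∂(Measure.infinitePi fun _ : ℕ => ν₁) =
      c * (Measure.infinitePi fun _ : ℕ => ν₁).real (alive G A B t) := by
  have hm := hG.measurableSet_alive t
  rw [integral_infinitePi_update _ t (hF.indicator hm) (hFi.indicator hm)]
  have e : ∀ ω, ∫ e, (alive G A B t).indicator F (Function.update ω t e) ∂ν₁ =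
      (alive G A B t).indicator (fun _ => c) ω := by
    intro ω
    by_cases h : ω ∈ alive G A B t
    · simp only [Set.indicator, hG.mem_alive_update_iff, h, if_true, hc]
    · simp only [Set.indicator, hG.mem_alive_update_iff, h, if_false, integral_zero]
  simp_rw [e]
  rw [integral_indicator hm, setIntegral_const, smul_eq_mul, mul_comm]

theorem ae_forall_infinitePi {p : E → Prop} (hp : ∀ᵐ e ∂ν₁, p e) :
    ∀ᵐ ω ∂(Measure.infinitePi fun _ : ℕ => ν₁), ∀ t, p (ω t) :=
  ae_all_iff.2 fun t =>
    (measurePreserving_eval_infinitePi (fun _ : ℕ => ν₁) t).quasiMeasurePreserving.ae hp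

theorem integrable_comp_eval {f : E → ℝ} (hf : Measurable f) {c : ℝ} (hc : ∀ᵐ e ∂ν₁, |f e| ≤ c)
    (t : ℕ) : Integrable (fun ω => f (ω t)) (Measure.infinitePi fun _ : ℕ => ν₁) := by
  refine Integrable.of_bound (hf.comp (measurable_pi_apply t)).aestronglyMeasurable c ?_
  filter_upwards [ae_forall_infinitePi hc] with ω hω
  exact hω t

theorem frozenWalk_eq_sum (x : E → ℝ) (A B : ℝ) (n : ℕ) (ω : ℕ → E) :
    frozenWalk x A B n ω =
      ∑ t ∈ Finset.range n, (alive (frozenWalk x A B) A B t).indicator (fun ω => x (ω t)) ω := by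
  induction n with
  | zero => simp [frozenWalk]
  | succ n ih =>
    rw [Finset.sum_range_succ, ← ih]
    by_cases h : ω ∈ alive (frozenWalk x A B) A B n
    · have h2 : frozenWalk x A B n ω ∈ Set.Ioo (-B) A := h
      simp only [frozenWalk, if_pos h2, Set.indicator_of_mem h]
    · have h2 : frozenWalk x A B n ω ∉ Set.Ioo (-B) A := h
      simp only [frozenWalk, if_neg h2, Set.indicator_of_notMem h, add_zero]

theorem integral_frozenWalk (hx : Measurable x) {c : ℝ} (hc : ∀ᵐ e ∂ν₁, |x e| ≤ c) {A B : ℝ}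
    (hA : 0 < A) (hB : 0 < B) (n : ℕ) :
    ∫ ω, frozenWalk x A B n ω ∂(Measure.infinitePi fun _ : ℕ => ν₁) =
      (∫ e, x e ∂ν₁) * ∑ t ∈ Finset.range n,
        (Measure.infinitePi fun _ : ℕ => ν₁).real (alive (frozenWalk x A B) A B t) := by
  have hS := isTest_frozenWalk hx hA hB
  simp_rw [frozenWalk_eq_sum x A B n]
  rw [integral_finsetSum, Finset.mul_sum]
  · refine Finset.sum_congr rfl fun t _ => ?_
    refine hS.integral_indicator_alive t (hx.comp (measurable_pi_apply t))
      (integrable_comp_eval hx hc t) fun ω => ?_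
    simp
  · exact fun t _ => (integrable_comp_eval hx hc t).indicator (hS.measurableSet_alive t)

/-- The likelihood ratio at the exit time. The event is split by the step at which the walk exits,
where the frozen walk is still the true one; later both sides stay constant. -/
theorem setLIntegral_exp_up (hx : Measurable x)
    (hν : ν₀ = ν₁.withDensity fun e => ENNReal.ofReal (Real.exp (-x e))) {A B : ℝ}
    (hA : 0 < A) (hB : 0 < B) (n : ℕ) :
    ∫⁻ ω in {ω | A ≤ frozenWalk x A B n ω}, ENNReal.ofReal (Real.exp (-frozenWalk x A B n ω))
      ∂(Measure.infinitePi fun _ : ℕ => ν₁) =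
    (Measure.infinitePi fun _ : ℕ => ν₀) {ω | A ≤ frozenWalk x A B n ω} := by
  have hS := isTest_frozenWalk hx hA hB
  induction n with
  | zero =>
    have e : {ω | A ≤ frozenWalk x A B 0 ω} = ∅ := by
      ext ω; simp [frozenWalk, hA]
    simp [e]
  | succ n ih =>
    have hm := (hS.measurableSet_alive n).inter (hS.measurableSet_up (n + 1))
    have hun : ∀ f : (ℕ → E) → ℝ≥0∞, ∫⁻ ω in {ω | A ≤ frozenWalk x A B (n + 1) ω}, f ω
        ∂(Measure.infinitePi fun _ : ℕ => ν₁) =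
        (∫⁻ ω in {ω | A ≤ frozenWalk x A B n ω}, f ω ∂(Measure.infinitePi fun _ : ℕ => ν₁)) +
        ∫⁻ ω in alive (frozenWalk x A B) A B n ∩ {ω | A ≤ frozenWalk x A B (n + 1) ω}, f ω
          ∂(Measure.infinitePi fun _ : ℕ => ν₁) := by
      intro f
      rw [← lintegral_union hm (IsTest.disjoint_up _ A B n), ← hS.up_succ]
    rw [hun, hS.measure_up_succ, ← ih, measure_change_measure hx hν (n + 1) hm]
    · congr 1
      · refine setLIntegral_congr_fun (hS.measurableSet_up n) fun ω hω => ?_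
        rw [hS.frozen n ω fun h2 => absurd h2.2 (not_lt.2 hω)]
      · refine setLIntegral_congr_fun hm fun ω hω => ?_
        rw [frozenWalk_succ_eq_walk x n ω hω.1]
    · intro ω ω' h
      simp only [alive, Set.mem_inter_iff, Set.mem_ofPred_eq, hS.dep (n + 1) ω ω' h,
        hS.dep n ω ω' fun s hs => h s (hs.trans n.lt_succ_self)]

theorem setLIntegral_exp_down (hx : Measurable x)
    (hν : ν₀ = ν₁.withDensity fun e => ENNReal.ofReal (Real.exp (-x e))) {A B : ℝ}
    (hA : 0 < A) (hB : 0 < B) (n : ℕ) :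
    ∫⁻ ω in {ω | frozenWalk x A B n ω ≤ -B}, ENNReal.ofReal (Real.exp (-frozenWalk x A B n ω))
      ∂(Measure.infinitePi fun _ : ℕ => ν₁) =
    (Measure.infinitePi fun _ : ℕ => ν₀) {ω | frozenWalk x A B n ω ≤ -B} := by
  have hS := isTest_frozenWalk hx hA hB
  induction n with
  | zero =>
    have e : {ω | frozenWalk x A B 0 ω ≤ -B} = ∅ := by
      ext ω; simp [frozenWalk, hB]
    simp [e]
  | succ n ih =>
    have hm := (hS.measurableSet_alive n).inter (hS.measurableSet_down (n + 1))
    have hun : ∀ f : (ℕ → E) → ℝ≥0∞, ∫⁻ ω in {ω | frozenWalk x A B (n + 1) ω ≤ -B}, f ω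
        ∂(Measure.infinitePi fun _ : ℕ => ν₁) =
        (∫⁻ ω in {ω | frozenWalk x A B n ω ≤ -B}, f ω ∂(Measure.infinitePi fun _ : ℕ => ν₁)) +
        ∫⁻ ω in alive (frozenWalk x A B) A B n ∩ {ω | frozenWalk x A B (n + 1) ω ≤ -B}, f ω
          ∂(Measure.infinitePi fun _ : ℕ => ν₁) := by
      intro f
      rw [← lintegral_union hm (IsTest.disjoint_down _ A B n), ← hS.down_succ]
    rw [hun, hS.measure_down_succ, ← ih, measure_change_measure hx hν (n + 1) hm]
    · congr 1
      · refine setLIntegral_congr_fun (hS.measurableSet_down n) fun ω hω => ?_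
        rw [hS.frozen n ω fun h2 => absurd h2.1 (not_lt.2 hω)]
      · refine setLIntegral_congr_fun hm fun ω hω => ?_
        rw [frozenWalk_succ_eq_walk x n ω hω.1]
    · intro ω ω' h
      simp only [alive, Set.mem_inter_iff, Set.mem_ofPred_eq, hS.dep (n + 1) ω ω' h,
        hS.dep n ω ω' fun s hs => h s (hs.trans n.lt_succ_self)]

/-- The inequality `log u ≤ u - 1` at `u = c exp (-y)`. It bounds the terminal value of the walk
from below by an exponential whose mean is an error probability, so thresholds and overshoots do not
enter. -/
theorem log_add_one_sub_le {c : ℝ} (hc : 0 < c) (y : ℝ) :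
    Real.log c + 1 - c * Real.exp (-y) ≤ y := by
  have h := Real.log_le_sub_one_of_pos (mul_pos hc (Real.exp_pos (-y)))
  rw [Real.log_mul hc.ne' (Real.exp_pos _).ne', Real.log_exp] at h
  linarith

/-- Wald's lower bound for the expected sample size of the sequential probability ratio test. -/
theorem expected_sprt_ge (hx : Measurable x)
    (hν : ν₀ = ν₁.withDensity fun e => ENNReal.ofReal (Real.exp (-x e)))
    {c : ℝ} (hc : ∀ᵐ e ∂ν₁, |x e| ≤ c) {A B α β : ℝ} (hA : 0 < A) (hB : 0 < B) (hα : 0 < α)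
    (hα1 : α < 1) (hβ : 0 < β) (hI : 0 ≤ ∫ e, x e ∂ν₁)
    (hup : (Measure.infinitePi fun _ : ℕ => ν₀) {ω | ∃ t, A ≤ frozenWalk x A B t ω} =
      ENNReal.ofReal α)
    (hdown : (Measure.infinitePi fun _ : ℕ => ν₁) {ω | ∃ t, frozenWalk x A B t ω ≤ -B} =
      ENNReal.ofReal β)
    (hfin : ∑' t, (Measure.infinitePi fun _ : ℕ => ν₁) (alive (frozenWalk x A B) A B t) ≠ ⊤) :
    |Real.log α| - β * |Real.log α| - β + β * Real.log β ≤
      (∫ e, x e ∂ν₁) *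
        (∑' t, (Measure.infinitePi fun _ : ℕ => ν₁) (alive (frozenWalk x A B) A B t)).toReal := by
  have hS := isTest_frozenWalk hx hA hB
  set P₀ := Measure.infinitePi fun _ : ℕ => ν₀ with hP₀
  set P₁ := Measure.infinitePi fun _ : ℕ => ν₁ with hP₁
  set S := frozenWalk x A B with hSd
  have ha : |Real.log α| = -Real.log α := abs_of_neg (Real.log_neg hα hα1)
  set a := |Real.log α|
  have hm : ∀ n, Measurable (S n) := hS.meas
  have hSi : ∀ n, Integrable (S n) P₁ := by
    intro n
    have : S n = fun ω => ∑ t ∈ Finset.range n, (alive S A B t).indicator (fun ω => x (ω t)) ω :=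
      funext fun ω => frozenWalk_eq_sum x A B n ω
    rw [this]
    exact integrable_finsetSum _ fun t _ =>
      (integrable_comp_eval hx hc t).indicator (hS.measurableSet_alive t)
  -- The mean of the frozen walk is split over upward exit, downward exit and survival, and Wald's
  -- identity bounds it by drift times expected time.
  have key : ∀ n, (a + 1) * (1 - P₁.real {ω | S n ω ≤ -B} - P₁.real (alive S A B n)) - 1 +
      (Real.log β + 1) * P₁.real {ω | S n ω ≤ -B} - β - B * P₁.real (alive S A B n) ≤
      (∫ e, x e ∂ν₁) * (∑' t, P₁ (alive S A B t)).toReal := by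
    intro n
    have hmu := hS.measurableSet_up n
    have hmd := hS.measurableSet_down n
    have hma := hS.measurableSet_alive n
    have hem : Measurable fun ω => Real.exp (-S n ω) := (hm n).neg.exp
    have hui : IntegrableOn (fun ω => Real.exp (-S n ω)) {ω | A ≤ S n ω} P₁ := by
      refine ⟨hem.aestronglyMeasurable, ?_⟩
      rw [hasFiniteIntegral_iff_ofReal (ae_of_all _ fun _ => (Real.exp_pos _).le),
        setLIntegral_exp_up hx hν hA hB]
      exact measure_lt_top _ _
    have hdi : IntegrableOn (fun ω => Real.exp (-S n ω)) {ω | S n ω ≤ -B} P₁ := by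
      refine ⟨hem.aestronglyMeasurable, ?_⟩
      rw [hasFiniteIntegral_iff_ofReal (ae_of_all _ fun _ => (Real.exp_pos _).le),
        setLIntegral_exp_down hx hν hA hB]
      exact measure_lt_top _ _
    have hue : ∫ ω in {ω | A ≤ S n ω}, Real.exp (-S n ω) ∂P₁ = P₀.real {ω | A ≤ S n ω} := by
      rw [integral_eq_lintegral_of_nonneg_ae (ae_of_all _ fun _ => (Real.exp_pos _).le)
        hem.aestronglyMeasurable, setLIntegral_exp_up hx hν hA hB]
      rfl
    have hde : ∫ ω in {ω | S n ω ≤ -B}, Real.exp (-S n ω) ∂P₁ = P₀.real {ω | S n ω ≤ -B} := by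
      rw [integral_eq_lintegral_of_nonneg_ae (ae_of_all _ fun _ => (Real.exp_pos _).le)
        hem.aestronglyMeasurable, setLIntegral_exp_down hx hν hA hB]
      rfl
    have hcompl : {ω | A ≤ S n ω} = ({ω | S n ω ≤ -B} ∪ alive S A B n)ᶜ := by
      ext ω
      have h2 : ω ∈ alive S A B n ↔ -B < S n ω ∧ S n ω < A := Iff.rfl
      simp only [Set.mem_compl_iff, Set.mem_union, Set.mem_ofPred_eq, h2, not_or, not_and, not_lt,
        not_le]
      constructor
      · intro h; exact ⟨by linarith, fun _ => h⟩
      · exact fun h => h.2 h.1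
    have hdisj : Disjoint {ω | S n ω ≤ -B} (alive S A B n) := by
      rw [Set.disjoint_left]
      exact fun ω h h2 => absurd h2.1 (not_lt.2 h)
    -- With `c = 1 / α` the exponential term is at most `1`, since the change of measure gives `P₀`
    -- of an upward exit.
    have i1 : (a + 1) * P₁.real {ω | A ≤ S n ω} - 1 ≤ ∫ ω in {ω | A ≤ S n ω}, S n ω ∂P₁ := by
      have h1 : ∫ ω in {ω | A ≤ S n ω}, ((a + 1) - 1 / α * Real.exp (-S n ω)) ∂P₁ ≤
          ∫ ω in {ω | A ≤ S n ω}, S n ω ∂P₁ := by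
        refine setIntegral_mono ((integrable_const _).sub (hui.const_mul _))
          (hSi n).integrableOn fun ω => ?_
        have := log_add_one_sub_le (c := 1 / α) (by positivity) (S n ω)
        rw [one_div, Real.log_inv] at this
        rw [ha, one_div]
        linarith
      rw [integral_sub (integrable_const _) (hui.const_mul _), integral_const_mul, hue,
        setIntegral_const, smul_eq_mul] at h1
      have h2 : P₀.real {ω | A ≤ S n ω} ≤ α := by
        refine ENNReal.toReal_le_of_le_ofReal hα.le ?_
        rw [← hup]
        exact measure_mono fun ω hω => ⟨n, hω⟩
      have h3 : 1 / α * P₀.real {ω | A ≤ S n ω} ≤ 1 := by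
        rw [one_div, inv_mul_le_iff₀ hα]; linarith
      linarith
    -- Here `c = β`, which is of the order of `exp (-B)`; the `P₀`-probability of the event is
    -- simply bounded by `1`.
    have i2 : (Real.log β + 1) * P₁.real {ω | S n ω ≤ -B} - β ≤
        ∫ ω in {ω | S n ω ≤ -B}, S n ω ∂P₁ := by
      have h1 : ∫ ω in {ω | S n ω ≤ -B}, ((Real.log β + 1) - β * Real.exp (-S n ω)) ∂P₁ ≤
          ∫ ω in {ω | S n ω ≤ -B}, S n ω ∂P₁ :=
        setIntegral_mono ((integrable_const _).sub (hdi.const_mul _))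
          (hSi n).integrableOn fun ω => log_add_one_sub_le hβ _
      rw [integral_sub (integrable_const _) (hdi.const_mul _), integral_const_mul, hde,
        setIntegral_const, smul_eq_mul] at h1
      have h2 : P₀.real {ω | S n ω ≤ -B} ≤ 1 := measureReal_le_one
      nlinarith
    have i3 : -(B * P₁.real (alive S A B n)) ≤ ∫ ω in alive S A B n, S n ω ∂P₁ := by
      have h1 : ∫ ω in alive S A B n, (-B) ∂P₁ ≤ ∫ ω in alive S A B n, S n ω ∂P₁ :=
        setIntegral_mono_on (integrable_const _) (hSi n).integrableOn hma fun ω hω => hω.1.le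
      rw [setIntegral_const, smul_eq_mul] at h1
      linarith
    have e1 : ∫ ω, S n ω ∂P₁ = ∫ ω in {ω | S n ω ≤ -B}, S n ω ∂P₁ +
        ∫ ω in alive S A B n, S n ω ∂P₁ + ∫ ω in {ω | A ≤ S n ω}, S n ω ∂P₁ := by
      rw [hcompl, ← setIntegral_union hdisj hma (hSi n).integrableOn (hSi n).integrableOn,
        integral_add_compl (hmd.union hma) (hSi n)]
    have e2 : P₁.real {ω | A ≤ S n ω} =
        1 - P₁.real {ω | S n ω ≤ -B} - P₁.real (alive S A B n) := by
      rw [hcompl, measureReal_compl (hmd.union hma), measureReal_union hdisj hma, probReal_univ]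
      ring
    have e3 := integral_frozenWalk hx hc hA hB n
    have e4 : ∑ t ∈ Finset.range n, P₁.real (alive S A B t) ≤
        (∑' t, P₁ (alive S A B t)).toReal := by
      simp only [measureReal_def]
      rw [← ENNReal.toReal_sum fun t _ => measure_ne_top _ _]
      exact ENNReal.toReal_mono hfin (ENNReal.sum_le_tsum _)
    have e5 := mul_le_mul_of_nonneg_left e4 hI
    rw [← e3, e1] at e5
    rw [← e2]
    linarith
  have l1 : Tendsto (fun n => P₁.real (alive S A B n)) atTop (𝓝 0) := by
    have := (ENNReal.tendsto_toReal ENNReal.zero_ne_top).comp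
      (ENNReal.tendsto_atTop_zero_of_tsum_ne_top hfin)
    rwa [ENNReal.toReal_zero] at this
  have l2 : Tendsto (fun n => P₁.real {ω | S n ω ≤ -B}) atTop (𝓝 β) := by
    have h := hS.tendsto_measure_down P₁
    rw [hdown] at h
    have := (ENNReal.tendsto_toReal ENNReal.ofReal_ne_top).comp h
    rwa [ENNReal.toReal_ofReal hβ.le] at this
  have l3 := ((((((tendsto_const_nhds (x := (1 : ℝ))).sub l2).sub l1).const_mul (a + 1)).sub_const
    1).add (l2.const_mul (Real.log β + 1)) |>.sub_const β).sub (l1.const_mul B)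
  have := le_of_tendsto' l3 key
  calc _ = _ := by ring
    _ ≤ _ := this

end WaldIdentity

/-! ### The RLT-SPRT as a Markov chain -/

section StateMachine

/-- Everything that is drawn in one time unit, with the observations replaced by their
log-likelihood ratios. -/
abbrev LStep (K : ℕ) : Type := (Fin K → ℝ × unitInterval) × Equiv.Perm (Fin K)

/-- The state of the network: the log-likelihood ratios that the SUs have accumulated since they
last sampled, and the test statistic of the fusion center. -/
abbrev NetState (K : ℕ) : Type := (Fin K → ℝ) × ℝ

/-- The parameters of the RLT-SPRT. -/
structure RLTParams where
  φ : ℝ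
  Δ : ℝ
  r : ℕ
  A : ℝ
  B : ℝ

/-- The parameters with the roles of the two hypotheses exchanged. -/
def RLTParams.flip (p : RLTParams) : RLTParams := { p with A := p.B, B := p.A }

/-- The statistic `F` after an increment `v`, unless the test has already stopped. -/
def freeze (A B F v : ℝ) : ℝ := if F ∈ Set.Ioo (-B) A then F + v else F

/-- The increment that stands for a message about an increment `z` of a local log-likelihood
ratio. -/
def RLTParams.increment (p : RLTParams) (z u : ℝ) : ℝ :=
  Real.sign z * (p.Δ + quantize p.φ p.r (|z| - p.Δ) u)

variable {K : ℕ} (p : RLTParams)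

/-- The new state when SU `k` makes an observation. -/
def RLTParams.micro (k : Fin K) (y : ℝ × unitInterval) (st : NetState K) : NetState K :=
  if p.Δ ≤ |st.1 k + y.1| then
    (Function.update st.1 k 0, freeze p.A p.B st.2 (p.increment (st.1 k + y.1) y.2))
  else (Function.update st.1 k (st.1 k + y.1), st.2)

/-- The new state when the SUs in a list make an observation, one after the other. -/
def RLTParams.microList (e : Fin K → ℝ × unitInterval) (l : List (Fin K)) (st : NetState K) :
    NetState K :=
  l.foldl (fun st k => p.micro k (e k) st) st

/-- The new state after one time unit. -/
def RLTParams.step (e : LStep K) (st : NetState K) : NetState K :=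
  p.microList e.1 ((List.finRange K).map e.2) st

/-- The state after `t` time units. -/
def RLTParams.state : ℕ → (ℕ → LStep K) → NetState K
  | 0, _ => (0, 0)
  | t + 1, ω => p.step (ω t) (state t ω)

theorem RLTParams.microList_nil (e : Fin K → ℝ × unitInterval) (st : NetState K) :
    p.microList e [] st = st := rfl

theorem RLTParams.microList_cons (e : Fin K → ℝ × unitInterval) (k : Fin K) (l : List (Fin K))
    (st : NetState K) : p.microList e (k :: l) st = p.microList e l (p.micro k (e k) st) := rfl

theorem RLTParams.micro_fst (k : Fin K) (y : ℝ × unitInterval) (st : NetState K) :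
    (p.micro k y st).1 =
      Function.update st.1 k (if p.Δ ≤ |st.1 k + y.1| then 0 else st.1 k + y.1) := by
  unfold RLTParams.micro
  split_ifs <;> rfl

theorem RLTParams.microList_fst (e : Fin K → ℝ × unitInterval) {l : List (Fin K)} (hl : l.Nodup)
    (st : NetState K) (k : Fin K) :
    (p.microList e l st).1 k = if k ∈ l then
      (if p.Δ ≤ |st.1 k + (e k).1| then 0 else st.1 k + (e k).1) else st.1 k := by
  induction l generalizing st with
  | nil => simp [microList_nil]
  | cons j l ih =>
    obtain ⟨hj, hl⟩ := List.nodup_cons.1 hl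
    rw [microList_cons, ih hl, micro_fst]
    by_cases hk : k = j
    · subst hk
      simp [hj]
    · simp [hk]

theorem nodup_map_finRange (σ : Equiv.Perm (Fin K)) : ((List.finRange K).map σ).Nodup :=
  (List.nodup_finRange K).map σ.injective

theorem mem_map_finRange (σ : Equiv.Perm (Fin K)) (k : Fin K) : k ∈ (List.finRange K).map σ :=
  List.mem_map.2 ⟨σ.symm k, List.mem_finRange _, σ.apply_symm_apply k⟩

theorem RLTParams.step_fst (e : LStep K) (st : NetState K) (k : Fin K) :
    (p.step e st).1 k = if p.Δ ≤ |st.1 k + (e.1 k).1| then 0 else st.1 k + (e.1 k).1 := by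
  rw [step, microList_fst _ _ (nodup_map_finRange _), if_pos (mem_map_finRange _ _)]

theorem RLTParams.state_succ (t : ℕ) (ω : ℕ → LStep K) :
    p.state (t + 1) ω = p.step (ω t) (p.state t ω) := rfl

theorem RLTParams.abs_state_fst_lt (hΔ : 0 < p.Δ) (t : ℕ) (ω : ℕ → LStep K) (k : Fin K) :
    |(p.state t ω).1 k| < p.Δ := by
  cases t with
  | zero => simpa [state] using hΔ
  | succ t =>
    rw [state_succ, step_fst]
    split_ifs with h
    · simpa using hΔ
    · exact not_le.1 h

theorem RLTParams.state_congr (t : ℕ) {ω ω' : ℕ → LStep K} (h : ∀ s < t, ω s = ω' s) :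
    p.state t ω = p.state t ω' := by
  induction t with
  | zero => rfl
  | succ t ih =>
    rw [state_succ, state_succ, ih fun s hs => h s (hs.trans t.lt_succ_self), h t t.lt_succ_self]

theorem RLTParams.state_update (t : ℕ) (ω : ℕ → LStep K) (e : LStep K) :
    p.state t (Function.update ω t e) = p.state t ω :=
  p.state_congr t fun s hs => by rw [Function.update_of_ne hs.ne]

theorem RLTParams.micro_snd_of_notMem {k : Fin K} {y : ℝ × unitInterval} {st : NetState K}
    (h : st.2 ∉ Set.Ioo (-p.B) p.A) : (p.micro k y st).2 = st.2 := by
  unfold micro freeze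
  rw [if_neg h]
  split_ifs <;> rfl

theorem RLTParams.microList_snd_of_notMem {e : Fin K → ℝ × unitInterval} {l : List (Fin K)}
    {st : NetState K} (h : st.2 ∉ Set.Ioo (-p.B) p.A) : (p.microList e l st).2 = st.2 := by
  induction l generalizing st with
  | nil => rfl
  | cons k l ih =>
    have h2 := p.micro_snd_of_notMem (k := k) (y := e k) h
    rw [microList_cons, ih (by rwa [h2]), h2]

/-! ### Measurability -/

theorem measurable_quantize (φ : ℝ) (r : ℕ) :
    Measurable fun z : ℝ × ℝ => quantize φ r z.1 z.2 := by
  unfold quantize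
  by_cases hr : r = 0
  · simp [hr]
  · simp only [hr, if_false]
    have h1 : Measurable fun z : ℝ × ℝ => ((⌊z.1 * r / φ⌋ : ℤ) : ℝ) :=
      (measurable_of_countable _).comp (Int.measurable_floor.comp (by fun_prop))
    refine Measurable.ite (measurableSet_lt measurable_snd ?_) ?_ ?_ <;> fun_prop

theorem measurable_sign : Measurable Real.sign := by
  unfold Real.sign
  exact Measurable.ite (measurableSet_lt measurable_id measurable_const) measurable_const
    (Measurable.ite (measurableSet_lt measurable_const measurable_id) measurable_const
      measurable_const)

theorem RLTParams.measurable_increment :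
    Measurable fun z : ℝ × ℝ => p.increment z.1 z.2 := by
  unfold increment
  refine (measurable_sign.comp measurable_fst).mul (measurable_const.add ?_)
  exact (measurable_quantize p.φ p.r).comp
    (((measurable_norm.comp measurable_fst).sub_const p.Δ).prodMk measurable_snd)

theorem measurable_freeze (A B : ℝ) : Measurable fun z : ℝ × ℝ => freeze A B z.1 z.2 := by
  unfold freeze
  exact Measurable.ite (measurable_fst measurableSet_Ioo) (by fun_prop) measurable_fst

theorem RLTParams.measurable_micro (k : Fin K) :
    Measurable fun z : (ℝ × unitInterval) × NetState K => p.micro k z.1 z.2 := by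
  have hz : Measurable fun z : (ℝ × unitInterval) × NetState K => z.2.1 k + z.1.1 := by fun_prop
  have hu : ∀ g : (ℝ × unitInterval) × NetState K → ℝ, Measurable g →
      Measurable fun z : (ℝ × unitInterval) × NetState K => Function.update z.2.1 k (g z) := by
    intro g hg
    exact (measurable_update_prod (X := fun _ : Fin K => ℝ) k).comp
      ((measurable_fst.comp measurable_snd).prodMk hg)
  unfold micro
  refine Measurable.ite (measurableSet_le measurable_const (measurable_norm.comp hz)) ?_ ?_
  · refine (hu _ measurable_const).prodMk ((measurable_freeze p.A p.B).comp
      ((measurable_snd.comp measurable_snd).prodMk ?_))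
    exact p.measurable_increment.comp
      (hz.prodMk (measurable_subtype_coe.comp (measurable_snd.comp measurable_fst)))
  · exact (hu _ hz).prodMk (measurable_snd.comp measurable_snd)

theorem RLTParams.measurable_microList (l : List (Fin K)) :
    Measurable fun z : (Fin K → ℝ × unitInterval) × NetState K => p.microList z.1 l z.2 := by
  induction l with
  | nil => exact measurable_snd
  | cons k l ih =>
    simp_rw [microList_cons]
    exact ih.comp (measurable_fst.prodMk ((p.measurable_micro k).comp
      (((measurable_pi_apply k).comp measurable_fst).prodMk measurable_snd)))

theorem RLTParams.measurable_step :
    Measurable fun z : LStep K × NetState K => p.step z.1 z.2 := by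
  -- The orders are countably many, so joint measurability can be checked for each fixed order.
  have : Measurable fun z : Equiv.Perm (Fin K) × ((Fin K → ℝ × unitInterval) × NetState K) =>
      p.microList z.2.1 ((List.finRange K).map z.1) z.2.2 :=
    measurable_from_prod_countable_right fun σ =>
      p.measurable_microList ((List.finRange K).map σ)
  exact this.comp ((measurable_snd.comp measurable_fst).prodMk
    ((measurable_fst.comp measurable_fst).prodMk measurable_snd))

theorem RLTParams.measurable_state (t : ℕ) : Measurable (p.state (K := K) t) := by
  induction t with
  | zero => exact measurable_const
  | succ t ih =>
    have h : Measurable fun ω : ℕ → LStep K => (ω t, p.state t ω) :=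
      (measurable_pi_apply t).prodMk ih
    exact p.measurable_step.comp h

/-- The test statistic of the fusion center, stopped when it leaves `(-B, A)`. -/
def RLTParams.stat (t : ℕ) (ω : ℕ → LStep K) : ℝ := (p.state t ω).2

theorem RLTParams.isTest_stat (hA : 0 < p.A) (hB : 0 < p.B) :
    IsTest (p.stat (K := K)) p.A p.B where
  posA := hA
  posB := hB
  meas t := measurable_snd.comp (p.measurable_state t)
  dep t ω ω' h := by rw [stat, stat, p.state_congr t h]
  zero ω := rfl
  frozen t ω h := p.microList_snd_of_notMem h

/-! ### Exchanging the hypotheses -/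

/-- The log-likelihood ratios with the roles of the two hypotheses exchanged. -/
def flipStep (e : LStep K) : LStep K := (fun k => (-(e.1 k).1, (e.1 k).2), e.2)

def flipState (st : NetState K) : NetState K := (-st.1, -st.2)

theorem freeze_neg (A B F v : ℝ) : freeze B A (-F) (-v) = -freeze A B F v := by
  unfold freeze
  have : -F ∈ Set.Ioo (-A) B ↔ F ∈ Set.Ioo (-B) A := by
    simp only [Set.mem_Ioo]
    constructor <;> rintro ⟨h1, h2⟩ <;> constructor <;> linarith
  simp only [this]
  split_ifs
  · ring
  · rfl

theorem RLTParams.increment_flip (z u : ℝ) : p.flip.increment (-z) u = -p.increment z u := by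
  unfold increment
  rw [Real.sign_neg, abs_neg, neg_mul]
  rfl

theorem RLTParams.micro_flip (k : Fin K) (y : ℝ × unitInterval) (st : NetState K) :
    p.flip.micro k (-y.1, y.2) (flipState st) = flipState (p.micro k y st) := by
  have h1 : ∀ a : ℝ, Function.update (-st.1) k (-a) = -Function.update st.1 k a := by
    intro a
    ext j
    by_cases hj : j = k
    · subst hj; simp
    · simp [hj]
  have h2 : (flipState st).1 k + -y.1 = -(st.1 k + y.1) := by
    simp only [flipState, Pi.neg_apply]; ring
  have h0 := h1 0
  rw [neg_zero] at h0
  unfold micro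
  simp only [h2, abs_neg, p.increment_flip]
  have h3 : p.flip.Δ = p.Δ := rfl
  have h4 := freeze_neg p.A p.B st.2 (p.increment (st.1 k + y.1) y.2)
  rw [h3]
  split_ifs
  · exact Prod.ext h0 h4
  · exact Prod.ext (h1 _) rfl

theorem RLTParams.step_flip (e : LStep K) (st : NetState K) :
    p.flip.step (flipStep e) (flipState st) = flipState (p.step e st) := by
  have : ∀ (l : List (Fin K)) (st : NetState K),
      p.flip.microList (flipStep e).1 l (flipState st) = flipState (p.microList e.1 l st) := by
    intro l
    induction l with
    | nil => exact fun st => rfl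
    | cons k l ih =>
      intro st
      rw [microList_cons, microList_cons, ← ih]
      exact congrArg _ (p.micro_flip k (e.1 k) st)
  exact this _ st

/-- Sampling and quantization see only absolute values, so reversing all log-likelihood ratios
reverses every message. This reduces `H_0` to `H_1`. -/
theorem RLTParams.stat_flip (t : ℕ) (ω : ℕ → LStep K) :
    p.flip.stat t (fun s => flipStep (ω s)) = -p.stat t ω := by
  have : p.flip.state t (fun s => flipStep (ω s)) = flipState (p.state t ω) := by
    induction t with
    | zero => simp [state, flipState]
    | succ t ih => rw [state_succ, state_succ, ih, step_flip]
  unfold stat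
  rw [this]
  rfl

theorem measurable_flipStep : Measurable (flipStep (K := K)) := by
  unfold flipStep
  fun_prop

end StateMachine

/-! ### The randomized quantizer on the exponential scale -/

section Quantizer

theorem exp_mul_le_interpolate {θ : ℝ} (h0 : 0 ≤ θ) (h1 : θ ≤ 1) (d : ℝ) :
    Real.exp (θ * d) ≤ 1 - θ + θ * Real.exp d := by
  have := convexOn_exp.2 (Set.mem_univ (0 : ℝ)) (Set.mem_univ d) (sub_nonneg.2 h1) h0 (by ring)
  simpa using this

/-- The probability with which the randomized quantizer rounds down, when the overshoot exceeds a
multiple of `ε` by `t`. -/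
def roundDownProb (ε t : ℝ) : ℝ := (1 - Real.exp (t - ε)) / (1 - Real.exp (-ε))

theorem roundDownProb_mem {ε t : ℝ} (hε : 0 < ε) (ht : 0 ≤ t) (hte : t ≤ ε) :
    0 ≤ roundDownProb ε t ∧ roundDownProb ε t ≤ 1 := by
  have h1 : Real.exp (-ε) < 1 := Real.exp_lt_one_iff.2 (by linarith)
  have h2 : Real.exp (t - ε) ≤ 1 := Real.exp_le_one_iff.2 (by linarith)
  have h3 : Real.exp (-ε) ≤ Real.exp (t - ε) := Real.exp_le_exp.2 (by linarith)
  unfold roundDownProb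
  exact ⟨div_nonneg (by linarith) (by linarith), (div_le_one (by linarith)).2 (by linarith)⟩

/-- The randomized quantizer is unbiased on the exponential scale. -/
theorem roundDownProb_exp {ε : ℝ} (hε : 0 < ε) (t : ℝ) :
    roundDownProb ε t * Real.exp (-t) + (1 - roundDownProb ε t) * Real.exp (ε - t) = 1 := by
  have h1 : Real.exp (-ε) < 1 := Real.exp_lt_one_iff.2 (by linarith)
  have h2 : 1 - Real.exp (-ε) ≠ 0 := by linarith
  have e1 : Real.exp (-t) = Real.exp (ε - t) * Real.exp (-ε) := by
    rw [← Real.exp_add]; congr 1; ring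
  have e2 : Real.exp (ε - t) * Real.exp (t - ε) = 1 := by
    rw [← Real.exp_add, ← Real.exp_zero]; congr 1; ring
  have e3 : roundDownProb ε t * (1 - Real.exp (-ε)) = 1 - Real.exp (t - ε) :=
    div_mul_cancel₀ _ h2
  rw [e1]
  linear_combination e2 - Real.exp (ε - t) * e3

/-- The opposite exponential is biased upwards, but only by a product of two small factors. -/
theorem roundDownProb_exp_neg {ε : ℝ} (hε : 0 < ε) (t : ℝ) :
    roundDownProb ε t * Real.exp t + (1 - roundDownProb ε t) * Real.exp (t - ε) =
      1 + (Real.exp t - 1) * (1 - Real.exp (t - ε)) := by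
  have h1 : Real.exp (-ε) < 1 := Real.exp_lt_one_iff.2 (by linarith)
  have h2 : 1 - Real.exp (-ε) ≠ 0 := by linarith
  have e1 : Real.exp (t - ε) = Real.exp t * Real.exp (-ε) := by
    rw [← Real.exp_add]; congr 1
  have e3 : roundDownProb ε t * (1 - Real.exp (-ε)) = 1 - Real.exp (t - ε) :=
    div_mul_cancel₀ _ h2
  rw [e1] at e3 ⊢
  linear_combination Real.exp t * e3

/-- The factors are at most `t exp ε` and `ε - t`, and `t (ε - t) ≤ ε ^ 2 / 4`. -/
theorem exp_sub_one_mul_le {ε t : ℝ} (ht : 0 ≤ t) (hte : t ≤ ε) :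
    (Real.exp t - 1) * (1 - Real.exp (t - ε)) ≤ ε ^ 2 / 4 * Real.exp ε := by
  have h1 : Real.exp t - 1 ≤ t * Real.exp ε := by
    have := Real.add_one_le_exp (-t)
    have h2 : Real.exp t * Real.exp (-t) = 1 := by rw [← Real.exp_add]; simp
    have h3 : Real.exp t ≤ Real.exp ε := Real.exp_le_exp.2 hte
    nlinarith [Real.exp_pos t, Real.exp_pos ε]
  have h2 : 1 - Real.exp (t - ε) ≤ ε - t := by
    have := Real.add_one_le_exp (t - ε)
    linarith
  have h3 : 0 ≤ Real.exp t - 1 := by linarith [Real.one_le_exp ht]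
  calc _ ≤ t * Real.exp ε * (ε - t) := by
        refine mul_le_mul h1 h2 ?_ (mul_nonneg ht (Real.exp_pos _).le)
        linarith [Real.exp_le_one_iff.2 (show t - ε ≤ 0 by linarith)]
    _ ≤ _ := by nlinarith [Real.exp_pos ε, mul_nonneg (sq_nonneg (ε - 2 * t)) (Real.exp_pos ε).le]

/-- With `U = exp ((1 - 2 δ ^ 2) x)` and `W = exp (2 δ ^ 2 x)` the right side is `1 + U W - U - W`,
the room gained by lowering the exponent from `1`. The left side bounds the bias `ε ^ 2 / 4 exp ε`
carried by the factor `W`. Since `W - 1` is at least of order `δ ^ 2 Δ` and `ε ^ 2 ≤ δ ^ 2 Δ ^ 2`, a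
loss of order `δ ^ 2` in the exponent suffices. -/
theorem quantization_slack {Δ δ ε : ℝ} (hΔ : 0 < Δ) (hδ : δ ≤ 1 / 4) (hε : 0 ≤ ε)
    (hεδ : ε ≤ δ * Δ) {x : ℝ} (hx : Δ ≤ x) :
    ε ^ 2 / 4 * Real.exp ε * Real.exp ((2 * δ ^ 2) * x) ≤
      (Real.exp ((1 - 2 * δ ^ 2) * x) - 1) * (Real.exp ((2 * δ ^ 2) * x) - 1) := by
  have hδ0 : 0 ≤ δ := by
    by_contra h
    nlinarith [mul_neg_of_neg_of_pos (not_le.1 h) hΔ]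
  have hδ2 : δ ^ 2 ≤ 1 / 16 := by nlinarith
  have hxp : 0 < x := hΔ.trans_le hx
  set y := (2 * δ ^ 2) * Δ with hy
  have hy0 : 0 ≤ y := by positivity
  set W := Real.exp ((2 * δ ^ 2) * x)
  have hW : 1 + y ≤ W := by
    have := Real.add_one_le_exp ((2 * δ ^ 2) * x)
    have : y ≤ (2 * δ ^ 2) * x := mul_le_mul_of_nonneg_left hx (by positivity)
    linarith
  set κ := ε ^ 2 / 4 * Real.exp ε
  have hκ : κ ≤ δ ^ 2 * Δ ^ 2 / 4 * Real.exp (Δ / 4) := by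
    have h1 : ε ^ 2 ≤ (δ * Δ) ^ 2 := pow_le_pow_left₀ hε hεδ 2
    have h2 : Real.exp ε ≤ Real.exp (Δ / 4) := Real.exp_le_exp.2 (by nlinarith)
    calc κ = ε ^ 2 / 4 * Real.exp ε := rfl
      _ ≤ (δ * Δ) ^ 2 / 4 * Real.exp (Δ / 4) := by gcongr
      _ = _ := by ring
  have hU : Δ / 2 * Real.exp (3 * Δ / 8) ≤ Real.exp ((1 - 2 * δ ^ 2) * x) - 1 := by
    -- `δ ≤ 1 / 4` gives `1 - 2 δ ^ 2 ≥ 7 / 8`. The exponent is later shared out as `1 / 2`, `1 / 4`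
    -- and `1 / 8` of `Δ`, for the factor `Δ / 2`, for `exp ε` and for `1 + y`.
    have h1 : Real.exp (7 * Δ / 8) ≤ Real.exp ((1 - 2 * δ ^ 2) * x) :=
      Real.exp_le_exp.2 (by nlinarith)
    have h2 : Real.exp (7 * Δ / 8) = Real.exp (3 * Δ / 8) * Real.exp (Δ / 2) := by
      rw [← Real.exp_add]; congr 1; ring
    have h3 := Real.add_one_le_exp (Δ / 2)
    have h4 : 1 ≤ Real.exp (3 * Δ / 8) := Real.one_le_exp (by linarith)
    nlinarith
  set U := Real.exp ((1 - 2 * δ ^ 2) * x)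
  have hκy : κ * (1 + y) ≤ (U - 1) * y := by
    have h1 : 1 + y ≤ Real.exp (Δ / 8) := by
      have := Real.add_one_le_exp (Δ / 8)
      nlinarith
    have h2 : Real.exp (3 * Δ / 8) = Real.exp (Δ / 4) * Real.exp (Δ / 8) := by
      rw [← Real.exp_add]; congr 1; ring
    calc κ * (1 + y) ≤ δ ^ 2 * Δ ^ 2 / 4 * Real.exp (Δ / 4) * Real.exp (Δ / 8) := by gcongr
      _ = δ ^ 2 * Δ ^ 2 / 4 * Real.exp (3 * Δ / 8) := by rw [h2]; ring
      _ ≤ Δ / 2 * Real.exp (3 * Δ / 8) * y := by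
        have : 0 ≤ δ ^ 2 * Δ ^ 2 * Real.exp (3 * Δ / 8) := by positivity
        rw [hy]
        linarith
      _ ≤ _ := mul_le_mul_of_nonneg_right hU hy0
  have hU0 : 0 ≤ U - 1 := le_trans (by positivity) hU
  have h1y : 0 < 1 + y := by linarith
  have h5 : (κ * (1 + y)) * W ≤ (U - 1) * y * W :=
    mul_le_mul_of_nonneg_right hκy (by linarith)
  have h6 : (U - 1) * (y * W) ≤ (U - 1) * ((W - 1) * (1 + y)) :=
    mul_le_mul_of_nonneg_left (by linarith) hU0
  refine le_of_mul_le_mul_right ?_ h1y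
  linarith

theorem lintegral_unitInterval_ite {q : ℝ} (h0 : 0 ≤ q) (h1 : q ≤ 1) (a b : ℝ≥0∞) :
    ∫⁻ u : unitInterval, (if (u : ℝ) < q then a else b) =
      ENNReal.ofReal q * a + ENNReal.ofReal (1 - q) * b := by
  have hm : MeasurableSet {u : unitInterval | (u : ℝ) < q} :=
    measurableSet_lt measurable_subtype_coe measurable_const
  have hv : (volume : Measure unitInterval) {u : unitInterval | (u : ℝ) < q} =
      ENNReal.ofReal q := by
    rw [Measure.Subtype.volume_def,
      Measure.comap_apply _ Subtype.val_injective (fun s hs =>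
        (MeasurableSet.subtype_image measurableSet_Icc hs)) _ hm]
    have : Subtype.val '' {u : unitInterval | (u : ℝ) < q} = Set.Ico 0 q := by
      ext z
      simp only [Set.mem_image, Set.mem_ofPred_eq, Subtype.exists, Set.mem_Icc, Set.mem_Ico]
      constructor
      · rintro ⟨a, ⟨ha, -⟩, hq, rfl⟩; exact ⟨ha, hq⟩
      · rintro ⟨ha, hq⟩; exact ⟨z, ⟨ha, by linarith⟩, hq, rfl⟩
    rw [this, Real.volume_Ico, sub_zero]
  rw [← lintegral_add_compl _ hm]
  congr 1
  · rw [setLIntegral_congr_fun hm (f := fun u : unitInterval => if (u : ℝ) < q then a else b)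
      (g := fun _ => a) fun u hu => if_pos hu, setLIntegral_const, hv,
      mul_comm]
  · rw [setLIntegral_congr_fun hm.compl (f := fun u : unitInterval => if (u : ℝ) < q then a else b)
      (g := fun _ => b) fun u hu => if_neg hu,
      setLIntegral_const, prob_compl_eq_one_sub hm, hv, mul_comm,
      ENNReal.ofReal_sub _ h0, ENNReal.ofReal_one]

theorem quantize_zero (φ q u : ℝ) : quantize φ 0 q u = 0 := by simp [quantize]

theorem quantize_eq {φ : ℝ} {r : ℕ} (hr : r ≠ 0) (q u : ℝ) :
    quantize φ r q u =
      if u < roundDownProb (φ / r) (q - ⌊q * r / φ⌋ * (φ / r)) then ⌊q * r / φ⌋ * (φ / r)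
      else ⌊q * r / φ⌋ * (φ / r) + φ / r := by
  unfold quantize roundDownProb
  rw [if_neg hr, show q - ((⌊q * r / φ⌋ : ℝ) + 1) * (φ / r) =
    q - ⌊q * r / φ⌋ * (φ / r) - φ / r by ring]
  congr 1
  ring

theorem quantize_remainder {φ : ℝ} {r : ℕ} (hφ : 0 < φ) (hr : r ≠ 0) (q : ℝ) :
    0 ≤ q - ⌊q * r / φ⌋ * (φ / r) ∧ q - ⌊q * r / φ⌋ * (φ / r) ≤ φ / r := by
  have hr' : (0 : ℝ) < r := by positivity
  have hε : 0 < φ / r := by positivity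
  have e : q = q * r / φ * (φ / r) := by field_simp
  have h1 := mul_le_mul_of_nonneg_right (Int.floor_le (q * r / φ)) hε.le
  have h2 := mul_le_mul_of_nonneg_right (Int.lt_floor_add_one (q * r / φ)).le hε.le
  rw [← e] at h1 h2
  constructor <;> linarith

theorem abs_quantize_sub_le {φ : ℝ} (hφ : 0 < φ) (r : ℕ) {q : ℝ} (h0 : 0 ≤ q) (hq : q ≤ φ) (u : ℝ) :
    |quantize φ r q u - q| ≤ φ / max (r : ℝ) 1 := by
  by_cases hr : r = 0
  · subst hr
    rw [quantize_zero, zero_sub, abs_neg, abs_of_nonneg h0]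
    simpa using hq
  · have h1 : (1 : ℝ) ≤ r := by exact_mod_cast Nat.one_le_iff_ne_zero.2 hr
    rw [max_eq_left h1, quantize_eq hr]
    have := quantize_remainder hφ hr q
    split_ifs <;> rw [abs_le] <;> constructor <;> linarith [this.1, this.2]

/-- The randomized quantizer almost preserves the exponential martingale property of the messages. -/
theorem lintegral_quantize_le {φ Δ δ : ℝ} {r : ℕ} (hφ : 0 < φ) (hΔ : 0 < Δ) (hδ : δ ≤ 1 / 4)
    (hδ0 : 0 ≤ δ) (hε : φ / max (r : ℝ) 1 ≤ δ * Δ) {x : ℝ} (hx : Δ ≤ x) :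
    ∫⁻ u : unitInterval,
      ENNReal.ofReal (Real.exp ((1 - 2 * δ ^ 2) * (Δ + quantize φ r (x - Δ) u)) +
        Real.exp (x - (1 - 2 * δ ^ 2) * (Δ + quantize φ r (x - Δ) u))) ≤
      ENNReal.ofReal (1 + Real.exp x) := by
  have hδ2 : δ ^ 2 ≤ 1 / 16 := by nlinarith
  set θ := 1 - 2 * δ ^ 2 with hθ
  have hθ0 : 0 ≤ θ := by linarith
  have hθ1 : θ ≤ 1 := by linarith [sq_nonneg δ]
  -- Without overshoot bits the message is at most `x` in size, and the claim is `(exp (θ Δ) - 1)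
  -- (exp (x - θ Δ) - 1) ≥ 0`.
  by_cases hr : r = 0
  · subst hr
    simp only [quantize_zero, add_zero, lintegral_const, measure_univ, mul_one]
    refine ENNReal.ofReal_le_ofReal ?_
    have e : Real.exp x = Real.exp (θ * Δ) * Real.exp (x - θ * Δ) := by
      rw [← Real.exp_add]; congr 1; ring
    have h1 : 1 ≤ Real.exp (θ * Δ) := Real.one_le_exp (by positivity)
    have h2 : 1 ≤ Real.exp (x - θ * Δ) := Real.one_le_exp (by nlinarith)
    rw [e]
    nlinarith [mul_nonneg (sub_nonneg.2 h1) (sub_nonneg.2 h2)]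
  · have h1 : (1 : ℝ) ≤ r := by exact_mod_cast Nat.one_le_iff_ne_zero.2 hr
    rw [max_eq_left h1] at hε
    obtain ⟨ht0, ht1⟩ := quantize_remainder hφ hr (x - Δ)
    have hε0 : 0 < φ / r := by positivity
    set ε := φ / r
    set t := (x - Δ) - ⌊(x - Δ) * r / φ⌋ * ε with ht
    set q := roundDownProb ε t with hq
    obtain ⟨hq0, hq1⟩ := roundDownProb_mem hε0 ht0 ht1
    set g : ℝ → ℝ := fun a => Real.exp (θ * a) + Real.exp (x - θ * a) with hg
    have hg0 : ∀ a, 0 ≤ g a := fun a => by positivity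
    -- Chords of the exponential reduce exponents `θ d` to exponents `d`, for which the bias of the
    -- quantizer is known exactly.
    have hgd : ∀ d, g (x + d) ≤ Real.exp (θ * x) * (1 - θ + θ * Real.exp d) +
        Real.exp ((1 - θ) * x) * (1 - θ + θ * Real.exp (-d)) := by
      intro d
      have e1 : Real.exp (θ * (x + d)) = Real.exp (θ * x) * Real.exp (θ * d) := by
        rw [← Real.exp_add]; congr 1; ring
      have e2 : Real.exp (x - θ * (x + d)) = Real.exp ((1 - θ) * x) * Real.exp (θ * (-d)) := by
        rw [← Real.exp_add]; congr 1; ring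
      simp only [hg, e1, e2]
      exact add_le_add
        (mul_le_mul_of_nonneg_left (exp_mul_le_interpolate hθ0 hθ1 d) (Real.exp_pos _).le)
        (mul_le_mul_of_nonneg_left (exp_mul_le_interpolate hθ0 hθ1 (-d)) (Real.exp_pos _).le)
    have e : ∀ u : unitInterval, ENNReal.ofReal (g (Δ + quantize φ r (x - Δ) u)) =
        if (u : ℝ) < q then ENNReal.ofReal (g (x + -t)) else ENNReal.ofReal (g (x + (ε - t))) := by
      intro u
      rw [quantize_eq hr]
      have c1 : Δ + ⌊(x - Δ) * r / φ⌋ * ε = x + -t := by rw [ht]; ring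
      have c2 : Δ + (⌊(x - Δ) * r / φ⌋ * ε + ε) = x + (ε - t) := by rw [ht]; ring
      by_cases hu : (u : ℝ) < q
      · rw [if_pos hu, if_pos hu, c1]
      · rw [if_neg hu, if_neg hu, c2]
    change ∫⁻ u : unitInterval, ENNReal.ofReal (g (Δ + quantize φ r (x - Δ) u)) ≤ _
    simp_rw [e]
    rw [lintegral_unitInterval_ite hq0 hq1, ← ENNReal.ofReal_mul hq0,
      ← ENNReal.ofReal_mul (by linarith : 0 ≤ 1 - q),
      ← ENNReal.ofReal_add (mul_nonneg hq0 (hg0 _)) (mul_nonneg (by linarith) (hg0 _))]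
    refine ENNReal.ofReal_le_ofReal ?_
    have k1 := mul_le_mul_of_nonneg_left (hgd (-t)) hq0
    have k2 := mul_le_mul_of_nonneg_left (hgd (ε - t)) (by linarith : 0 ≤ 1 - q)
    rw [neg_neg] at k1
    rw [neg_sub] at k2
    have k3 := roundDownProb_exp hε0 t
    have k4 := roundDownProb_exp_neg hε0 t
    rw [← hq] at k3 k4
    have k5 := exp_sub_one_mul_le ht0 ht1
    have k6 : 0 ≤ (Real.exp t - 1) * (1 - Real.exp (t - ε)) := by
      refine mul_nonneg ?_ ?_
      · linarith [Real.one_le_exp ht0]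
      · linarith [Real.exp_le_one_iff.2 (show t - ε ≤ 0 by linarith)]
    have k7 := quantization_slack hΔ hδ hε0.le hε hx
    rw [← hθ, show 2 * δ ^ 2 = 1 - θ by rw [hθ]; ring] at k7
    have e3 : Real.exp x = Real.exp (θ * x) * Real.exp ((1 - θ) * x) := by
      rw [← Real.exp_add]; congr 1; ring
    set U := Real.exp (θ * x)
    set W := Real.exp ((1 - θ) * x)
    have hW : 0 < W := Real.exp_pos _
    set κ := (Real.exp t - 1) * (1 - Real.exp (t - ε))
    have k8 : q * (U * (1 - θ + θ * Real.exp (-t)) + W * (1 - θ + θ * Real.exp t)) +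
        (1 - q) * (U * (1 - θ + θ * Real.exp (ε - t)) + W * (1 - θ + θ * Real.exp (t - ε))) =
        U + W * (1 + θ * κ) := by
      linear_combination U * θ * k3 + W * θ * k4
    have k9 : θ * κ ≤ κ := mul_le_of_le_one_left k6 hθ1
    have k10 : W * (1 + θ * κ) ≤ W * (1 + ε ^ 2 / 4 * Real.exp ε) :=
      mul_le_mul_of_nonneg_left (by linarith) hW.le
    rw [e3]
    linarith

end Quantizer

/-! ### Randomized signs and the exponential error bound -/

section ErrorBound

/-- Resampling one coordinate of a finite product measure from another law. -/
theorem lintegral_pi_resample {ι : Type*} {X : ι → Type*} [∀ i, MeasurableSpace (X i)] [Fintype ι]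
    [DecidableEq ι] (μ : (i : ι) → Measure (X i)) [∀ i, IsProbabilityMeasure (μ i)] (i : ι)
    (ν : Measure (X i)) [IsProbabilityMeasure ν] {h : ((j : ι) → X j) → ℝ≥0∞} (hh : Measurable h) :
    ∫⁻ ω, ∫⁻ e, h (Function.update ω i e) ∂ν ∂(Measure.pi μ) =
      ∫⁻ ω, h ω ∂(Measure.pi (Function.update μ i ν)) := by
  have hm := measurable_update_prod (X := X) i
  have hp : ∀ j, IsProbabilityMeasure (Function.update μ i ν j) := by
    intro j
    by_cases hj : j = i
    · subst hj; simpa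
    · rw [Function.update_of_ne hj]; infer_instance
  have key : ((Measure.pi μ).prod ν).map (fun p : ((j : ι) → X j) × X i =>
      Function.update p.1 i p.2) = Measure.pi (Function.update μ i ν) := by
    refine (Measure.pi_eq fun t ht => ?_).symm
    rw [Measure.map_apply hm (.univ_pi ht)]
    have : (fun p : ((j : ι) → X j) × X i => Function.update p.1 i p.2) ⁻¹' Set.univ.pi t
        = Set.univ.pi (Function.update t i Set.univ) ×ˢ t i := by
      ext ⟨x, y⟩
      simp only [Set.mem_preimage, Set.mem_pi, Set.mem_prod, Set.mem_univ, true_imp_iff]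
      constructor
      · intro h
        refine ⟨fun j => ?_, by simpa using h i⟩
        by_cases hj : j = i
        · subst hj; simp
        · simpa [hj] using h j
      · rintro ⟨h1, h2⟩ j
        by_cases hj : j = i
        · subst hj; simpa using h2
        · simpa [hj] using h1 j
    rw [this, Measure.prod_prod, Measure.pi_pi,
      ← Finset.mul_prod_erase _ _ (Finset.mem_univ i),
      ← Finset.mul_prod_erase (a := i) _ (fun j => Function.update μ i ν j (t j))
        (Finset.mem_univ i)]
    simp only [Function.update_self, measure_univ, one_mul]
    rw [mul_comm]
    congr 1
    refine Finset.prod_congr rfl fun j hj => ?_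
    rw [Function.update_of_ne (Finset.ne_of_mem_erase hj),
      Function.update_of_ne (Finset.ne_of_mem_erase hj)]
  rw [← key, lintegral_map hh hm,
    lintegral_prod (fun p : ((j : ι) → X j) × X i => h (Function.update p.1 i p.2))
      (hh.comp hm).aemeasurable]

/-- The law of a symmetric log-likelihood ratio whose absolute value is that of `s`, under `H_1`. -/
def signMix (s : ℝ) : Measure ℝ :=
  ENNReal.ofReal (1 / (1 + Real.exp (-s))) • Measure.dirac s +
    ENNReal.ofReal (1 / (1 + Real.exp s)) • Measure.dirac (-s)

theorem signMix_weights (s : ℝ) : 1 / (1 + Real.exp (-s)) + 1 / (1 + Real.exp s) = 1 := by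
  have h : Real.exp s * Real.exp (-s) = 1 := by rw [← Real.exp_add]; simp
  have := Real.exp_pos s
  have := Real.exp_pos (-s)
  field_simp
  linear_combination -h

theorem ofReal_signMix_weights (s : ℝ) :
    ENNReal.ofReal (1 / (1 + Real.exp (-s))) + ENNReal.ofReal (1 / (1 + Real.exp s)) = 1 := by
  rw [← ENNReal.ofReal_add (by positivity) (by positivity), signMix_weights, ENNReal.ofReal_one]

theorem lintegral_signMix (s : ℝ) {g : ℝ → ℝ≥0∞} (hg : Measurable g) :
    ∫⁻ z, g z ∂(signMix s) = ENNReal.ofReal (1 / (1 + Real.exp (-s))) * g s +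
      ENNReal.ofReal (1 / (1 + Real.exp s)) * g (-s) := by
  rw [signMix, lintegral_add_measure, lintegral_smul_measure, lintegral_smul_measure,
    lintegral_dirac' _ hg, lintegral_dirac' _ hg, smul_eq_mul, smul_eq_mul]

instance (s : ℝ) : IsProbabilityMeasure (signMix s) :=
  ⟨by
    have := lintegral_signMix s (g := fun _ => 1) measurable_const
    rw [lintegral_one, mul_one, mul_one, ofReal_signMix_weights] at this
    exact this⟩

theorem signMix_zero : signMix 0 = Measure.dirac 0 := by
  rw [signMix, neg_zero, ← add_smul]
  have := ofReal_signMix_weights 0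
  rw [neg_zero] at this
  rw [this, one_smul]

theorem signMix_neg (s : ℝ) : signMix (-s) = signMix s := by
  rw [signMix, signMix, neg_neg, add_comm]

/-- The law `m` of a log-likelihood ratio under `H_1` is symmetric: its law under `H_0`, which has
density `exp (-x)` with respect to `m`, is the law of the negative. -/
structure SymmLLR (m : Measure ℝ) : Prop where
  prob : IsProbabilityMeasure m
  symm : m.map (fun x => -x) = m.withDensity fun x => ENNReal.ofReal (Real.exp (-x))

theorem SymmLLR.lintegral_neg {m : Measure ℝ} (hm : SymmLLR m) {g : ℝ → ℝ≥0∞} (hg : Measurable g) :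
    ∫⁻ x, g (-x) ∂m = ∫⁻ x, ENNReal.ofReal (Real.exp (-x)) * g x ∂m := by
  rw [← lintegral_map hg measurable_neg, hm.symm, lintegral_withDensity_eq_lintegral_mul _
    (by fun_prop) hg]
  rfl

theorem SymmLLR.lintegral_exp_neg {m : Measure ℝ} (hm : SymmLLR m) :
    ∫⁻ x, ENNReal.ofReal (Real.exp (-x)) ∂m = 1 := by
  have := hm.prob
  have h := hm.lintegral_neg (g := fun _ => 1) measurable_const
  simp only [mul_one, lintegral_one, measure_univ] at h
  exact h.symm

/-- `1 + exp (-s)` is harmonic for the walk because `exp (-x)` has mean one. The weight is the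
density of the corresponding Doob transform, the law of the increments when the sign of the
accumulated value is hidden. -/
theorem SymmLLR.lintegral_weight {m : Measure ℝ} (hm : SymmLLR m) (s : ℝ) :
    ∫⁻ x, ENNReal.ofReal ((1 + Real.exp (-(s + x))) / (1 + Real.exp (-s))) ∂m = 1 := by
  have := hm.prob
  have e : ∀ x : ℝ, ENNReal.ofReal ((1 + Real.exp (-(s + x))) / (1 + Real.exp (-s))) =
      ENNReal.ofReal (1 / (1 + Real.exp (-s))) +
        ENNReal.ofReal (1 / (1 + Real.exp s)) * ENNReal.ofReal (Real.exp (-x)) := by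
    intro x
    rw [← ENNReal.ofReal_mul (by positivity), ← ENNReal.ofReal_add (by positivity) (by positivity)]
    congr 1
    rw [neg_add, Real.exp_add]
    have h : Real.exp s * Real.exp (-s) = 1 := by rw [← Real.exp_add]; simp
    have := Real.exp_pos s
    have := Real.exp_pos (-s)
    field_simp
    linear_combination (Real.exp (-x)) * h
  simp_rw [e]
  rw [lintegral_add_left measurable_const, lintegral_const_mul _ (by fun_prop),
    hm.lintegral_exp_neg, lintegral_const, measure_univ, mul_one, mul_one, ofReal_signMix_weights]

/-- Randomizing the sign of a log-likelihood ratio before adding an increment amounts to randomizing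
it afterwards. -/
theorem SymmLLR.lintegral_signMix_add {m : Measure ℝ} (hm : SymmLLR m) (s : ℝ) {g : ℝ → ℝ≥0∞}
    (hg : Measurable g) :
    ∫⁻ e, ∫⁻ x, g (e + x) ∂m ∂(signMix s) =
      ∫⁻ x, ENNReal.ofReal ((1 + Real.exp (-(s + x))) / (1 + Real.exp (-s))) *
        ∫⁻ z, g z ∂(signMix (s + x)) ∂m := by
  have := hm.prob
  have hg1 : Measurable fun x => g (s + x) := by fun_prop
  have hg2 : Measurable fun x => g (-(s + x)) := by fun_prop
  have hgg : Measurable fun e => ∫⁻ x, g (e + x) ∂m :=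
    Measurable.lintegral_prod_right' (f := fun z : ℝ × ℝ => g (z.1 + z.2)) (by fun_prop)
  rw [lintegral_signMix s hgg]
  -- The increment added to the negative atom is reflected, at the price `exp (-x)`; then both atoms
  -- move to `±(s + x)`.
  have e1 : ∫⁻ x, g (-s + x) ∂m = ∫⁻ x, ENNReal.ofReal (Real.exp (-x)) * g (-(s + x)) ∂m := by
    have := hm.lintegral_neg hg2
    simpa [neg_add, add_comm] using this
  rw [e1, ← lintegral_const_mul _ hg1, ← lintegral_const_mul _ (by fun_prop),
    ← lintegral_add_left (by fun_prop)]
  refine lintegral_congr fun x => ?_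
  rw [lintegral_signMix _ hg, mul_add, ← mul_assoc, ← mul_assoc, ← mul_assoc,
    ← ENNReal.ofReal_mul (by positivity), ← ENNReal.ofReal_mul (by positivity),
    ← ENNReal.ofReal_mul (by positivity)]
  have h1 : Real.exp s * Real.exp (-s) = 1 := by rw [← Real.exp_add]; simp
  have h2 : Real.exp x * Real.exp (-x) = 1 := by rw [← Real.exp_add]; simp
  have := Real.exp_pos s
  have := Real.exp_pos x
  have := Real.exp_pos (-s)
  have := Real.exp_pos (-x)
  congr 3
  · field_simp
  · rw [neg_add, Real.exp_add, Real.exp_add]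
    rw [div_mul_eq_mul_div, div_mul_div_comm, div_eq_div_iff (by positivity) (by positivity)]
    linear_combination (1 - Real.exp (-x)) * h1 +
      (Real.exp s + Real.exp s * Real.exp (-s)) * h2

end ErrorBound

section ErrorBound

variable {K : ℕ} (p : RLTParams)

/-- The bound for the probability of a downward exit from a statistic `F` under `H_1`. -/
def RLTParams.downBound (θ F : ℝ) : ℝ≥0∞ := ENNReal.ofReal (Real.exp (-(θ * (F + p.B))))

/-- The state of SU `k` and of the fusion center after the local log-likelihood ratio increment has
become `z`. -/
def RLTParams.arrive (k : Fin K) (z : ℝ) (u : unitInterval) (st : NetState K) : NetState K :=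
  if p.Δ ≤ |z| then (Function.update st.1 k 0, freeze p.A p.B st.2 (p.increment z u))
  else (Function.update st.1 k z, st.2)

theorem RLTParams.micro_eq_arrive (k : Fin K) (y : ℝ × unitInterval) (st : NetState K) :
    p.micro k y st = p.arrive k (st.1 k + y.1) y.2 st := rfl

theorem RLTParams.arrive_update (k : Fin K) (z : ℝ) (u : unitInterval) (R : Fin K → ℝ) (F e : ℝ) :
    p.arrive k z u (Function.update R k e, F) = p.arrive k z u (R, F) := by
  simp [arrive]

theorem RLTParams.measurable_arrive (k : Fin K) :
    Measurable fun z : (ℝ × unitInterval) × NetState K => p.arrive k z.1.1 z.1.2 z.2 := by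
  have e : ∀ z : (ℝ × unitInterval) × NetState K, p.arrive k z.1.1 z.1.2 z.2 =
      p.micro k z.1 (Function.update z.2.1 k 0, z.2.2) := by
    intro z
    rw [micro_eq_arrive, arrive_update]
    simp
  simp_rw [e]
  refine (p.measurable_micro k).comp (measurable_fst.prodMk ?_)
  exact ((measurable_update_prod (X := fun _ : Fin K => ℝ) k).comp
    ((measurable_fst.comp measurable_snd).prodMk measurable_const)).prodMk
    (measurable_snd.comp measurable_snd)

theorem RLTParams.increment_neg (z u : ℝ) : p.increment (-z) u = -p.increment z u := by
  rw [increment, increment, Real.sign_neg, abs_neg, neg_mul]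

/-- Functions of the state whose expectations, after randomizing the signs of the local
log-likelihood ratios, are bounded by `downBound`. -/
structure RLTParams.DownBounded (θ : ℝ) (v : NetState K → ℝ≥0∞) : Prop where
  meas : Measurable v
  le : ∀ (R : Fin K → ℝ) (F : ℝ), ∫⁻ y, v (y, F) ∂(Measure.pi fun k => signMix (R k)) ≤ p.downBound θ F

theorem update_signMix (R : Fin K → ℝ) (k : Fin K) (z : ℝ) :
    Function.update (fun j => signMix (R j)) k (signMix z) =
      fun j => signMix (Function.update R k z j) := by
  ext1 j
  by_cases hj : j = k
  · subst hj; simp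
  · simp [hj]

variable {p}

theorem RLTParams.DownBounded.le_update {θ : ℝ} {v : NetState K → ℝ≥0∞} (hv : p.DownBounded θ v)
    (R : Fin K → ℝ) (F : ℝ) (k : Fin K) (z : ℝ) :
    ∫⁻ y, ∫⁻ e, v (Function.update y k e, F) ∂(signMix z) ∂(Measure.pi fun j => signMix (R j)) ≤
      p.downBound θ F := by
  have hm : Measurable fun y : Fin K → ℝ => v (y, F) :=
    hv.meas.comp (measurable_id.prodMk measurable_const)
  rw [lintegral_pi_resample (fun j => signMix (R j)) k (signMix z) hm, update_signMix]
  exact hv.le _ _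

theorem RLTParams.DownBounded.le_update_zero {θ : ℝ} {v : NetState K → ℝ≥0∞}
    (hv : p.DownBounded θ v) (R : Fin K → ℝ) (F : ℝ) (k : Fin K) :
    ∫⁻ y, v (Function.update y k 0, F) ∂(Measure.pi fun j => signMix (R j)) ≤
      p.downBound θ F := by
  refine le_trans (le_of_eq ?_) (hv.le_update R F k 0)
  refine lintegral_congr fun y => ?_
  have hm : Measurable fun e : ℝ => v (Function.update y k e, F) :=
    hv.meas.comp ((measurable_update y).prodMk measurable_const)
  rw [signMix_zero, lintegral_dirac' _ hm]

/-- A message of hidden sign does not increase the exponential on average: after multiplication by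
`1 + exp z` this is the inequality for the quantizer. -/
theorem RLTParams.downBound_increment {δ : ℝ} (hφ : 0 < p.φ) (hΔ : 0 < p.Δ) (hδ : δ ≤ 1 / 4)
    (hδ0 : 0 ≤ δ) (hε : p.φ / max (p.r : ℝ) 1 ≤ δ * p.Δ) {z : ℝ} (hz : p.Δ ≤ z) (F : ℝ) :
    ENNReal.ofReal (1 / (1 + Real.exp (-z))) *
        (∫⁻ u : unitInterval, p.downBound (1 - 2 * δ ^ 2) (F + p.increment z u)) +
      ENNReal.ofReal (1 / (1 + Real.exp z)) *
        (∫⁻ u : unitInterval, p.downBound (1 - 2 * δ ^ 2) (F - p.increment z u)) ≤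
      p.downBound (1 - 2 * δ ^ 2) F := by
  have hz0 : 0 < z := hΔ.trans_le hz
  set θ := 1 - 2 * δ ^ 2
  have hq : Measurable fun u : unitInterval => p.increment z u :=
    p.measurable_increment.comp (measurable_const.prodMk measurable_subtype_coe)
  have hinc : ∀ u : unitInterval, p.increment z u = p.Δ + quantize p.φ p.r (z - p.Δ) u := by
    intro u
    rw [increment, Real.sign_of_pos hz0, abs_of_pos hz0, one_mul]
  have h1 : Measurable fun u : unitInterval => p.downBound θ (F + p.increment z u) := by
    unfold downBound; fun_prop
  have h2 : Measurable fun u : unitInterval => p.downBound θ (F - p.increment z u) := by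
    unfold downBound; fun_prop
  rw [← lintegral_const_mul _ h1, ← lintegral_const_mul _ h2,
    ← lintegral_add_left (h1.const_mul _)]
  have e : ∀ u : unitInterval, ENNReal.ofReal (1 / (1 + Real.exp (-z))) *
        p.downBound θ (F + p.increment z u) + ENNReal.ofReal (1 / (1 + Real.exp z)) *
        p.downBound θ (F - p.increment z u) =
      (p.downBound θ F * ENNReal.ofReal (1 / (1 + Real.exp z))) *
      ENNReal.ofReal (Real.exp (θ * (p.Δ + quantize p.φ p.r (z - p.Δ) u)) +
        Real.exp (z - θ * (p.Δ + quantize p.φ p.r (z - p.Δ) u))) := by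
    intro u
    rw [hinc]
    set a := p.Δ + quantize p.φ p.r (z - p.Δ) u
    unfold downBound
    rw [← ENNReal.ofReal_mul (by positivity), ← ENNReal.ofReal_mul (by positivity),
      ← ENNReal.ofReal_add (by positivity) (by positivity), ← ENNReal.ofReal_mul (by positivity),
      ← ENNReal.ofReal_mul (by positivity)]
    congr 1
    have e1 : Real.exp (-(θ * (F + a + p.B))) =
        Real.exp (-(θ * (F + p.B))) * Real.exp (-(θ * a)) := by
      rw [← Real.exp_add]; congr 1; ring
    have e2 : Real.exp (-(θ * (F - a + p.B))) =
        Real.exp (-(θ * (F + p.B))) * Real.exp (θ * a) := by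
      rw [← Real.exp_add]; congr 1; ring
    have e3 : Real.exp (z - θ * a) = Real.exp z * Real.exp (-(θ * a)) := by
      rw [← Real.exp_add]; congr 1
    have e4 : 1 / (1 + Real.exp (-z)) = Real.exp z * (1 / (1 + Real.exp z)) := by
      have h : Real.exp z * Real.exp (-z) = 1 := by rw [← Real.exp_add]; simp
      have := Real.exp_pos z
      have := Real.exp_pos (-z)
      field_simp
      linear_combination -h
    rw [e1, e2, e3, e4]
    ring
  have hmq : Measurable fun u : unitInterval =>
      ENNReal.ofReal (Real.exp (θ * (p.Δ + quantize p.φ p.r (z - p.Δ) u)) +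
        Real.exp (z - θ * (p.Δ + quantize p.φ p.r (z - p.Δ) u))) := by
    simp_rw [← hinc]; fun_prop
  simp_rw [e]
  rw [lintegral_const_mul _ hmq]
  calc _ ≤ p.downBound θ F * ENNReal.ofReal (1 / (1 + Real.exp z)) *
        ENNReal.ofReal (1 + Real.exp z) :=
        mul_le_mul_right (lintegral_quantize_le hφ hΔ hδ hδ0 hε hz) _
    _ = p.downBound θ F := by
      rw [mul_assoc, ← ENNReal.ofReal_mul (by positivity), one_div_mul_cancel (by positivity),
        ENNReal.ofReal_one, mul_one]

/-- Whether the SU samples depends on `|z|` only. If it does not, the new local value again has law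
`signMix z`. If it does, the local value is reset to `0`, which is `signMix 0`, and the random sign
goes into the statistic. -/
theorem RLTParams.DownBounded.arrive_le {δ : ℝ} (hφ : 0 < p.φ) (hΔ : 0 < p.Δ) (hδ : δ ≤ 1 / 4)
    (hδ0 : 0 ≤ δ) (hε : p.φ / max (p.r : ℝ) 1 ≤ δ * p.Δ) {v : NetState K → ℝ≥0∞}
    (hv : p.DownBounded (1 - 2 * δ ^ 2) v) (R : Fin K → ℝ) (F : ℝ) (k : Fin K) (z : ℝ) :
    ∫⁻ y, ∫⁻ e, ∫⁻ u, v (p.arrive k e u (y, F)) ∂volume ∂(signMix z)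
        ∂(Measure.pi fun j => signMix (R j)) ≤ p.downBound (1 - 2 * δ ^ 2) F := by
  wlog hz : 0 ≤ z generalizing z with H
  · rw [← signMix_neg]
    exact H (-z) (by linarith)
  have hmv : Measurable fun w : (ℝ × (Fin K → ℝ)) × unitInterval =>
      v (p.arrive k w.1.1 w.2 (w.1.2, F)) :=
    hv.meas.comp ((p.measurable_arrive k).comp
      (((measurable_fst.comp measurable_fst).prodMk measurable_snd).prodMk
        ((measurable_snd.comp measurable_fst).prodMk measurable_const)))
  have hmu : Measurable fun w : ℝ × (Fin K → ℝ) =>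
      ∫⁻ u : unitInterval, v (p.arrive k w.1 u (w.2, F)) :=
    hmv.lintegral_prod_right'
  have hmu1 : ∀ y : Fin K → ℝ,
      Measurable fun e : ℝ => ∫⁻ u : unitInterval, v (p.arrive k e u (y, F)) :=
    fun y => hmu.comp (measurable_id.prodMk measurable_const)
  by_cases hlt : z < p.Δ
  · refine le_trans (le_of_eq ?_) (hv.le_update R F k z)
    refine lintegral_congr fun y => ?_
    have hm : Measurable fun e : ℝ => v (Function.update y k e, F) :=
      hv.meas.comp ((measurable_update y).prodMk measurable_const)
    have e1 : ∀ e : ℝ, |e| = z → ∫⁻ u : unitInterval, v (p.arrive k e u (y, F)) =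
        v (Function.update y k e, F) := by
      intro e he
      have : ¬ p.Δ ≤ |e| := by rw [he]; exact not_le.2 hlt
      simp [arrive, this]
    rw [lintegral_signMix z (hmu1 y), lintegral_signMix z hm, e1 z (abs_of_nonneg hz),
      e1 (-z) (by rw [abs_neg, abs_of_nonneg hz])]
  · rw [not_lt] at hlt
    have hbd : ∀ e : ℝ, |e| = z →
        ∫⁻ y, ∫⁻ u : unitInterval, v (p.arrive k e u (y, F)) ∂volume
          ∂(Measure.pi fun j => signMix (R j)) ≤
        ∫⁻ u : unitInterval, p.downBound (1 - 2 * δ ^ 2) (freeze p.A p.B F (p.increment e u)) := by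
      intro e he
      rw [lintegral_lintegral_swap]
      · refine lintegral_mono fun u => ?_
        have : p.Δ ≤ |e| := by rw [he]; exact hlt
        simp only [arrive, this, if_true]
        exact hv.le_update_zero R _ k
      · refine Measurable.aemeasurable ?_
        exact hmv.comp (f := fun w : (Fin K → ℝ) × unitInterval => ((e, w.1), w.2))
          (by fun_prop)
    have e1 : ∀ y : Fin K → ℝ, ∫⁻ e, ∫⁻ u : unitInterval, v (p.arrive k e u (y, F)) ∂volume
        ∂(signMix z) = _ := fun y => lintegral_signMix z (hmu1 y)
    simp_rw [e1]
    have hmy : ∀ e : ℝ,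
        Measurable fun y : Fin K → ℝ => ∫⁻ u : unitInterval, v (p.arrive k e u (y, F)) :=
      fun e => hmu.comp (measurable_const.prodMk measurable_id)
    rw [lintegral_add_left ((hmy z).const_mul _), lintegral_const_mul _ (hmy z),
      lintegral_const_mul _ (hmy (-z))]
    refine (add_le_add (mul_le_mul_right (hbd z (abs_of_nonneg hz)) _)
      (mul_le_mul_right (hbd (-z) (by rw [abs_neg, abs_of_nonneg hz])) _)).trans ?_
    by_cases hF : F ∈ Set.Ioo (-p.B) p.A
    · simp only [freeze, hF, if_true, increment_neg, ← sub_eq_add_neg]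
      exact downBound_increment hφ hΔ hδ hδ0 hε hlt F
    · simp only [freeze, hF, if_false, lintegral_const, measure_univ, mul_one]
      rw [← add_mul, ofReal_signMix_weights, one_mul]

/-- The sign of the local value is drawn after the observation instead of before. For each
observation the bound then holds conditionally, and the weights have total mass one. -/
theorem RLTParams.DownBounded.micro {δ : ℝ} (hφ : 0 < p.φ) (hΔ : 0 < p.Δ) (hδ : δ ≤ 1 / 4)
    (hδ0 : 0 ≤ δ) (hε : p.φ / max (p.r : ℝ) 1 ≤ δ * p.Δ) {m : Measure ℝ} (hm : SymmLLR m)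
    {v : NetState K → ℝ≥0∞} (hv : p.DownBounded (1 - 2 * δ ^ 2) v) (k : Fin K) :
    p.DownBounded (1 - 2 * δ ^ 2) fun st =>
      ∫⁻ y, v (p.micro k y st) ∂(m.prod (volume : Measure unitInterval)) := by
  have hmp := hm.prob
  have hmm : Measurable fun w : NetState K × (ℝ × unitInterval) => v (p.micro k w.2 w.1) :=
    hv.meas.comp ((p.measurable_micro k).comp measurable_swap)
  have hmeas : Measurable fun st : NetState K =>
      ∫⁻ y, v (p.micro k y st) ∂(m.prod (volume : Measure unitInterval)) :=
    hmm.lintegral_prod_right'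
  refine ⟨hmeas, fun R F => ?_⟩
  have hmv : Measurable fun w : ((Fin K → ℝ) × ℝ) × unitInterval =>
      v (p.arrive k w.1.2 w.2 (w.1.1, F)) :=
    hv.meas.comp ((p.measurable_arrive k).comp
      (((measurable_snd.comp measurable_fst).prodMk measurable_snd).prodMk
        ((measurable_fst.comp measurable_fst).prodMk measurable_const)))
  set g : (Fin K → ℝ) → ℝ → ℝ≥0∞ := fun y z => ∫⁻ u : unitInterval, v (p.arrive k z u (y, F))
  have hg : Measurable fun w : (Fin K → ℝ) × ℝ => g w.1 w.2 := hmv.lintegral_prod_right'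
  have hgy : ∀ y, Measurable (g y) := fun y => hg.comp (measurable_const.prodMk measurable_id)
  have e1 : ∀ y e, ∫⁻ w, v (p.micro k w (Function.update y k e, F))
      ∂(m.prod (volume : Measure unitInterval)) = ∫⁻ x, g y (e + x) ∂m := by
    intro y e
    rw [lintegral_prod]
    · simp only [micro_eq_arrive, arrive_update, Function.update_self, g]
    · exact (hmm.comp (measurable_const.prodMk measurable_id)).aemeasurable
  have hmF : Measurable fun y : Fin K → ℝ =>
      ∫⁻ w, v (p.micro k w (y, F)) ∂(m.prod (volume : Measure unitInterval)) :=
    hmeas.comp (measurable_id.prodMk measurable_const)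
  rw [lintegral_pi_update _ k hmF]
  simp_rw [e1]
  have e2 : ∀ y, ∫⁻ e, ∫⁻ x, g y (e + x) ∂m ∂(signMix (R k)) = _ :=
    fun y => hm.lintegral_signMix_add (R k) (hgy y)
  simp_rw [e2]
  have hw : Measurable fun w : (Fin K → ℝ) × ℝ => ∫⁻ z, g w.1 z ∂(signMix (R k + w.2)) := by
    have : ∀ w : (Fin K → ℝ) × ℝ, ∫⁻ z, g w.1 z ∂(signMix (R k + w.2)) = _ :=
      fun w => lintegral_signMix _ (hgy w.1)
    simp_rw [this]
    have h1 : Measurable fun w : (Fin K → ℝ) × ℝ => g w.1 (R k + w.2) :=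
      hg.comp (measurable_fst.prodMk (by fun_prop))
    have h2 : Measurable fun w : (Fin K → ℝ) × ℝ => g w.1 (-(R k + w.2)) :=
      hg.comp (measurable_fst.prodMk (by fun_prop))
    fun_prop
  rw [lintegral_lintegral_swap]
  · calc _ ≤ ∫⁻ x, ENNReal.ofReal ((1 + Real.exp (-(R k + x))) / (1 + Real.exp (-R k))) *
          p.downBound (1 - 2 * δ ^ 2) F ∂m := by
          refine lintegral_mono fun x => ?_
          have hwx : Measurable fun y : Fin K → ℝ => ∫⁻ z, g y z ∂(signMix (R k + x)) :=
            hw.comp (g := fun w : (Fin K → ℝ) × ℝ => ∫⁻ z, g w.1 z ∂(signMix (R k + w.2)))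
              (f := fun y : Fin K → ℝ => (y, x)) measurable_prodMk_right
          rw [lintegral_const_mul _ hwx]
          exact mul_le_mul_right (hv.arrive_le hφ hΔ hδ hδ0 hε R F k (R k + x)) _
      _ = _ := by
        rw [lintegral_mul_const _ (by fun_prop), hm.lintegral_weight, one_mul]
  · exact Measurable.aemeasurable (by fun_prop)

end ErrorBound

/-! ### Propagation of the error bound along the path -/

section ErrorBound

variable {K : ℕ} {p : RLTParams}

/-- The law of what is drawn in one time unit. -/
def stepLaw (m : Fin K → Measure ℝ) (ρ : Measure (Equiv.Perm (Fin K))) : Measure (LStep K) :=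
  (Measure.pi fun k => (m k).prod (volume : Measure unitInterval)).prod ρ

instance (m : Fin K → Measure ℝ) [∀ k, IsProbabilityMeasure (m k)]
    (ρ : Measure (Equiv.Perm (Fin K))) [IsProbabilityMeasure ρ] :
    IsProbabilityMeasure (stepLaw m ρ) := by
  unfold stepLaw; infer_instance

theorem RLTParams.microList_update (e : Fin K → ℝ × unitInterval) {k : Fin K}
    (y : ℝ × unitInterval) {l : List (Fin K)} (hk : k ∉ l) (st : NetState K) :
    p.microList (Function.update e k y) l st = p.microList e l st := by
  induction l generalizing st with
  | nil => rfl
  | cons j l ih =>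
    simp only [List.mem_cons, not_or] at hk
    rw [microList_cons, microList_cons, Function.update_of_ne (Ne.symm hk.1), ih hk.2]

/-- Each SU occurs at most once, so its observation can be averaged separately from those processed
later. -/
theorem RLTParams.DownBounded.microList {δ : ℝ} (hφ : 0 < p.φ) (hΔ : 0 < p.Δ) (hδ : δ ≤ 1 / 4)
    (hδ0 : 0 ≤ δ) (hε : p.φ / max (p.r : ℝ) 1 ≤ δ * p.Δ) {m : Fin K → Measure ℝ}
    (hm : ∀ k, SymmLLR (m k)) {v : NetState K → ℝ≥0∞} (hv : p.DownBounded (1 - 2 * δ ^ 2) v)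
    {l : List (Fin K)} (hl : l.Nodup) :
    p.DownBounded (1 - 2 * δ ^ 2) fun st => ∫⁻ e, v (p.microList e l st)
      ∂(Measure.pi fun k => (m k).prod (volume : Measure unitInterval)) := by
  have hmp := fun k => (hm k).prob
  induction l with
  | nil => simpa [RLTParams.microList_nil] using hv
  | cons k l ih =>
    obtain ⟨hk, hl⟩ := List.nodup_cons.1 hl
    convert (ih hl).micro hφ hΔ hδ hδ0 hε (hm k) k using 1
    funext st
    have hM : Measurable fun e : Fin K → ℝ × unitInterval => v (p.microList e (k :: l) st) :=
      hv.meas.comp ((p.measurable_microList (k :: l)).comp measurable_prodMk_right)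
    rw [lintegral_pi_update _ k hM]
    simp only [microList_cons, Function.update_self, microList_update _ _ hk]
    rw [lintegral_lintegral_swap]
    have h1 : Measurable fun z : (Fin K → ℝ × unitInterval) × (ℝ × unitInterval) =>
        (z.1, p.micro k z.2 st) :=
      measurable_fst.prodMk ((p.measurable_micro k).comp (measurable_snd.prodMk measurable_const))
    exact (hv.meas.comp ((p.measurable_microList l).comp h1)).aemeasurable

theorem RLTParams.DownBounded.step {δ : ℝ} (hφ : 0 < p.φ) (hΔ : 0 < p.Δ) (hδ : δ ≤ 1 / 4)
    (hδ0 : 0 ≤ δ) (hε : p.φ / max (p.r : ℝ) 1 ≤ δ * p.Δ) {m : Fin K → Measure ℝ}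
    (hm : ∀ k, SymmLLR (m k)) (ρ : Measure (Equiv.Perm (Fin K))) [IsProbabilityMeasure ρ]
    {v : NetState K → ℝ≥0∞} (hv : p.DownBounded (1 - 2 * δ ^ 2) v) :
    p.DownBounded (1 - 2 * δ ^ 2) fun st => ∫⁻ e, v (p.step e st) ∂(stepLaw m ρ) := by
  have hmp := fun k => (hm k).prob
  have hM : Measurable fun z : NetState K × LStep K => v (p.step z.2 z.1) :=
    hv.meas.comp (p.measurable_step.comp measurable_swap)
  refine ⟨hM.lintegral_prod_right', fun R F => ?_⟩
  set w : Equiv.Perm (Fin K) → NetState K → ℝ≥0∞ := fun σ st =>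
    ∫⁻ e, v (p.microList e ((List.finRange K).map σ) st)
      ∂(Measure.pi fun k => (m k).prod (volume : Measure unitInterval))
  have hw : ∀ σ, p.DownBounded (1 - 2 * δ ^ 2) (w σ) := fun σ =>
    hv.microList hφ hΔ hδ hδ0 hε hm (nodup_map_finRange σ)
  have e1 : ∀ st, ∫⁻ e, v (p.step e st) ∂(stepLaw m ρ) = ∫⁻ σ, w σ st ∂ρ := by
    intro st
    rw [stepLaw, lintegral_prod_symm]
    · rfl
    · exact (hM.comp (measurable_const.prodMk measurable_id)).aemeasurable
  simp_rw [e1]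
  rw [lintegral_lintegral_swap]
  · calc _ ≤ ∫⁻ _, p.downBound (1 - 2 * δ ^ 2) F ∂ρ := lintegral_mono fun σ => (hw σ).le R F
      _ = _ := by rw [lintegral_const, measure_univ, mul_one]
  · have : Measurable fun z : (Fin K → ℝ) × Equiv.Perm (Fin K) => w z.2 (z.1, F) :=
      measurable_from_prod_countable_left fun σ => (hw σ).meas.comp measurable_prodMk_right
    exact this.aemeasurable

/-- Backward induction: the transition operator preserves the class of functions, and at time `0`
the local values are `0`, where randomizing the sign does nothing. -/
theorem RLTParams.DownBounded.lintegral_state_le {δ : ℝ} (hφ : 0 < p.φ) (hΔ : 0 < p.Δ)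
    (hδ : δ ≤ 1 / 4) (hδ0 : 0 ≤ δ) (hε : p.φ / max (p.r : ℝ) 1 ≤ δ * p.Δ) {m : Fin K → Measure ℝ}
    (hm : ∀ k, SymmLLR (m k)) (ρ : Measure (Equiv.Perm (Fin K))) [IsProbabilityMeasure ρ]
    {v : NetState K → ℝ≥0∞} (hv : p.DownBounded (1 - 2 * δ ^ 2) v) (n : ℕ) :
    ∫⁻ ω, v (p.state n ω) ∂(Measure.infinitePi fun _ : ℕ => stepLaw m ρ) ≤
      p.downBound (1 - 2 * δ ^ 2) 0 := by
  have hmp := fun k => (hm k).prob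
  induction n generalizing v with
  | zero =>
    refine le_trans (le_of_eq ?_) (hv.le 0 0)
    have h0 : (fun k : Fin K => signMix ((0 : Fin K → ℝ) k)) = fun _ => Measure.dirac 0 := by
      funext k; exact signMix_zero
    have h1 : Measurable fun y : Fin K → ℝ => v (y, 0) :=
      hv.meas.comp measurable_prodMk_right
    have h2 : Measure.pi (fun _ : Fin K => Measure.dirac (0 : ℝ)) = Measure.dirac fun _ => 0 := by
      rw [← Measure.infinitePi_eq_pi, Measure.infinitePi_dirac]
    rw [h0, h2, lintegral_dirac' _ h1]
    simp only [RLTParams.state, lintegral_const, measure_univ, mul_one]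
    rfl
  | succ n ih =>
    have h1 : Measurable fun ω : ℕ → LStep K => v (p.state (n + 1) ω) :=
      hv.meas.comp (p.measurable_state _)
    rw [lintegral_infinitePi_update _ n h1]
    simp only [state_succ, Function.update_self, state_update]
    exact ih (hv.step hφ hΔ hδ hδ0 hε hm ρ)

theorem RLTParams.downBounded_indicator {θ : ℝ} (hθ : 0 ≤ θ) :
    p.DownBounded θ (Set.indicator {st : NetState K | st.2 ≤ -p.B} 1) where
  meas := measurable_one.indicator (measurableSet_le measurable_snd measurable_const)
  le R F := by
    by_cases h : F ≤ -p.B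
    · have : 1 ≤ p.downBound θ F := by
        rw [downBound, ← ENNReal.ofReal_one]
        refine ENNReal.ofReal_le_ofReal (Real.one_le_exp ?_)
        nlinarith
      simpa [Set.indicator, h] using this
    · simp [Set.indicator, h]

/-- An exponential bound for the error probability of the RLT-SPRT. -/
theorem RLTParams.measure_down_le {δ : ℝ} (hφ : 0 < p.φ) (hΔ : 0 < p.Δ) (hA : 0 < p.A)
    (hB : 0 < p.B) (hδ : δ ≤ 1 / 4) (hδ0 : 0 ≤ δ) (hε : p.φ / max (p.r : ℝ) 1 ≤ δ * p.Δ)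
    {m : Fin K → Measure ℝ} (hm : ∀ k, SymmLLR (m k)) (ρ : Measure (Equiv.Perm (Fin K)))
    [IsProbabilityMeasure ρ] :
    (Measure.infinitePi fun _ : ℕ => stepLaw m ρ) {ω | ∃ t, p.stat t ω ≤ -p.B} ≤
      ENNReal.ofReal (Real.exp (-((1 - 2 * δ ^ 2) * p.B))) := by
  have hmp := fun k => (hm k).prob
  have hT := p.isTest_stat (K := K) hA hB
  refine le_of_tendsto' (hT.tendsto_measure_down _) fun n => ?_
  have hθ : 0 ≤ 1 - 2 * δ ^ 2 := by nlinarith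
  have h := (downBounded_indicator (K := K) (p := p) hθ).lintegral_state_le hφ hΔ hδ hδ0 hε hm ρ n
  rw [downBound, zero_add] at h
  refine le_trans (le_of_eq ?_) h
  rw [← lintegral_indicator_one (hT.measurableSet_down n)]
  rfl

end ErrorBound

/-! ### A potential that pays for the rounding, and the expected time -/

section ExpectedTime

theorem tanh_half_mul_sinh (x : ℝ) : Real.tanh (x / 2) * Real.sinh x = Real.cosh x - 1 := by
  have h1 := Real.sinh_two_mul (x / 2)
  have h2 := Real.cosh_two_mul (x / 2)
  have h3 := Real.cosh_sq (x / 2)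
  rw [mul_div_cancel₀ x two_ne_zero] at h1 h2
  have h4 := (Real.cosh_pos (x / 2)).ne'
  rw [Real.tanh_eq_sinh_div_cosh, h1, h2]
  field_simp
  linear_combination -h3

theorem tanh_half_pos {x : ℝ} (hx : 0 < x) : 0 < Real.tanh (x / 2) := by
  rw [Real.tanh_eq_sinh_div_cosh]
  exact div_pos (Real.sinh_pos_iff.2 (by linarith)) (Real.cosh_pos _)

/-- Outside `[-Δ, Δ]` the function `exp (-z)` lies above its secant. -/
theorem secant_le_exp_neg {Δ z : ℝ} (hΔ : 0 < Δ) (hz : Δ ≤ |z|) :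
    Δ * (Real.cosh Δ - Real.exp (-z)) ≤ z * Real.sinh Δ := by
  have hs : Δ ≤ Real.sinh Δ := Real.self_le_sinh_iff.2 hΔ.le
  have e1 := Real.cosh_add_sinh Δ
  have e2 := Real.cosh_sub_sinh Δ
  have h1 : Real.exp (-Δ) ≤ 1 := Real.exp_le_one_iff.2 (by linarith)
  rcases le_abs'.1 hz with hz | hz
  · have h2 : Real.exp (-z) = Real.exp Δ * Real.exp (-z - Δ) := by
      rw [← Real.exp_add]; congr 1; ring
    have h3 := Real.add_one_le_exp (-z - Δ)
    have h4 : Real.sinh Δ ≤ Δ * Real.exp Δ := by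
      have h5 := Real.add_one_le_exp (-(2 * Δ))
      have h6 : Real.exp (-Δ) = Real.exp Δ * Real.exp (-(2 * Δ)) := by
        rw [← Real.exp_add]; congr 1; ring
      nlinarith [Real.exp_pos Δ]
    have h7 : Real.exp Δ * (-z - Δ + 1) ≤ Real.exp (-z) := by
      rw [h2]; exact mul_le_mul_of_nonneg_left h3 (Real.exp_pos _).le
    nlinarith [mul_nonneg (sub_nonneg.2 h4) (by linarith : 0 ≤ -z - Δ)]
  · have h2 : Real.exp (-z) = Real.exp (-Δ) * Real.exp (Δ - z) := by
      rw [← Real.exp_add]; congr 1; ring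
    have h3 := Real.add_one_le_exp (Δ - z)
    have h7 : Real.exp (-Δ) * (Δ - z + 1) ≤ Real.exp (-z) := by
      rw [h2]; exact mul_le_mul_of_nonneg_left h3 (Real.exp_pos _).le
    have h8 : Δ * Real.exp (-Δ) ≤ Real.sinh Δ := by nlinarith
    nlinarith [mul_nonneg (sub_nonneg.2 h8) (by linarith : 0 ≤ z - Δ)]

/-- The potential of an accumulated local log-likelihood ratio. -/
def llrPotential (Δ c z : ℝ) : ℝ := z + c * (Δ * (1 - Real.exp (-z)) / Real.sinh Δ)

theorem llrPotential_zero (Δ c : ℝ) : llrPotential Δ c 0 = 0 := by simp [llrPotential]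

/-- The secant of `exp (-z)` through `±Δ` lies below it at every value for which a message is sent,
and `(cosh Δ - 1) / sinh Δ = tanh (Δ / 2)`. So each message earns the surplus `c Δ tanh (Δ / 2)`. -/
theorem llrPotential_le {Δ c z : ℝ} (hΔ : 0 < Δ) (hc : 0 ≤ c) (hz : Δ ≤ |z|) :
    llrPotential Δ c z ≤ (1 + c) * z - c * (Δ * Real.tanh (Δ / 2)) := by
  have hs : 0 < Real.sinh Δ := Real.sinh_pos_iff.2 hΔ
  have h1 : Δ * (1 - Real.exp (-z)) / Real.sinh Δ ≤ z - Δ * Real.tanh (Δ / 2) := by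
    rw [div_le_iff₀ hs]
    have := secant_le_exp_neg hΔ hz
    have := tanh_half_mul_sinh Δ
    nlinarith
  have := mul_le_mul_of_nonneg_left h1 hc
  unfold llrPotential
  linarith

theorem llrPotential_mono {Δ c : ℝ} (hΔ : 0 < Δ) (hc : 0 ≤ c) : Monotone (llrPotential Δ c) := by
  intro a b hab
  have hs : 0 < Real.sinh Δ := Real.sinh_pos_iff.2 hΔ
  have : Real.exp (-b) ≤ Real.exp (-a) := Real.exp_le_exp.2 (by linarith)
  unfold llrPotential
  gcongr

theorem llrPotential_add_sub (Δ c a x : ℝ) :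
    llrPotential Δ c (a + x) - llrPotential Δ c a =
      x + c * Δ * Real.exp (-a) / Real.sinh Δ * (1 - Real.exp (-x)) := by
  unfold llrPotential
  rw [neg_add, Real.exp_add]
  ring

theorem measurable_llrPotential (Δ c : ℝ) : Measurable (llrPotential Δ c) := by
  unfold llrPotential
  fun_prop

variable {K : ℕ} {p : RLTParams} {c : ℝ}

theorem RLTParams.sub_le_increment (hφ : 0 < p.φ) (hΔ : 0 < p.Δ) {z : ℝ} (hz : p.Δ ≤ |z|)
    (hz2 : |z| ≤ p.Δ + p.φ) (u : ℝ) : z - p.φ / max (p.r : ℝ) 1 ≤ p.increment z u := by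
  have h := abs_le.1 (abs_quantize_sub_le hφ p.r (sub_nonneg.2 hz) (by linarith) u)
  unfold increment
  rcases le_abs'.1 hz with h1 | h1
  · rw [abs_of_neg (by linarith)] at h ⊢
    rw [Real.sign_of_neg (by linarith)]
    linarith
  · rw [abs_of_pos (by linarith)] at h ⊢
    rw [Real.sign_of_pos (by linarith)]
    linarith

/-- `c` is chosen so that the surplus of a message equals `1 + c` times the largest rounding error.
-/
theorem RLTParams.llrPotential_le_increment (hφ : 0 < p.φ) (hΔ : 0 < p.Δ) (hc : 0 ≤ c)
    (hcε : c * (p.Δ * Real.tanh (p.Δ / 2)) = (1 + c) * (p.φ / max (p.r : ℝ) 1)) {z : ℝ}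
    (hz : p.Δ ≤ |z|) (hz2 : |z| ≤ p.Δ + p.φ) (u : ℝ) :
    llrPotential p.Δ c z ≤ (1 + c) * p.increment z u := by
  have h1 := llrPotential_le hΔ hc hz
  have h2 := mul_le_mul_of_nonneg_left (p.sub_le_increment hφ hΔ hz hz2 u)
    (by linarith : 0 ≤ 1 + c)
  rw [hcε] at h1
  linarith

/-- The potential of a state of the network. -/
def RLTParams.potential (p : RLTParams) (c : ℝ) (st : NetState K) : ℝ :=
  (1 + c) * st.2 + ∑ k, llrPotential p.Δ c (st.1 k)

theorem sum_comp_update (g : ℝ → ℝ) (R : Fin K → ℝ) (k : Fin K) (a : ℝ) :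
    ∑ j, g (Function.update R k a j) = ∑ j, g (R j) + g a - g (R k) := by
  have h : ∀ f : Fin K → ℝ, ∑ j, f j = f k + ∑ j ∈ Finset.univ.erase k, f j := fun f =>
    (Finset.add_sum_erase _ f (Finset.mem_univ k)).symm
  rw [h fun j => g (R j), h fun j => g (Function.update R k a j), Function.update_self,
    Finset.sum_congr rfl fun j hj => by rw [Function.update_of_ne (Finset.ne_of_mem_erase hj)]]
  ring

theorem RLTParams.potential_micro (hφ : 0 < p.φ) (hΔ : 0 < p.Δ) (hc : 0 ≤ c)
    (hcε : c * (p.Δ * Real.tanh (p.Δ / 2)) = (1 + c) * (p.φ / max (p.r : ℝ) 1))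
    {k : Fin K} {y : ℝ × unitInterval} {st : NetState K} (hst : st.2 ∈ Set.Ioo (-p.B) p.A)
    (hz : |st.1 k + y.1| ≤ p.Δ + p.φ) :
    p.potential c st + (llrPotential p.Δ c (st.1 k + y.1) - llrPotential p.Δ c (st.1 k)) ≤
      p.potential c (p.micro k y st) := by
  unfold potential micro
  by_cases h : p.Δ ≤ |st.1 k + y.1|
  · simp only [h, if_true, sum_comp_update, llrPotential_zero, freeze, hst]
    have := p.llrPotential_le_increment hφ hΔ hc hcε h hz y.2
    linarith
  · simp only [h, if_false, sum_comp_update]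
    linarith

/-- Survival to the end of the list is needed: once the statistic is frozen, a message resets the
local value without being credited. -/
theorem RLTParams.potential_microList (hφ : 0 < p.φ) (hΔ : 0 < p.Δ) (hc : 0 ≤ c)
    (hcε : c * (p.Δ * Real.tanh (p.Δ / 2)) = (1 + c) * (p.φ / max (p.r : ℝ) 1))
    {e : Fin K → ℝ × unitInterval} {l : List (Fin K)} (hl : l.Nodup) {st : NetState K}
    (hz : ∀ k ∈ l, |st.1 k + (e k).1| ≤ p.Δ + p.φ)
    (hal : (p.microList e l st).2 ∈ Set.Ioo (-p.B) p.A) :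
    p.potential c st + (l.map fun k =>
      llrPotential p.Δ c (st.1 k + (e k).1) - llrPotential p.Δ c (st.1 k)).sum ≤
      p.potential c (p.microList e l st) := by
  induction l generalizing st with
  | nil => simp [microList_nil]
  | cons k l ih =>
    obtain ⟨hk, hl⟩ := List.nodup_cons.1 hl
    have hst : st.2 ∈ Set.Ioo (-p.B) p.A := by
      by_contra h
      rw [p.microList_snd_of_notMem h] at hal
      exact h hal
    have hother : ∀ j ∈ l, (p.micro k (e k) st).1 j = st.1 j := by
      intro j hj
      rw [micro_fst, Function.update_of_ne]
      rintro rfl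
      exact hk hj
    have h1 := p.potential_micro hφ hΔ hc hcε hst (hz k List.mem_cons_self)
    rw [microList_cons] at hal ⊢
    have hΦ : ∀ st' : NetState K, (∀ j ∈ l, st'.1 j = st.1 j) →
        (l.map fun k => llrPotential p.Δ c (st'.1 k + (e k).1) - llrPotential p.Δ c (st'.1 k)) =
        (l.map fun k => llrPotential p.Δ c (st.1 k + (e k).1) - llrPotential p.Δ c (st.1 k)) :=
      fun st' h => List.map_congr_left fun j hj => by rw [h j hj]
    rw [List.map_cons, List.sum_cons, ← hΦ _ hother]
    have hz' : ∀ j ∈ l, |(p.micro k (e k) st).1 j + (e j).1| ≤ p.Δ + p.φ := by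
      intro j hj
      rw [hother j hj]
      exact hz j (List.mem_cons_of_mem k hj)
    have h2 := ih hl hz' hal
    linarith

/-- The increase of the potential that is due to the observations of time `t + 1`. -/
def RLTParams.gain (p : RLTParams) (c : ℝ) (t : ℕ) (ω : ℕ → LStep K) : ℝ :=
  ∑ k, (llrPotential p.Δ c ((p.state t ω).1 k + ((ω t).1 k).1) -
    llrPotential p.Δ c ((p.state t ω).1 k))

theorem RLTParams.potential_step (hφ : 0 < p.φ) (hΔ : 0 < p.Δ) (hc : 0 ≤ c)
    (hcε : c * (p.Δ * Real.tanh (p.Δ / 2)) = (1 + c) * (p.φ / max (p.r : ℝ) 1))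
    {t : ℕ} {ω : ℕ → LStep K} (hω : ∀ k, |((ω t).1 k).1| ≤ p.φ)
    (hal : ω ∈ alive p.stat p.A p.B (t + 1)) :
    p.potential c (p.state t ω) + p.gain c t ω ≤ p.potential c (p.state (t + 1) ω) := by
  have h := p.potential_microList hφ hΔ hc hcε (e := (ω t).1) (st := p.state t ω)
    (nodup_map_finRange (ω t).2) (fun k _ => ?_) hal
  · rw [List.map_map, ← Fin.sum_univ_def] at h
    simp only [Function.comp_apply] at h
    rw [Equiv.sum_comp (ω t).2 fun k => llrPotential p.Δ c ((p.state t ω).1 k + ((ω t).1 k).1) -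
      llrPotential p.Δ c ((p.state t ω).1 k)] at h
    exact h
  · exact (abs_add_le _ _).trans (add_le_add (p.abs_state_fst_lt hΔ t ω k).le (hω k))

/-- The bound for the potential when the test stops. -/
def RLTParams.potentialBound (K : ℕ) (p : RLTParams) (c : ℝ) : ℝ :=
  (1 + c) * p.A +
    K * (p.Δ + p.φ + c * (p.Δ + p.φ - p.Δ * Real.tanh (p.Δ / 2)))

/-- Treats the time unit in which the test stops. The gain is counted before the messages are
processed, so the statistic is still below `A`, and each local value is at most `Δ + φ`; the
overshoot of the statistic plays no role. -/
theorem RLTParams.potential_add_gain_le (hφ : 0 < p.φ) (hΔ : 0 < p.Δ) (hc : 0 ≤ c)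
    {t : ℕ} {ω : ℕ → LStep K} (hω : ∀ k, |((ω t).1 k).1| ≤ p.φ)
    (hal : ω ∈ alive p.stat p.A p.B t) :
    p.potential c (p.state t ω) + p.gain c t ω ≤ p.potentialBound K c := by
  have h1 : (p.state t ω).2 ≤ p.A := hal.2.le
  have h2 : ∀ k, llrPotential p.Δ c ((p.state t ω).1 k + ((ω t).1 k).1) ≤
      p.Δ + p.φ + c * (p.Δ + p.φ - p.Δ * Real.tanh (p.Δ / 2)) := by
    intro k
    have h3 : (p.state t ω).1 k + ((ω t).1 k).1 ≤ p.Δ + p.φ :=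
      add_le_add ((le_abs_self _).trans (p.abs_state_fst_lt hΔ t ω k).le)
        ((le_abs_self _).trans (hω k))
    refine (llrPotential_mono hΔ hc h3).trans ?_
    refine (llrPotential_le hΔ hc ?_).trans (by linarith)
    rw [abs_of_pos (by linarith)]
    linarith
  have h4 := Finset.sum_le_sum fun (k : Fin K) (_ : k ∈ Finset.univ) => h2 k
  rw [Finset.sum_const, Finset.card_univ, Fintype.card_fin, nsmul_eq_mul] at h4
  have h5 := mul_le_mul_of_nonneg_left h1 (by linarith : 0 ≤ 1 + c)
  unfold potential gain potentialBound
  rw [Finset.sum_sub_distrib]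
  linarith

/-- During survival the gains sum to at most the current potential, which starts at `0`; the last
gain is covered by the bound for the stopping unit, and later ones are not counted. -/
theorem RLTParams.sum_gain_le (hφ : 0 < p.φ) (hΔ : 0 < p.Δ) (hA : 0 < p.A) (hB : 0 < p.B)
    (hc : 0 ≤ c) (hcε : c * (p.Δ * Real.tanh (p.Δ / 2)) = (1 + c) * (p.φ / max (p.r : ℝ) 1))
    {ω : ℕ → LStep K} (hω : ∀ t k, |((ω t).1 k).1| ≤ p.φ) (n : ℕ) :
    ∑ t ∈ Finset.range n, (alive p.stat p.A p.B t).indicator (p.gain c t) ω ≤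
      p.potentialBound K c := by
  have hT := p.isTest_stat (K := K) hA hB
  have hU : 0 ≤ p.potentialBound K c := by
    have : p.Δ * Real.tanh (p.Δ / 2) ≤ p.Δ := mul_le_of_le_one_right hΔ.le (Real.tanh_lt_one _).le
    unfold potentialBound
    have : 0 ≤ p.Δ + p.φ - p.Δ * Real.tanh (p.Δ / 2) := by linarith
    positivity
  suffices H : (ω ∈ alive p.stat p.A p.B n →
      ∑ t ∈ Finset.range n, (alive p.stat p.A p.B t).indicator (p.gain c t) ω ≤
        p.potential c (p.state n ω)) ∧
      ∑ t ∈ Finset.range n, (alive p.stat p.A p.B t).indicator (p.gain c t) ω ≤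
        p.potentialBound K c from H.2
  induction n with
  | zero => simp [state, potential, llrPotential_zero, hU]
  | succ n ih =>
    rw [Finset.sum_range_succ]
    by_cases h : ω ∈ alive p.stat p.A p.B n
    · rw [Set.indicator_of_mem h]
      have h1 := ih.1 h
      have h2 := p.potential_add_gain_le hφ hΔ hc (hω n) h
      refine ⟨fun h3 => ?_, by linarith⟩
      have h4 := p.potential_step hφ hΔ hc hcε (hω n) h3
      linarith
    · rw [Set.indicator_of_notMem h, add_zero]
      exact ⟨fun h3 => absurd (hT.alive_anti n.le_succ h3) h, ih.2⟩

theorem measurePreserving_stepLaw (m : Fin K → Measure ℝ) [∀ k, IsProbabilityMeasure (m k)]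
    (ρ : Measure (Equiv.Perm (Fin K))) [IsProbabilityMeasure ρ] (k : Fin K) :
    MeasurePreserving (fun e : LStep K => (e.1 k).1) (stepLaw m ρ) (m k) :=
  measurePreserving_fst.comp
    ((measurePreserving_eval (fun k => (m k).prod (volume : Measure unitInterval)) k).comp
      measurePreserving_fst)

theorem SymmLLR.integral_exp_neg {m : Measure ℝ} (hm : SymmLLR m) :
    ∫ x, Real.exp (-x) ∂m = 1 := by
  rw [integral_eq_lintegral_of_nonneg_ae (ae_of_all _ fun _ => (Real.exp_pos _).le)
    (by fun_prop), hm.lintegral_exp_neg, ENNReal.toReal_one]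

theorem SymmLLR.integrable_exp_neg {m : Measure ℝ} (hm : SymmLLR m) :
    Integrable (fun x => Real.exp (-x)) m := by
  refine ⟨by fun_prop, ?_⟩
  rw [hasFiniteIntegral_iff_ofReal (ae_of_all _ fun _ => (Real.exp_pos _).le),
    hm.lintegral_exp_neg]
  exact ENNReal.one_lt_top

theorem integrable_of_abs_le {m : Measure ℝ} [IsProbabilityMeasure m] {φ : ℝ}
    (hb : ∀ᵐ x ∂m, |x| ≤ φ) : Integrable (fun x => x) m :=
  Integrable.of_bound measurable_id.aestronglyMeasurable φ hb

/-- The exponential part is a martingale, so the correction costs no drift. -/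
theorem SymmLLR.integral_llrPotential {m : Measure ℝ} (hm : SymmLLR m) {φ : ℝ}
    (hb : ∀ᵐ x ∂m, |x| ≤ φ) (Δ c a : ℝ) :
    Integrable (fun x => llrPotential Δ c (a + x) - llrPotential Δ c a) m ∧
    ∫ x, (llrPotential Δ c (a + x) - llrPotential Δ c a) ∂m = ∫ x, x ∂m := by
  have := hm.prob
  simp_rw [llrPotential_add_sub]
  have h1 := integrable_of_abs_le hb
  have h2 : Integrable (fun x => c * Δ * Real.exp (-a) / Real.sinh Δ * (1 - Real.exp (-x))) m :=
    ((integrable_const 1).sub hm.integrable_exp_neg).const_mul _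
  refine ⟨h1.add h2, ?_⟩
  rw [integral_add h1 h2, integral_const_mul,
    integral_sub (integrable_const 1) hm.integrable_exp_neg, hm.integral_exp_neg]
  simp

theorem RLTParams.integrable_gain (hΔ : 0 < p.Δ) {m : Fin K → Measure ℝ}
    (hm : ∀ k, SymmLLR (m k)) (hb : ∀ k, ∀ᵐ x ∂(m k), |x| ≤ p.φ)
    (ρ : Measure (Equiv.Perm (Fin K))) [IsProbabilityMeasure ρ] (t : ℕ) :
    Measurable (p.gain (K := K) c t) ∧
    Integrable (p.gain c t) (Measure.infinitePi fun _ : ℕ => stepLaw m ρ) := by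
  have hmp := fun k => (hm k).prob
  have hR : ∀ k, Measurable fun ω : ℕ → LStep K => (p.state t ω).1 k := fun k =>
    (measurable_pi_apply k).comp (measurable_fst.comp (p.measurable_state t))
  have hX : ∀ k, Measurable fun ω : ℕ → LStep K => ((ω t).1 k).1 := fun k => by fun_prop
  have hh := measurable_llrPotential p.Δ c
  have hmt : ∀ k, Measurable fun ω : ℕ → LStep K =>
      llrPotential p.Δ c ((p.state t ω).1 k + ((ω t).1 k).1) -
        llrPotential p.Δ c ((p.state t ω).1 k) := fun k =>
    (hh.comp ((hR k).add (hX k))).sub (hh.comp (hR k))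
  refine ⟨Finset.measurable_sum _ fun k _ => hmt k, ?_⟩
  refine integrable_finsetSum _ fun k _ => ?_
  have hae : ∀ᵐ ω ∂(Measure.infinitePi fun _ : ℕ => stepLaw m ρ), |((ω t).1 k).1| ≤ p.φ := by
    have := (ae_forall_infinitePi (ν₁ := stepLaw m ρ)
      ((measurePreserving_stepLaw m ρ k).quasiMeasurePreserving.ae (hb k)))
    filter_upwards [this] with ω h using h t
  have hi : Integrable (fun ω : ℕ → LStep K => ((ω t).1 k).1)
      (Measure.infinitePi fun _ : ℕ => stepLaw m ρ) :=
    Integrable.of_bound (hX k).aestronglyMeasurable p.φ hae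
  refine Integrable.of_bound (hmt k).aestronglyMeasurable
    (p.φ + |c * p.Δ / Real.sinh p.Δ| * Real.exp p.Δ * (1 + Real.exp p.φ)) ?_
  filter_upwards [hae] with ω h
  have h1 := abs_le.1 (p.abs_state_fst_lt hΔ t ω k).le
  have h2 := abs_le.1 h
  rw [Real.norm_eq_abs, llrPotential_add_sub]
  set a := (p.state t ω).1 k
  set x := ((ω t).1 k).1
  refine (abs_add_le _ _).trans (add_le_add h ?_)
  rw [show c * p.Δ * Real.exp (-a) / Real.sinh p.Δ * (1 - Real.exp (-x)) =
    (c * p.Δ / Real.sinh p.Δ) * Real.exp (-a) * (1 - Real.exp (-x)) by ring, abs_mul, abs_mul,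
    Real.abs_exp]
  have h3 : |1 - Real.exp (-x)| ≤ 1 + Real.exp p.φ := by
    have : Real.exp (-x) ≤ Real.exp p.φ := Real.exp_le_exp.2 (by linarith)
    have := Real.exp_pos (-x)
    rw [abs_le]
    constructor <;> linarith
  have h4 : Real.exp (-a) ≤ Real.exp p.Δ := Real.exp_le_exp.2 (by linarith)
  gcongr

/-- An upper bound for the expected stopping time of the RLT-SPRT. -/
theorem RLTParams.tsum_alive_le (hφ : 0 < p.φ) (hΔ : 0 < p.Δ) (hA : 0 < p.A) (hB : 0 < p.B)
    (hc : 0 ≤ c) (hcε : c * (p.Δ * Real.tanh (p.Δ / 2)) = (1 + c) * (p.φ / max (p.r : ℝ) 1))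
    {m : Fin K → Measure ℝ} (hm : ∀ k, SymmLLR (m k)) (hb : ∀ k, ∀ᵐ x ∂(m k), |x| ≤ p.φ)
    (ρ : Measure (Equiv.Perm (Fin K))) [IsProbabilityMeasure ρ] (hI : 0 < ∑ k, ∫ x, x ∂(m k)) :
    ∑' t, (Measure.infinitePi fun _ : ℕ => stepLaw m ρ) (alive p.stat p.A p.B t) ≤
      ENNReal.ofReal (p.potentialBound K c / ∑ k, ∫ x, x ∂(m k)) := by
  have hmp := fun k => (hm k).prob
  have hT := p.isTest_stat (K := K) hA hB
  set Q := Measure.infinitePi fun _ : ℕ => stepLaw m ρ with hQ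
  -- Given the past, a gain has mean `∑ k, E x_k` whatever the local values are; this is Wald's
  -- identity for the potential.
  have hint : ∀ t, ∫ ω, (alive p.stat p.A p.B t).indicator (p.gain c t) ω ∂Q =
      (∑ k, ∫ x, x ∂(m k)) * Q.real (alive p.stat p.A p.B t) := by
    intro t
    obtain ⟨h1, h2⟩ := p.integrable_gain (c := c) hΔ hm hb ρ t
    refine hT.integral_indicator_alive t h1 h2 fun ω => ?_
    have e : ∀ k, Integrable (fun e : LStep K => llrPotential p.Δ c ((p.state t ω).1 k + (e.1 k).1)
        - llrPotential p.Δ c ((p.state t ω).1 k)) (stepLaw m ρ) ∧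
        ∫ e : LStep K, (llrPotential p.Δ c ((p.state t ω).1 k + (e.1 k).1)
        - llrPotential p.Δ c ((p.state t ω).1 k)) ∂(stepLaw m ρ) = ∫ x, x ∂(m k) := by
      intro k
      have mp := measurePreserving_stepLaw m ρ k
      obtain ⟨h3, h4⟩ := (hm k).integral_llrPotential (hb k) p.Δ c ((p.state t ω).1 k)
      refine ⟨mp.integrable_comp_of_integrable h3, ?_⟩
      rw [← h4]
      conv_rhs => rw [← mp.map_eq]
      rw [integral_map mp.measurable.aemeasurable]
      rw [mp.map_eq]
      exact h3.aestronglyMeasurable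
    simp only [gain, state_update, Function.update_self]
    rw [integral_finsetSum _ fun k _ => (e k).1]
    exact Finset.sum_congr rfl fun k _ => (e k).2
  have hae : ∀ᵐ ω ∂Q, ∀ t k, |((ω t).1 k).1| ≤ p.φ :=
    ae_forall_infinitePi (ν₁ := stepLaw m ρ) (p := fun e : LStep K => ∀ k, |(e.1 k).1| ≤ p.φ)
      (ae_all_iff.2 fun k => (measurePreserving_stepLaw m ρ k).quasiMeasurePreserving.ae (hb k))
  refine ENNReal.tsum_le_of_sum_range_le fun n => ?_
  have hfi : ∀ t, Integrable ((alive p.stat p.A p.B t).indicator (p.gain (K := K) c t)) Q :=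
    fun t => ((p.integrable_gain hΔ hm hb ρ t).2).indicator (hT.measurableSet_alive t)
  have h1 : ∫ ω, ∑ t ∈ Finset.range n, (alive p.stat p.A p.B t).indicator (p.gain c t) ω ∂Q ≤
      p.potentialBound K c := by
    have : ∫ _, p.potentialBound K c ∂Q = p.potentialBound K c := by simp
    rw [← this]
    refine integral_mono_ae (integrable_finsetSum _ fun t _ => hfi t) (integrable_const _) ?_
    filter_upwards [hae] with ω hω
    exact p.sum_gain_le hφ hΔ hA hB hc hcε hω n
  rw [integral_finsetSum _ fun t _ => hfi t] at h1
  simp_rw [hint] at h1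
  rw [← Finset.mul_sum] at h1
  have h2 : ∑ t ∈ Finset.range n, Q (alive p.stat p.A p.B t) =
      ENNReal.ofReal (∑ t ∈ Finset.range n, Q.real (alive p.stat p.A p.B t)) := by
    rw [ENNReal.ofReal_sum_of_nonneg fun t _ => measureReal_nonneg]
    exact Finset.sum_congr rfl fun t _ => (ofReal_measureReal).symm
  rw [h2]
  refine ENNReal.ofReal_le_ofReal ?_
  rw [le_div_iff₀ hI]
  linarith

end ExpectedTime

/-! ### First times and tail sums -/

section FirstTime

theorem firstTime_le_iff {p : ℕ → Prop} {t : ℕ} : firstTime p ≤ t ↔ ∃ s ≤ t, p s := by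
  unfold firstTime
  constructor
  · intro h
    have h2 : (⨅ (t : ℕ) (_ : p t), (t : ℕ∞)) < (t + 1 : ℕ) :=
      lt_of_le_of_lt h (by exact_mod_cast t.lt_succ_self)
    simp only [iInf_lt_iff] at h2
    obtain ⟨s, hs, hst⟩ := h2
    exact ⟨s, Nat.lt_succ_iff.1 (by exact_mod_cast hst), hs⟩
  · rintro ⟨s, hs, hp⟩
    exact (iInf₂_le s hp).trans (by exact_mod_cast hs)

theorem firstTime_ne_top_iff {p : ℕ → Prop} : firstTime p ≠ ⊤ ↔ ∃ s, p s := by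
  constructor
  · intro h
    obtain ⟨n, hn⟩ := ENat.ne_top_iff_exists.1 h
    obtain ⟨s, -, hs⟩ := firstTime_le_iff.1 hn.ge
    exact ⟨s, hs⟩
  · rintro ⟨s, hs⟩ h
    have := firstTime_le_iff.2 ⟨s, le_rfl, hs⟩
    rw [h] at this
    exact ENat.natCast_ne_top s (top_le_iff.1 this)

theorem firstTime_eq_coe_iff {p : ℕ → Prop} {n : ℕ} :
    firstTime p = n ↔ p n ∧ ∀ m < n, ¬ p m := by
  constructor
  · intro h
    have h2 : ∀ m < n, ¬ p m := by
      intro m hm hp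
      have := firstTime_le_iff.2 ⟨m, le_rfl, hp⟩
      rw [h] at this
      exact absurd (by exact_mod_cast this) (not_le.2 hm)
    obtain ⟨s, hs, hp⟩ := firstTime_le_iff.1 h.le
    rcases hs.lt_or_eq with hs | rfl
    · exact absurd hp (h2 s hs)
    · exact ⟨hp, h2⟩
  · rintro ⟨hp, h⟩
    refine le_antisymm (firstTime_le_iff.2 ⟨n, le_rfl, hp⟩) ?_
    refine le_iInf₂ fun m hm => ?_
    exact_mod_cast not_lt.1 fun hmn => h m hmn hm

theorem exists_firstTime {p : ℕ → Prop} {s : ℕ} (hs : p s) :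
    ∃ n ≤ s, firstTime p = n ∧ p n ∧ ∀ m < n, ¬ p m := by
  obtain ⟨n, hn⟩ := ENat.ne_top_iff_exists.1 (firstTime_ne_top_iff.2 ⟨s, hs⟩)
  have := firstTime_le_iff.2 ⟨s, le_rfl, hs⟩
  rw [← hn] at this
  exact ⟨n, by exact_mod_cast this, hn.symm, firstTime_eq_coe_iff.1 hn.symm⟩

/-- The expectation of a random time is the sum of its tail probabilities. -/
theorem lintegral_toENNReal_eq_tsum {Ω : Type*} [MeasurableSpace Ω] (P : Measure Ω) {T : Ω → ℕ∞}
    (hT : ∀ t : ℕ, MeasurableSet {ω | ¬ T ω ≤ t}) :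
    ∫⁻ ω, ((T ω : ℕ∞) : ℝ≥0∞) ∂P = ∑' t : ℕ, P {ω | ¬ T ω ≤ t} := by
  have e : ∀ ω, ((T ω : ℕ∞) : ℝ≥0∞) =
      ∑' t : ℕ, ({ω | ¬ T ω ≤ t} : Set Ω).indicator (fun _ => (1 : ℝ≥0∞)) ω := by
    intro ω
    have e1 : ∀ t : ℕ, ({ω | ¬ T ω ≤ t} : Set Ω).indicator (fun _ => (1 : ℝ≥0∞)) ω =
        ({t : ℕ | ¬ T ω ≤ t} : Set ℕ).indicator (fun _ => (1 : ℝ≥0∞)) t := fun t => rfl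
    simp_rw [e1]
    rw [← tsum_subtype, ENNReal.tsum_one, ENat.card_coe_set_eq]
    congr 1
    induction h : T ω with
    | top => simp
    | coe n =>
      have : ({t : ℕ | ¬ (n : ℕ∞) ≤ t} : Set ℕ) = ((Finset.range n : Finset ℕ) : Set ℕ) := by
        ext t
        simp
      rw [this, Set.encard_coe_eq_coe_finsetCard, Finset.card_range]
  simp_rw [e]
  rw [lintegral_tsum fun t => (measurable_const.indicator (hT t)).aemeasurable]
  refine tsum_congr fun t => ?_
  rw [lintegral_indicator (hT t), setLIntegral_const, one_mul]

end FirstTime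

/-! ### The frozen walk and the first exit -/

section FrozenWalk

variable {E : Type*} {x : E → ℝ} {A B : ℝ}

theorem frozenWalk_eq_walk_of_first {ω : ℕ → E} {n t : ℕ} (hnt : n ≤ t)
    (hlast : frozenWalk x A B n ω = walk x n ω) (hn : walk x n ω ∉ Set.Ioo (-B) A) :
    frozenWalk x A B t ω = walk x n ω := by
  induction t, hnt using Nat.le_induction with
  | base => exact hlast
  | succ t _ ih =>
    have : frozenWalk x A B t ω ∉ Set.Ioo (-B) A := by rwa [ih]
    simp only [frozenWalk, if_neg this]
    exact ih

theorem frozenWalk_mem_of_forall (hA : 0 < A) (hB : 0 < B) {ω : ℕ → E} {t : ℕ}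
    (h : ∀ s, s ≤ t → 0 < s → walk x s ω ∈ Set.Ioo (-B) A) :
    frozenWalk x A B t ω ∈ Set.Ioo (-B) A := by
  induction t with
  | zero => simpa [frozenWalk] using ⟨hB, hA⟩
  | succ t ih =>
    rw [frozenWalk_succ_eq_walk x t ω (ih fun s hs => h s (hs.trans t.le_succ))]
    exact h _ le_rfl t.succ_pos

theorem frozenWalk_eq_of_least (hA : 0 < A) (hB : 0 < B) {ω : ℕ → E} {n t : ℕ} (hnt : n ≤ t)
    (hn : walk x n ω ∉ Set.Ioo (-B) A)
    (hlt : ∀ s, s < n → 0 < s → walk x s ω ∈ Set.Ioo (-B) A) :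
    frozenWalk x A B t ω = walk x n ω := by
  refine frozenWalk_eq_walk_of_first hnt ?_ hn
  cases n with
  | zero => simp [frozenWalk, walk]
  | succ n =>
    exact frozenWalk_succ_eq_walk x n ω
      (frozenWalk_mem_of_forall hA hB fun s hs => hlt s (Nat.lt_succ_iff.2 hs))

theorem frozenWalk_mem_iff (hA : 0 < A) (hB : 0 < B) {ω : ℕ → E} {t : ℕ} :
    frozenWalk x A B t ω ∈ Set.Ioo (-B) A ↔
      ∀ s, s ≤ t → 0 < s → walk x s ω ∈ Set.Ioo (-B) A := by
  refine ⟨fun h s hs h0 => ?_, frozenWalk_mem_of_forall hA hB⟩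
  by_contra hc
  obtain ⟨n, hns, -, ⟨hn0, hn⟩, hmin⟩ :=
    exists_firstTime (p := fun s => 0 < s ∧ walk x s ω ∉ Set.Ioo (-B) A) ⟨h0, hc⟩
  rw [frozenWalk_eq_of_least hA hB (hns.trans hs) hn
    fun m hm hm0 => by_contra fun hc => hmin m hm ⟨hm0, hc⟩] at h
  exact hn h

/-- The frozen sum of a list. -/
theorem foldl_freeze_eq_frozenWalk (A B : ℝ) (l : List ℝ) :
    l.foldl (freeze A B) 0 = frozenWalk id A B l.length fun i => l.getD i 0 := by
  have h : ∀ (z : ℕ → ℝ) (n : ℕ), ((List.range n).map z).foldl (freeze A B) 0 =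
      frozenWalk id A B n z := by
    intro z n
    induction n with
    | zero => rfl
    | succ n ih =>
      rw [List.range_succ, List.map_append, List.foldl_append, ih]
      rfl
  have hl : l = (List.range l.length).map fun i => l.getD i 0 := by
    refine List.ext_getElem (by simp) fun i h1 h2 => ?_
    rw [List.getElem_map, List.getElem_range, List.getD_eq_getElem _ _ h1]
  conv_lhs => rw [hl]
  rw [h]

theorem walk_getD_eq_sum_take (l : List ℝ) {n : ℕ} (hn : n ≤ l.length) :
    walk id n (fun i => l.getD i 0) = (l.take n).sum := by
  unfold walk
  induction n with
  | zero => simp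
  | succ n ih =>
    rw [Finset.sum_range_succ, ih (n.le_succ.trans hn), List.sum_take_succ l n hn]
    exact congrArg _ (List.getD_eq_getElem l 0 hn)

end FrozenWalk

/-! ### The two tests as functions of the log-likelihood ratios -/

section Bridge

variable {K : ℕ} {Y : Fin K → Type*} [∀ k, MeasurableSpace (Y k)]
  (μ : Fin 2 → (k : Fin K) → Measure (Y k))

/-- The log-likelihood ratios of the observations of one time unit. -/
def llrStep (s : Step Y) : LStep K :=
  (fun k => (llr (μ 1 k) (μ 0 k) (s.1 k).1, (s.1 k).2), s.2)

/-- The log-likelihood ratios along a realization of the experiment. -/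
def llrPath (ω : Path Y) : ℕ → LStep K := fun t => llrStep μ (ω t)

/-- The sum of the log-likelihood ratios of one time unit. -/
def stepSum (e : LStep K) : ℝ := ∑ k, (e.1 k).1

theorem measurable_stepSum : Measurable (stepSum (K := K)) := by
  unfold stepSum; fun_prop

theorem globalLLR_eq_walk (t : ℕ) (ω : Path Y) :
    globalLLR μ t ω = walk stepSum t (llrPath μ ω) := by
  unfold globalLLR localLLR walk
  rw [Finset.sum_comm]
  rfl

theorem sprtTime_le_iff {A B : ℝ} (hA : 0 < A) (hB : 0 < B) (ω : Path Y) (t : ℕ) :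
    ¬ sprtTime μ A B ω ≤ t ↔ llrPath μ ω ∈ alive (frozenWalk stepSum A B) A B t := by
  unfold sprtTime alive
  rw [firstTime_le_iff, Set.mem_ofPred_eq, frozenWalk_mem_iff hA hB]
  simp only [globalLLR_eq_walk]
  push Not
  exact ⟨fun h s hs h0 => h s hs h0, fun h s hs h0 => h s hs h0⟩

/-- The frozen walk keeps its exit value, so a decision can be read off at any later time. The
predicate `P` stands for either decision. -/
theorem sprtDecides_iff {A B : ℝ} (hA : 0 < A) (hB : 0 < B) {P : ℝ → Prop}
    (hP : ∀ y, P y → y ∉ Set.Ioo (-B) A) (ω : Path Y) :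
    (∃ t : ℕ, sprtTime μ A B ω = t ∧ P (globalLLR μ t ω)) ↔
      ∃ t, P (frozenWalk stepSum A B t (llrPath μ ω)) := by
  unfold sprtTime
  simp only [globalLLR_eq_walk]
  constructor
  · rintro ⟨t, ht, hp⟩
    obtain ⟨⟨-, h1⟩, h2⟩ := firstTime_eq_coe_iff.1 ht
    refine ⟨t, ?_⟩
    rwa [frozenWalk_eq_of_least hA hB le_rfl h1
      fun s hs h0 => by_contra fun hc => h2 s hs ⟨h0, hc⟩]
  · rintro ⟨t, hp⟩
    have h := hP _ hp
    rw [frozenWalk_mem_iff hA hB] at h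
    push Not at h
    obtain ⟨s, hs, h0, hc⟩ := h
    obtain ⟨n, hns, hn, ⟨hn0, hn1⟩, hmin⟩ := exists_firstTime
      (p := fun s => 0 < s ∧ walk stepSum s (llrPath μ ω) ∉ Set.Ioo (-B) A) ⟨h0, hc⟩
    refine ⟨n, hn, ?_⟩
    rwa [frozenWalk_eq_of_least hA hB (hns.trans hs) hn1
      fun m hm hm0 => by_contra fun hc => hmin m hm ⟨hm0, hc⟩] at hp

/-! ### The messages -/

variable (p : RLTParams)

/-- The messages that are processed in one time unit. -/
def newMessages (t : ℕ) (ω : Path Y) : List ℝ :=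
  ((List.finRange K).map (ω t).2).filterMap fun k => message μ p.φ p.Δ p.r k t ω

theorem received_succ (t : ℕ) (ω : Path Y) :
    received μ p.φ p.Δ p.r (t + 1) ω = received μ p.φ p.Δ p.r t ω ++ newMessages μ p t ω := by
  unfold received newMessages
  rw [List.range_succ, List.flatMap_append, List.flatMap_singleton]

theorem received_prefix {s t : ℕ} (hst : s ≤ t) (ω : Path Y) :
    received μ p.φ p.Δ p.r s ω <+: received μ p.φ p.Δ p.r t ω := by
  induction t, hst using Nat.le_induction with
  | base => exact List.prefix_rfl
  | succ t _ ih => exact ih.trans (received_succ μ p t ω ▸ List.prefix_append _ _)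

theorem commTime_le_iff (n t : ℕ) (ω : Path Y) :
    commTime μ p.φ p.Δ p.r n ω ≤ t ↔ n ≤ (received μ p.φ p.Δ p.r t ω).length := by
  unfold commTime
  rw [firstTime_le_iff]
  exact ⟨fun ⟨s, hs, h⟩ => h.trans (received_prefix μ p hs ω).length_le,
    fun h => ⟨t, le_rfl, h⟩⟩

theorem commTime_ne_top_iff (n : ℕ) (ω : Path Y) :
    commTime μ p.φ p.Δ p.r n ω ≠ ⊤ ↔ ∃ t, n ≤ (received μ p.φ p.Δ p.r t ω).length :=
  firstTime_ne_top_iff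

/-- Later lists of messages extend earlier ones, so the first `n` messages do not depend on when the
list is read. -/
theorem fusionLLR_eq {n t : ℕ} {ω : Path Y} (h : n ≤ (received μ p.φ p.Δ p.r t ω).length) :
    fusionLLR μ p.φ p.Δ p.r n ω = ((received μ p.φ p.Δ p.r t ω).take n).sum := by
  obtain ⟨s, hst, hs, hns, -⟩ := exists_firstTime
    (p := fun t => n ≤ (received μ p.φ p.Δ p.r t ω).length) h
  have hs' : commTime μ p.φ p.Δ p.r n ω = s := hs
  unfold fusionLLR
  rw [hs', ENat.toNat_natCast]
  obtain ⟨l, hl⟩ := received_prefix μ p hst ω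
  rw [← hl, List.take_append_of_le_length hns]

theorem state_llrPath_fst (t : ℕ) (ω : Path Y) (k : Fin K) :
    (p.state t (llrPath μ ω)).1 k =
      localLLR μ k t ω - localLLR μ k (lastSample μ p.Δ k ω t) ω := by
  induction t with
  | zero => simp [RLTParams.state, lastSample]
  | succ t ih =>
    have e : localLLR μ k t ω - localLLR μ k (lastSample μ p.Δ k ω t) ω +
        ((llrPath μ ω t).1 k).1 =
        localLLR μ k (t + 1) ω - localLLR μ k (lastSample μ p.Δ k ω t) ω := by
      unfold localLLR
      rw [Finset.sum_range_succ]
      simp only [llrPath, llrStep]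
      ring
    rw [RLTParams.state_succ, RLTParams.step_fst, ih, e]
    simp only [lastSample]
    split_ifs
    · rw [sub_self]
    · rfl

/-- Processing one SU leaves the local values of the others alone, so all messages of a time unit
can be computed from its initial state, as in `message`. -/
theorem microList_snd_eq_foldl (e : Fin K → ℝ × unitInterval) {l : List (Fin K)} (hl : l.Nodup)
    (st : NetState K) :
    (p.microList e l st).2 = (l.filterMap fun k =>
      if p.Δ ≤ |st.1 k + (e k).1| then some (p.increment (st.1 k + (e k).1) (e k).2)
      else none).foldl (freeze p.A p.B) st.2 := by
  induction l generalizing st with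
  | nil => rfl
  | cons k l ih =>
    obtain ⟨hk, hl⟩ := List.nodup_cons.1 hl
    have hother : ∀ j ∈ l, (p.micro k (e k) st).1 j = st.1 j := by
      intro j hj
      rw [RLTParams.micro_fst, Function.update_of_ne]
      rintro rfl
      exact hk hj
    rw [RLTParams.microList_cons, ih hl, List.filterMap_cons]
    have h1 : (l.filterMap fun k' =>
        if p.Δ ≤ |(p.micro k (e k) st).1 k' + (e k').1| then
          some (p.increment ((p.micro k (e k) st).1 k' + (e k').1) (e k').2) else none) =
        l.filterMap fun k => if p.Δ ≤ |st.1 k + (e k).1| then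
          some (p.increment (st.1 k + (e k).1) (e k).2) else none :=
      List.filterMap_congr fun j hj => by rw [hother j hj]
    rw [h1]
    by_cases h : p.Δ ≤ |st.1 k + (e k).1|
    · simp only [h, if_true, List.foldl_cons, RLTParams.micro]
    · simp only [h, if_false, RLTParams.micro]

theorem stat_llrPath (t : ℕ) (ω : Path Y) :
    p.stat t (llrPath μ ω) = (received μ p.φ p.Δ p.r t ω).foldl (freeze p.A p.B) 0 := by
  induction t with
  | zero => rfl
  | succ t ih =>
    rw [received_succ, List.foldl_append, ← ih]
    unfold RLTParams.stat
    rw [RLTParams.state_succ, RLTParams.step,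
      microList_snd_eq_foldl p _ (nodup_map_finRange _)]
    congr 1
    unfold newMessages
    refine List.filterMap_congr fun k _ => ?_
    have e : (p.state t (llrPath μ ω)).1 k + ((llrPath μ ω t).1 k).1 =
        localLLR μ k (t + 1) ω - localLLR μ k (lastSample μ p.Δ k ω t) ω := by
      rw [state_llrPath_fst]
      unfold localLLR
      rw [Finset.sum_range_succ]
      simp only [llrPath, llrStep]
      ring
    rw [e]
    rfl

theorem stat_llrPath_eq_frozenWalk (t : ℕ) (ω : Path Y) :
    p.stat t (llrPath μ ω) = frozenWalk id p.A p.B (received μ p.φ p.Δ p.r t ω).length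
      fun i => (received μ p.φ p.Δ p.r t ω).getD i 0 := by
  rw [stat_llrPath, foldl_freeze_eq_frozenWalk]

theorem walk_received_eq_fusionLLR {n t : ℕ} {ω : Path Y}
    (h : n ≤ (received μ p.φ p.Δ p.r t ω).length) :
    walk id n (fun i => (received μ p.φ p.Δ p.r t ω).getD i 0) =
      fusionLLR μ p.φ p.Δ p.r n ω := by
  rw [walk_getD_eq_sum_take _ h, fusionLLR_eq μ p h]

theorem stat_notMem_iff (hA : 0 < p.A) (hB : 0 < p.B) (t : ℕ) (ω : Path Y) :
    p.stat t (llrPath μ ω) ∉ Set.Ioo (-p.B) p.A ↔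
      ∃ n ≤ (received μ p.φ p.Δ p.r t ω).length, 0 < n ∧
        fusionLLR μ p.φ p.Δ p.r n ω ∉ Set.Ioo (-p.B) p.A := by
  rw [stat_llrPath_eq_frozenWalk, frozenWalk_mem_iff hA hB]
  push Not
  refine exists_congr fun n => and_congr_right fun hn => and_congr_right fun _ => ?_
  rw [walk_received_eq_fusionLLR μ p hn]

/-- The condition that defines the number of messages at which the RLT-SPRT stops. -/
def Exits (n : ℕ) (ω : Path Y) : Prop :=
  0 < n ∧ commTime μ p.φ p.Δ p.r n ω ≠ ⊤ ∧
    fusionLLR μ p.φ p.Δ p.r n ω ∉ Set.Ioo (-p.B) p.A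

theorem rltCount_eq_firstTime (ω : Path Y) :
    rltCount μ p.φ p.Δ p.r p.A p.B ω = firstTime fun n => Exits μ p n ω := rfl

/-- The stopping rule counts messages, the state machine counts time units; they match because the
`n`-th message has arrived by time `t` exactly when the list at time `t` has length at least `n`. -/
theorem rltTime_le_iff (hA : 0 < p.A) (hB : 0 < p.B) (ω : Path Y) (t : ℕ) :
    ¬ rltTime μ p.φ p.Δ p.r p.A p.B ω ≤ t ↔ llrPath μ ω ∈ alive p.stat p.A p.B t := by
  rw [alive, Set.mem_ofPred_eq, ← not_iff_not, not_not, stat_notMem_iff μ p hA hB, rltTime,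
    rltCount_eq_firstTime]
  constructor
  · intro h
    by_cases hT : firstTime (fun n => Exits μ p n ω) = ⊤
    · rw [if_pos hT] at h
      exact absurd (top_le_iff.1 h) (ENat.natCast_ne_top t)
    · rw [if_neg hT] at h
      obtain ⟨n, hn⟩ := ENat.ne_top_iff_exists.1 hT
      rw [← hn, ENat.toNat_natCast, commTime_le_iff] at h
      obtain ⟨⟨h0, -, h1⟩, -⟩ := firstTime_eq_coe_iff.1 hn.symm
      exact ⟨n, h, h0, h1⟩
  · rintro ⟨s, hs, h0, h1⟩
    obtain ⟨n, hns, hn, -⟩ := exists_firstTime (p := fun n => Exits μ p n ω)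
      ⟨h0, (commTime_ne_top_iff μ p s ω).2 ⟨t, hs⟩, h1⟩
    rw [hn, if_neg (ENat.natCast_ne_top n), ENat.toNat_natCast, commTime_le_iff]
    exact hns.trans hs

theorem stat_eq_fusionLLR (hA : 0 < p.A) (hB : 0 < p.B) {n t : ℕ} {ω : Path Y}
    (hn : Exits μ p n ω) (hmin : ∀ m < n, ¬ Exits μ p m ω)
    (hnt : n ≤ (received μ p.φ p.Δ p.r t ω).length) :
    p.stat t (llrPath μ ω) = fusionLLR μ p.φ p.Δ p.r n ω := by
  rw [stat_llrPath_eq_frozenWalk, ← walk_received_eq_fusionLLR μ p hnt]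
  refine frozenWalk_eq_of_least hA hB hnt ?_ fun m hm h0 => ?_
  · rw [walk_received_eq_fusionLLR μ p hnt]
    exact hn.2.2
  · rw [walk_received_eq_fusionLLR μ p (hm.le.trans hnt)]
    by_contra hc
    exact hmin m hm ⟨h0, (commTime_ne_top_iff μ p m ω).2 ⟨t, hm.le.trans hnt⟩, hc⟩

theorem rltDecides_iff (hA : 0 < p.A) (hB : 0 < p.B) {P : ℝ → Prop}
    (hP : ∀ y, P y → y ∉ Set.Ioo (-p.B) p.A) (ω : Path Y) :
    (∃ n : ℕ, rltCount μ p.φ p.Δ p.r p.A p.B ω = n ∧ P (fusionLLR μ p.φ p.Δ p.r n ω)) ↔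
      ∃ t, P (p.stat t (llrPath μ ω)) := by
  rw [rltCount_eq_firstTime]
  constructor
  · rintro ⟨n, hn, hp⟩
    obtain ⟨h1, hmin⟩ := firstTime_eq_coe_iff.1 hn
    obtain ⟨t, ht⟩ := (commTime_ne_top_iff μ p n ω).1 h1.2.1
    exact ⟨t, by rwa [stat_eq_fusionLLR μ p hA hB h1 hmin ht]⟩
  · rintro ⟨t, hp⟩
    obtain ⟨s, hs, h0, h1⟩ := (stat_notMem_iff μ p hA hB t ω).1 (hP _ hp)
    obtain ⟨n, hns, hn, h2, hmin⟩ := exists_firstTime (p := fun n => Exits μ p n ω)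
      ⟨h0, (commTime_ne_top_iff μ p s ω).2 ⟨t, hs⟩, h1⟩
    exact ⟨n, hn, by rwa [stat_eq_fusionLLR μ p hA hB h2 hmin (hns.trans hs)] at hp⟩

/-! ### The laws -/

theorem measurable_llrStep : Measurable (llrStep μ) := by
  have h : ∀ k, Measurable (llr (μ 1 k) (μ 0 k)) := fun k => measurable_llr _ _
  unfold llrStep
  refine Measurable.prodMk (measurable_pi_iff.2 fun k => ?_) measurable_snd
  have h2 : Measurable fun s : Step Y => s.1 k := (measurable_pi_apply k).comp measurable_fst
  exact ((h k).comp (measurable_fst.comp h2)).prodMk (measurable_snd.comp h2)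

theorem measurable_llrPath : Measurable (llrPath μ) :=
  measurable_pi_iff.2 fun t => (measurable_llrStep μ).comp (measurable_pi_apply t)

/-- The law of the log-likelihood ratio of an observation of SU `k` under `H_i`. -/
def llrLaw (i : Fin 2) (k : Fin K) : Measure ℝ := (μ i k).map (llr (μ 1 k) (μ 0 k))

variable [∀ i k, IsProbabilityMeasure (μ i k)] (ρ : Measure (Equiv.Perm (Fin K)))
  [IsProbabilityMeasure ρ]

instance (i : Fin 2) (k : Fin K) : IsProbabilityMeasure (llrLaw μ i k) :=
  Measure.isProbabilityMeasure_map (measurable_llr _ _).aemeasurable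

theorem map_llrStep (i : Fin 2) :
    ((Measure.pi fun k => (μ i k).prod (volume : Measure unitInterval)).prod ρ).map (llrStep μ) =
      stepLaw (llrLaw μ i) ρ := by
  have hl : ∀ k, Measurable (llr (μ 1 k) (μ 0 k)) := fun k => measurable_llr _ _
  have h1 : ∀ k, ((μ i k).prod (volume : Measure unitInterval)).map
      (Prod.map (llr (μ 1 k) (μ 0 k)) id) = (llrLaw μ i k).prod volume := by
    intro k
    rw [← Measure.map_prod_map _ _ (hl k) measurable_id, Measure.map_id]
    rfl
  have h2 : ∀ k, IsProbabilityMeasure (((μ i k).prod (volume : Measure unitInterval)).map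
      (Prod.map (llr (μ 1 k) (μ 0 k)) id)) := fun k => by rw [h1]; infer_instance
  have h3 : ∀ k, Measurable (Prod.map (llr (μ 1 k) (μ 0 k)) (id : unitInterval → unitInterval)) :=
    fun k => (hl k).prodMap measurable_id
  have e : llrStep μ = Prod.map (fun (y : (k : Fin K) → Y k × unitInterval) (k : Fin K) =>
      Prod.map (llr (μ 1 k) (μ 0 k)) id (y k)) id := rfl
  have h4 : Measurable (fun (y : (k : Fin K) → Y k × unitInterval) (k : Fin K) =>
      Prod.map (llr (μ 1 k) (μ 0 k)) (id : unitInterval → unitInterval) (y k)) :=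
    measurable_pi_iff.2 fun k => (h3 k).comp (measurable_pi_apply k)
  rw [e, ← Measure.map_prod_map _ _ h4 measurable_id, Measure.map_id,
    Measure.pi_map_pi fun k => (h3 k).aemeasurable]
  simp_rw [h1]
  rfl

theorem map_llrPath (i : Fin 2) :
    (law μ ρ i).map (llrPath μ) =
      Measure.infinitePi fun _ : ℕ => stepLaw (llrLaw μ i) ρ := by
  unfold law llrPath
  rw [Measure.infinitePi_map_pi (f := fun _ : ℕ => llrStep μ) _ fun _ => measurable_llrStep μ]
  simp_rw [map_llrStep]

theorem law_preimage (i : Fin 2) {S : Set (ℕ → LStep K)} (hS : MeasurableSet S) :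
    law μ ρ i (llrPath μ ⁻¹' S) = (Measure.infinitePi fun _ : ℕ => stepLaw (llrLaw μ i) ρ) S := by
  rw [← map_llrPath, Measure.map_apply (measurable_llrPath μ) hS]

theorem expTime_eq_tsum (i : Fin 2) {T : Path Y → ℕ∞} {G : ℕ → (ℕ → LStep K) → ℝ} {A B : ℝ}
    (hG : IsTest G A B) (hT : ∀ ω t, ¬ T ω ≤ (t : ℕ) ↔ llrPath μ ω ∈ alive G A B t) :
    expTime μ ρ i T =
      ∑' t, (Measure.infinitePi fun _ : ℕ => stepLaw (llrLaw μ i) ρ) (alive G A B t) := by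
  have e : ∀ t : ℕ, {ω | ¬ T ω ≤ t} = llrPath μ ⁻¹' alive G A B t := fun t =>
    Set.ext fun ω => hT ω t
  unfold expTime
  rw [lintegral_toENNReal_eq_tsum]
  · exact tsum_congr fun t => by rw [e, law_preimage μ ρ i (hG.measurableSet_alive t)]
  · exact fun t => by rw [e]; exact measurable_llrPath μ (hG.measurableSet_alive t)

end Bridge

/-! ### Symmetric laws and the exchange of the hypotheses -/

section SymmetricLaws

variable {K : ℕ} {m : Fin K → Measure ℝ}
  (ρ : Measure (Equiv.Perm (Fin K))) [IsProbabilityMeasure ρ]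

/-- The laws under `H_0` of symmetric log-likelihood ratios with laws `m k` under `H_1`. -/
def negLaw (m : Fin K → Measure ℝ) (k : Fin K) : Measure ℝ := (m k).map fun x => -x

theorem SymmLLR.isProbabilityMeasure_negLaw (hm : ∀ k, SymmLLR (m k)) (k : Fin K) :
    IsProbabilityMeasure (negLaw m k) := by
  have := (hm k).prob
  exact Measure.isProbabilityMeasure_map measurable_neg.aemeasurable

/-- Seeds and orders contribute no density, so the likelihood ratio of the enlarged time unit is
still that of the observations. Tests that use the seeds are thus covered by the Wald-Wolfowitz
theorem. -/
theorem stepLaw_negLaw_eq_withDensity (hm : ∀ k, SymmLLR (m k)) :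
    stepLaw (negLaw m) ρ =
      (stepLaw m ρ).withDensity fun e => ENNReal.ofReal (Real.exp (-stepSum e)) := by
  have hmp := fun k => (hm k).prob
  have hnp := SymmLLR.isProbabilityMeasure_negLaw hm
  have hd : Measurable fun x : ℝ => ENNReal.ofReal (Real.exp (-x)) := by fun_prop
  have h1 : ∀ k, (negLaw m k).prod (volume : Measure unitInterval) =
      ((m k).prod (volume : Measure unitInterval)).withDensity
        fun y => ENNReal.ofReal (Real.exp (-y.1)) := by
    intro k
    rw [negLaw, (hm k).symm, prod_withDensity_left hd]
  have h2 : ∀ k, IsProbabilityMeasure (((m k).prod (volume : Measure unitInterval)).withDensity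
        fun y => ENNReal.ofReal (Real.exp (-y.1))) := fun k => by rw [← h1]; infer_instance
  have hdk : Measurable fun y : Fin K → ℝ × unitInterval =>
      ∏ k, ENNReal.ofReal (Real.exp (-(y k).1)) := by fun_prop
  unfold stepLaw
  simp_rw [h1]
  rw [pi_withDensity _ fun k => by fun_prop, prod_withDensity_left hdk]
  congr 1
  funext e
  rw [stepSum, ← Finset.sum_neg_distrib, Real.exp_sum,
    ENNReal.ofReal_prod_of_nonneg fun k _ => (Real.exp_pos _).le]

theorem stepLaw_negLaw_eq_map (hm : ∀ k, SymmLLR (m k)) :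
    stepLaw (negLaw m) ρ = (stepLaw m ρ).map flipStep := by
  have hmp := fun k => (hm k).prob
  have hnp := SymmLLR.isProbabilityMeasure_negLaw hm
  have h3 : Measurable (Prod.map (fun x : ℝ => -x) (id : unitInterval → unitInterval)) :=
    measurable_neg.prodMap measurable_id
  have h1 : ∀ k, ((m k).prod (volume : Measure unitInterval)).map
      (Prod.map (fun x => -x) id) = (negLaw m k).prod volume := by
    intro k
    rw [← Measure.map_prod_map _ _ measurable_neg measurable_id, Measure.map_id]
    rfl
  have h2 : ∀ k, IsProbabilityMeasure (((m k).prod (volume : Measure unitInterval)).map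
      (Prod.map (fun x => -x) id)) := fun k => by rw [h1]; infer_instance
  have e : flipStep (K := K) = Prod.map (fun (y : Fin K → ℝ × unitInterval) (k : Fin K) =>
      Prod.map (fun x => -x) id (y k)) id := rfl
  have h4 : Measurable (fun (y : Fin K → ℝ × unitInterval) (k : Fin K) =>
      Prod.map (fun x : ℝ => -x) (id : unitInterval → unitInterval) (y k)) :=
    measurable_pi_iff.2 fun k => h3.comp (measurable_pi_apply k)
  rw [e]
  unfold stepLaw
  rw [← Measure.map_prod_map _ _ h4 measurable_id, Measure.map_id,
    Measure.pi_map_pi fun k => h3.aemeasurable]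
  simp_rw [h1]

/-- Exchanging the hypotheses along a path. -/
def flipPath (ω : ℕ → LStep K) : ℕ → LStep K := fun t => flipStep (ω t)

theorem measurable_flipPath : Measurable (flipPath (K := K)) :=
  measurable_pi_iff.2 fun t => measurable_flipStep.comp (measurable_pi_apply t)

theorem measure_negLaw (hm : ∀ k, SymmLLR (m k)) {S : Set (ℕ → LStep K)} (hS : MeasurableSet S) :
    (Measure.infinitePi fun _ : ℕ => stepLaw (negLaw m) ρ) S =
      (Measure.infinitePi fun _ : ℕ => stepLaw m ρ) (flipPath ⁻¹' S) := by
  have hmp := fun k => (hm k).prob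
  have hnp := SymmLLR.isProbabilityMeasure_negLaw hm
  rw [← Measure.map_apply measurable_flipPath hS]
  congr 1
  unfold flipPath
  rw [Measure.infinitePi_map_pi (f := fun _ : ℕ => flipStep) _ fun _ => measurable_flipStep]
  simp_rw [stepLaw_negLaw_eq_map ρ hm]

theorem stat_flipPath (p : RLTParams) (t : ℕ) (ω : ℕ → LStep K) :
    p.stat t (flipPath ω) = -p.flip.stat t ω :=
  p.flip.stat_flip t ω

theorem stepSum_flipStep (e : LStep K) : stepSum (flipStep e) = -stepSum e := by
  simp [stepSum, flipStep]

theorem frozenWalk_flipPath (A B : ℝ) (t : ℕ) (ω : ℕ → LStep K) :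
    frozenWalk stepSum A B t (flipPath ω) = -frozenWalk stepSum B A t ω := by
  induction t with
  | zero => simp [frozenWalk]
  | succ t ih =>
    have h := freeze_neg B A (frozenWalk stepSum B A t ω) (stepSum (ω t))
    rw [← stepSum_flipStep, ← ih] at h
    exact h

theorem neg_mem_Ioo_iff {A B y : ℝ} : -y ∈ Set.Ioo (-B) A ↔ y ∈ Set.Ioo (-A) B := by
  simp only [Set.mem_Ioo]
  constructor <;> rintro ⟨h1, h2⟩ <;> constructor <;> linarith

theorem preimage_alive {G G' : ℕ → (ℕ → LStep K) → ℝ} (h : ∀ t ω, G t (flipPath ω) = -G' t ω)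
    (A B : ℝ) (t : ℕ) : flipPath ⁻¹' alive G A B t = alive G' B A t := by
  ext ω
  simp only [alive, Set.mem_preimage, Set.mem_ofPred_eq, h, neg_mem_Ioo_iff]

theorem preimage_up {G G' : ℕ → (ℕ → LStep K) → ℝ} (h : ∀ t ω, G t (flipPath ω) = -G' t ω)
    (A : ℝ) : flipPath ⁻¹' {ω | ∃ t, A ≤ G t ω} = {ω | ∃ t, G' t ω ≤ -A} := by
  ext ω
  simp only [Set.mem_preimage, Set.mem_ofPred_eq, h, le_neg]

theorem IsTest.measurableSet_exists_up {E : Type*} [MeasurableSpace E] {G : ℕ → (ℕ → E) → ℝ}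
    {A B : ℝ} (hG : IsTest G A B) : MeasurableSet {ω | ∃ t, A ≤ G t ω} := by
  rw [Set.ofPred_exists]
  exact MeasurableSet.iUnion fun t => hG.measurableSet_up t

theorem IsTest.measurableSet_exists_down {E : Type*} [MeasurableSpace E] {G : ℕ → (ℕ → E) → ℝ}
    {A B : ℝ} (hG : IsTest G A B) : MeasurableSet {ω | ∃ t, G t ω ≤ -B} := by
  rw [Set.ofPred_exists]
  exact MeasurableSet.iUnion fun t => hG.measurableSet_down t

/-! ### The likelihood ratio of one time unit -/

theorem ae_abs_stepSum_le {φ : ℝ} (hm : ∀ k, SymmLLR (m k)) (hb : ∀ k, ∀ᵐ x ∂(m k), |x| ≤ φ) :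
    ∀ᵐ e ∂(stepLaw m ρ), |stepSum e| ≤ K * φ := by
  have hmp := fun k => (hm k).prob
  have h : ∀ᵐ e ∂(stepLaw m ρ), ∀ k, |(e.1 k).1| ≤ φ :=
    ae_all_iff.2 fun k => (measurePreserving_stepLaw m ρ k).quasiMeasurePreserving.ae (hb k)
  filter_upwards [h] with e he
  refine (Finset.abs_sum_le_sum_abs _ _).trans ?_
  have := Finset.sum_le_sum fun (k : Fin K) (_ : k ∈ Finset.univ) => he k
  rwa [Finset.sum_const, Finset.card_univ, Fintype.card_fin, nsmul_eq_mul] at this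

theorem integral_stepSum {φ : ℝ} [∀ k, IsProbabilityMeasure (m k)]
    (hb : ∀ k, ∀ᵐ x ∂(m k), |x| ≤ φ) : ∫ e, stepSum e ∂(stepLaw m ρ) = ∑ k, ∫ x, x ∂(m k) := by
  have hi : ∀ k, Integrable (fun e : LStep K => (e.1 k).1) (stepLaw m ρ) := fun k =>
    (measurePreserving_stepLaw m ρ k).integrable_comp_of_integrable (integrable_of_abs_le (hb k))
  unfold stepSum
  rw [integral_finsetSum _ fun k _ => hi k]
  refine Finset.sum_congr rfl fun k _ => ?_
  have mp := measurePreserving_stepLaw m ρ k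
  conv_rhs => rw [← mp.map_eq]
  exact (integral_map (f := fun x : ℝ => x) mp.measurable.aemeasurable
    measurable_id.aestronglyMeasurable).symm

/-- Mean one is the total mass of the law under `H_0`; nondegeneracy follows from the positive
drift, since a constant ratio `1` would make it vanish. -/
theorem isRatioLaw_stepLaw {φ : ℝ} (hm : ∀ k, SymmLLR (m k)) (hb : ∀ k, ∀ᵐ x ∂(m k), |x| ≤ φ)
    (hI : 0 < ∑ k, ∫ x, x ∂(m k)) :
    IsRatioLaw ((stepLaw m ρ).map fun e => Real.exp (-stepSum e)) := by
  have hmp := fun k => (hm k).prob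
  have hnp := SymmLLR.isProbabilityMeasure_negLaw hm
  have hx := measurable_stepSum (K := K)
  have hex : Measurable fun e : LStep K => Real.exp (-stepSum e) := hx.neg.exp
  refine ⟨Measure.isProbabilityMeasure_map hex.aemeasurable, ?_, ⟨Real.exp (K * φ), ?_⟩, ?_, ?_⟩
  · rw [ae_map_iff hex.aemeasurable measurableSet_Ioi]
    exact ae_of_all _ fun e => Real.exp_pos _
  · rw [ae_map_iff hex.aemeasurable measurableSet_Iic]
    filter_upwards [ae_abs_stepSum_le ρ hm hb] with e he
    exact Real.exp_le_exp.2 (by linarith [(abs_le.1 he).1])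
  · rw [integral_map (f := fun x : ℝ => x) hex.aemeasurable measurable_id.aestronglyMeasurable,
      integral_eq_lintegral_of_nonneg_ae (ae_of_all _ fun _ => (Real.exp_pos _).le)
      hex.aestronglyMeasurable]
    have h := congrArg (fun ν : Measure (LStep K) => ν Set.univ)
      (stepLaw_negLaw_eq_withDensity ρ hm)
    simp only [measure_univ, withDensity_apply _ MeasurableSet.univ, Measure.restrict_univ] at h
    rw [← h, ENNReal.toReal_one]
  · intro h
    replace h := (ae_map_iff (p := fun z : ℝ => z = 1) hex.aemeasurable
      (measurableSet_singleton (1 : ℝ))).1 h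
    have h0 : ∫ e, stepSum e ∂(stepLaw m ρ) = 0 := by
      refine integral_eq_zero_of_ae ?_
      filter_upwards [h] with e he
      have : -stepSum e = 0 := Real.exp_eq_one_iff _ |>.1 he
      simpa using this
    rw [integral_stepSum ρ hb] at h0
    exact hI.ne' h0

end SymmetricLaws

/-! ### Laws of the log-likelihood ratios and information numbers -/

section LLRLaws

variable {K : ℕ} {Y : Fin K → Type*} [∀ k, MeasurableSpace (Y k)]
  (μ : Fin 2 → (k : Fin K) → Measure (Y k)) [∀ i k, IsProbabilityMeasure (μ i k)]

theorem llrLaw_zero_eq_negLaw (hsymm : ∀ k, (μ 1 k).map (fun y => llr (μ 1 k) (μ 0 k) y) =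
      (μ 0 k).map (fun y => -llr (μ 1 k) (μ 0 k) y)) : llrLaw μ 0 = negLaw (llrLaw μ 1) := by
  funext k
  have hl := measurable_llr (μ 1 k) (μ 0 k)
  have h := hsymm k
  unfold negLaw llrLaw
  have h2 : Measurable fun y => -llr (μ 1 k) (μ 0 k) y := hl.neg
  rw [h, Measure.map_map measurable_neg h2]
  congr 1
  funext y
  simp

theorem llrLaw_zero_eq_withDensity (hac10 : ∀ k, μ 1 k ≪ μ 0 k) (hac01 : ∀ k, μ 0 k ≪ μ 1 k)
    (k : Fin K) :
    llrLaw μ 0 k = (llrLaw μ 1 k).withDensity fun x => ENNReal.ofReal (Real.exp (-x)) := by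
  have hl := measurable_llr (μ 1 k) (μ 0 k)
  have h0 : μ 0 k = (μ 1 k).withDensity
      fun y => ENNReal.ofReal (Real.exp (-llr (μ 1 k) (μ 0 k) y)) := by
    conv_lhs => rw [← Measure.withDensity_rnDeriv_eq _ _ (hac01 k)]
    refine withDensity_congr_ae ?_
    filter_upwards [exp_neg_llr (hac10 k), Measure.rnDeriv_lt_top (μ 0 k) (μ 1 k)] with y h1 h2
    rw [h1, ENNReal.ofReal_toReal h2.ne]
  refine Measure.ext_of_lintegral _ fun g hg => ?_
  unfold llrLaw
  have hd : Measurable fun x : ℝ => ENNReal.ofReal (Real.exp (-x)) := by fun_prop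
  rw [lintegral_map hg hl, lintegral_withDensity_eq_lintegral_mul _ hd hg,
    lintegral_map (hd.mul hg) hl]
  have h1 := lintegral_withDensity_eq_lintegral_mul (μ 1 k) (hd.comp hl) (hg.comp hl)
  have h2 : (μ 1 k).withDensity ((fun x : ℝ => ENNReal.ofReal (Real.exp (-x))) ∘
    llr (μ 1 k) (μ 0 k)) = μ 0 k := h0.symm
  rw [h2] at h1
  exact h1

theorem symmLLR_llrLaw (hac10 : ∀ k, μ 1 k ≪ μ 0 k) (hac01 : ∀ k, μ 0 k ≪ μ 1 k)
    (hsymm : ∀ k, (μ 1 k).map (fun y => llr (μ 1 k) (μ 0 k) y) =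
      (μ 0 k).map (fun y => -llr (μ 1 k) (μ 0 k) y)) (k : Fin K) : SymmLLR (llrLaw μ 1 k) where
  prob := inferInstance
  symm := by
    rw [← llrLaw_zero_eq_withDensity μ hac10 hac01 k, llrLaw_zero_eq_negLaw μ hsymm]
    rfl

theorem ae_llrLaw_abs_lt (hac10 : ∀ k, μ 1 k ≪ μ 0 k) {φ : ℝ}
    (hφ : ∀ k, ∀ᵐ y ∂(μ 0 k), |llr (μ 1 k) (μ 0 k) y| < φ) (k : Fin K) :
    ∀ᵐ x ∂(llrLaw μ 1 k), |x| < φ := by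
  exact (ae_map_iff (p := fun x : ℝ => |x| < φ) (measurable_llr _ _).aemeasurable
    (measurableSet_lt measurable_norm measurable_const)).2 ((hac10 k).ae_le (hφ k))

/-- The Kullback-Leibler divergence of a symmetric log-likelihood ratio. -/
theorem SymmLLR.integral_nonneg {m : Measure ℝ} (hm : SymmLLR m) {φ : ℝ}
    (hb : ∀ᵐ x ∂m, |x| ≤ φ) : 0 ≤ ∫ x, x ∂m ∧ (∫ x, x ∂m = 0 → ∀ᵐ x ∂m, x = 0) := by
  have := hm.prob
  have h1 := integrable_of_abs_le hb
  have h2 : Integrable (fun x : ℝ => x - (1 - Real.exp (-x))) m :=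
    h1.sub ((integrable_const 1).sub hm.integrable_exp_neg)
  -- The subtracted term has mean zero and makes the integrand nonnegative, with a zero only at `x =
  -- 0`.
  have e : ∫ x, (x - (1 - Real.exp (-x))) ∂m = ∫ x, x ∂m := by
    have h3 : Integrable (fun x : ℝ => 1 - Real.exp (-x)) m :=
      (integrable_const 1).sub hm.integrable_exp_neg
    rw [integral_sub h1 h3,
      integral_sub (integrable_const 1) hm.integrable_exp_neg, hm.integral_exp_neg]
    simp
  have h0 : ∀ x : ℝ, 0 ≤ x - (1 - Real.exp (-x)) := fun x => by
    linarith [Real.add_one_le_exp (-x)]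
  rw [← e]
  refine ⟨MeasureTheory.integral_nonneg h0, fun h => ?_⟩
  rw [integral_eq_zero_iff_of_nonneg h0 h2] at h
  filter_upwards [h] with x hx
  by_contra hne
  have := Real.add_one_lt_exp (neg_ne_zero.2 hne)
  simp only [Pi.zero_apply] at hx
  linarith

/-- A vanishing divergence makes the log-likelihood ratio zero almost everywhere, hence the two laws
equal. -/
theorem sum_integral_llrLaw_pos (hac10 : ∀ k, μ 1 k ≪ μ 0 k) (hac01 : ∀ k, μ 0 k ≪ μ 1 k)
    (hne : ∃ k, μ 0 k ≠ μ 1 k) {φ : ℝ} (hφ : ∀ k, ∀ᵐ y ∂(μ 0 k), |llr (μ 1 k) (μ 0 k) y| < φ)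
    (hsymm : ∀ k, (μ 1 k).map (fun y => llr (μ 1 k) (μ 0 k) y) =
      (μ 0 k).map (fun y => -llr (μ 1 k) (μ 0 k) y)) :
    0 < ∑ k, ∫ x, x ∂(llrLaw μ 1 k) := by
  have hm := symmLLR_llrLaw μ hac10 hac01 hsymm
  have hb : ∀ k, ∀ᵐ x ∂(llrLaw μ 1 k), |x| ≤ φ := fun k =>
    (ae_llrLaw_abs_lt μ hac10 hφ k).mono fun x hx => hx.le
  refine Finset.sum_pos' (fun k _ => ((hm k).integral_nonneg (hb k)).1) ?_
  obtain ⟨k, hk⟩ := hne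
  refine ⟨k, Finset.mem_univ k, lt_of_le_of_ne ((hm k).integral_nonneg (hb k)).1 fun h => hk ?_⟩
  have h0 := ((hm k).integral_nonneg (hb k)).2 h.symm
  have hl := measurable_llr (μ 1 k) (μ 0 k)
  replace h0 := (ae_map_iff (p := fun x : ℝ => x = 0) hl.aemeasurable
    (measurableSet_singleton (0 : ℝ))).1 h0
  rw [← Measure.withDensity_rnDeriv_eq _ _ (hac01 k)]
  conv_rhs => rw [← withDensity_one (μ := μ 1 k)]
  refine withDensity_congr_ae ?_
  filter_upwards [exp_neg_llr (hac10 k), Measure.rnDeriv_lt_top (μ 0 k) (μ 1 k), h0]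
    with y h1 h2 h3
  rw [h3, neg_zero, Real.exp_zero] at h1
  rw [← ENNReal.ofReal_toReal h2.ne, ← h1, ENNReal.ofReal_one]
  rfl

theorem infoNumber_eq (ρ : Measure (Equiv.Perm (Fin K))) [IsProbabilityMeasure ρ] {φ : ℝ}
    (i : Fin 2) (hb : ∀ k, ∀ᵐ x ∂(llrLaw μ i k), |x| ≤ φ) :
    infoNumber μ ρ i = |∑ k, ∫ x, x ∂(llrLaw μ i k)| / K := by
  unfold infoNumber
  congr 2
  have e : ∀ ω : Path Y, globalLLR μ 1 ω = stepSum (llrPath μ ω 0) := by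
    intro ω
    rw [globalLLR_eq_walk]
    simp [walk]
  simp_rw [e]
  have hg : Measurable fun ω : ℕ → LStep K => stepSum (ω 0) :=
    measurable_stepSum.comp (measurable_pi_apply 0)
  have h1 := integral_map (μ := law μ ρ i) (measurable_llrPath μ).aemeasurable
    (f := fun ω : ℕ → LStep K => stepSum (ω 0)) hg.aestronglyMeasurable
  rw [map_llrPath] at h1
  rw [← h1, ← integral_stepSum ρ hb]
  have mp := measurePreserving_eval_infinitePi (fun _ : ℕ => stepLaw (llrLaw μ i) ρ) 0
  conv_rhs => rw [← mp.map_eq]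
  rw [integral_map mp.measurable.aemeasurable measurable_stepSum.aestronglyMeasurable]

end LLRLaws

/-! ### The small parameter and the remainder terms -/

section Parameters

/-- The quantization step relative to the mean increment `Δ tanh (Δ / 2)` of a message. -/
def relStep (φ Δ : ℝ) (r : ℕ) : ℝ := φ / max (r : ℝ) 1 / (Δ * Real.tanh (Δ / 2))

theorem relStep_nonneg {φ Δ : ℝ} (hφ : 0 < φ) (hΔ : 0 < Δ) (r : ℕ) : 0 ≤ relStep φ Δ r := by
  have := tanh_half_pos hΔ
  unfold relStep
  positivity

theorem relStep_mul {φ Δ : ℝ} (hΔ : 0 < Δ) (r : ℕ) :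
    relStep φ Δ r * (Δ * Real.tanh (Δ / 2)) = φ / max (r : ℝ) 1 :=
  div_mul_cancel₀ _ (mul_pos hΔ (tanh_half_pos hΔ)).ne'

/-- The constant in the bound for `relStep`. -/
def relStepConst (φ Δ₀ : ℝ) : ℝ := φ / (Real.tanh (Δ₀ / 2) * min 1 Δ₀)

theorem tanh_mono {x y : ℝ} (hxy : x ≤ y) : Real.tanh x ≤ Real.tanh y := by
  rw [Real.tanh_eq_sinh_div_cosh, Real.tanh_eq_sinh_div_cosh,
    div_le_div_iff₀ (Real.cosh_pos _) (Real.cosh_pos _)]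
  have h := Real.sinh_nonneg_iff.2 (sub_nonneg.2 hxy)
  rw [Real.sinh_sub] at h
  linarith

/-- The product `Δ max r 1` dominates the larger of `Δ` and `r` up to the factor `min 1 Δ₀`, and
`tanh` is bounded below by its value at `Δ₀ / 2`. -/
theorem relStep_le {φ Δ₀ Δ : ℝ} (hφ : 0 < φ) (hΔ₀ : 0 < Δ₀) (hΔ : Δ₀ ≤ Δ) (r : ℕ) :
    relStep φ Δ r ≤ relStepConst φ Δ₀ / max Δ r := by
  have hΔp := hΔ₀.trans_le hΔ
  have h1 : Real.tanh (Δ₀ / 2) ≤ Real.tanh (Δ / 2) := tanh_mono (by linarith)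
  have ht := tanh_half_pos hΔ₀
  have hmin : 0 < min 1 Δ₀ := lt_min one_pos hΔ₀
  have hmax : 0 < max Δ (r : ℝ) := lt_max_of_lt_left hΔp
  have h2 : min 1 Δ₀ * max Δ r ≤ Δ * max (r : ℝ) 1 := by
    have hr : (r : ℝ) ≤ max (r : ℝ) 1 := le_max_left _ _
    have h1r : (1 : ℝ) ≤ max (r : ℝ) 1 := le_max_right _ _
    have hr0 : (0 : ℝ) ≤ r := Nat.cast_nonneg r
    rcases max_cases Δ (r : ℝ) with ⟨h, -⟩ | ⟨h, -⟩ <;> rw [h]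
    · exact (mul_le_of_le_one_left hΔp.le (min_le_left _ _)).trans
        (le_mul_of_one_le_right hΔp.le h1r)
    · exact mul_le_mul ((min_le_right _ _).trans hΔ) hr hr0 hΔp.le
  have ht' := (tanh_half_pos hΔp).le
  unfold relStep relStepConst
  rw [div_div, div_div]
  refine div_le_div_of_nonneg_left hφ.le (by positivity) ?_
  calc Real.tanh (Δ₀ / 2) * min 1 Δ₀ * max Δ r = Real.tanh (Δ₀ / 2) * (min 1 Δ₀ * max Δ r) := by
        ring
    _ ≤ Real.tanh (Δ / 2) * (Δ * max (r : ℝ) 1) := by gcongr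
    _ = _ := by ring

theorem tendsto_relStep {φ Δ₀ : ℝ} (hφ : 0 < φ) (hΔ₀ : 0 < Δ₀) :
    Tendsto (fun q : ℝ × ℕ => relStep φ q.1 q.2) (largeParams Δ₀) (𝓝 0) := by
  have h1 : Tendsto (fun q : ℝ × ℕ => max q.1 (q.2 : ℝ)) (largeParams Δ₀) atTop :=
    tendsto_comap.mono_left inf_le_left
  have h2 : ∀ᶠ q : ℝ × ℕ in largeParams Δ₀, Δ₀ ≤ q.1 :=
    mem_inf_of_right (mem_principal_self _)
  refine tendsto_of_tendsto_of_tendsto_of_le_of_le' tendsto_const_nhds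
    (h1.const_div_atTop (relStepConst φ Δ₀)) ?_ ?_
  · filter_upwards [h2] with q hq using relStep_nonneg hφ (hΔ₀.trans_le hq) q.2
  · filter_upwards [h2] with q hq using relStep_le hφ hΔ₀ hq q.2

theorem relStep_le_quarter {φ Δ₀ Δ : ℝ} (hφ : 0 < φ) (hΔ₀ : 0 < Δ₀) (hΔ : Δ₀ ≤ Δ) {r : ℕ}
    (hR : 4 * relStepConst φ Δ₀ ≤ max Δ r) : relStep φ Δ r ≤ 1 / 4 := by
  refine (relStep_le hφ hΔ₀ hΔ r).trans ?_
  have hmax : 0 < max Δ (r : ℝ) := lt_max_of_lt_left (hΔ₀.trans_le hΔ)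
  rw [div_le_iff₀ hmax]
  linarith

/-- Keeps the boundary term of the potential free of `Δ`, so that `e₂` vanishes also when `Δ` tends
to infinity. -/
theorem mul_one_sub_tanh_le {Δ : ℝ} (hΔ : 0 < Δ) : Δ - Δ * Real.tanh (Δ / 2) ≤ 2 := by
  have hs : Δ ≤ Real.sinh Δ := Real.self_le_sinh_iff.2 hΔ.le
  have h1 := tanh_half_mul_sinh Δ
  have h2 := Real.cosh_sub_sinh Δ
  have h3 : (1 - Real.tanh (Δ / 2)) * Real.sinh Δ ≤ 1 := by
    have := Real.exp_pos (-Δ)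
    linarith
  have h4 := (Real.tanh_lt_one (Δ / 2)).le
  nlinarith

/-- The remainder of the bound that vanishes with the error probabilities. -/
def smallErrorTerm (C I x : ℝ) : ℝ := C * x * (2 * |Real.log x| + 1 + |Real.log C|) / I

theorem tendsto_smallErrorTerm (C I : ℝ) :
    Tendsto (smallErrorTerm C I) (𝓝[>] 0) (𝓝 0) := by
  have h1 : Tendsto (fun x : ℝ => x * Real.log x) (𝓝[>] 0) (𝓝 0) := by
    have := Real.continuous_mul_log.tendsto 0
    simp only [zero_mul] at this
    exact this.mono_left nhdsWithin_le_nhds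
  have h2 : Tendsto (fun x : ℝ => x) (𝓝[>] 0) (𝓝 0) := nhdsWithin_le_nhds
  have h3 := ((h1.abs.const_mul (2 * C)).add (h2.const_mul (C * (1 + |Real.log C|)))).div_const I
  simp only [abs_zero, mul_zero, add_zero, zero_div] at h3
  refine h3.congr' ?_
  filter_upwards [self_mem_nhdsWithin] with x hx
  have hx : 0 < x := hx
  rw [abs_mul, abs_of_pos hx, smallErrorTerm]
  ring

/-- The left side is `1 / ((1 - δ) (1 - 2 δ ^ 2)) = 1 + δ + 3 δ ^ 2 + …`. The constant `8` leaves
room for all `δ ≤ 1 / 4` and is the source of `e₁`. -/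
theorem threshold_factor_le {δ : ℝ} (h0 : 0 ≤ δ) (h1 : δ ≤ 1 / 4) :
    (1 + δ / (1 - δ)) / (1 - 2 * δ ^ 2) ≤ 1 + δ * (1 + 8 * δ) := by
  have h2 : 0 < 1 - δ := by linarith
  have h3 : 0 < 1 - 2 * δ ^ 2 := by nlinarith
  have e : 1 + δ / (1 - δ) = 1 / (1 - δ) := by field_simp; ring
  rw [e, div_div, div_le_iff₀ (mul_pos h2 h3)]
  have h4 : δ ^ 2 ≤ 1 / 16 := by nlinarith
  have h5 : 0 ≤ 5 - 8 * δ - 14 * δ ^ 2 + 16 * δ ^ 3 := by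
    have := pow_nonneg h0 3
    linarith
  have := mul_nonneg (sq_nonneg δ) h5
  nlinarith

/-- The terms of Wald's bound that involve `β` are expressed by `α`, the only place where comparable
error probabilities are needed. -/
theorem rate_bound {α β C : ℝ} (hα : α ∈ Set.Ioo (0 : ℝ) 1) (hβ : β ∈ Set.Ioo (0 : ℝ) 1)
    (hαβ : α ≤ C * β) (hβα : β ≤ C * α) :
    β * |Real.log α| + β - β * Real.log β ≤ C * α * (2 * |Real.log α| + 1 + |Real.log C|) := by
  have hC : 0 < C := by
    by_contra h
    have := mul_nonpos_of_nonpos_of_nonneg (not_lt.1 h) hβ.1.le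
    linarith [hα.1]
  have h1 : Real.log α ≤ Real.log C + Real.log β := by
    rw [← Real.log_mul hC.ne' hβ.1.ne']
    exact Real.log_le_log hα.1 hαβ
  have h2 : |Real.log α| = -Real.log α := abs_of_neg (Real.log_neg hα.1 hα.2)
  have h3 := le_abs_self (Real.log C)
  have h4 : 0 ≤ 2 * |Real.log α| + 1 + |Real.log C| := by positivity
  calc β * |Real.log α| + β - β * Real.log β = β * (|Real.log α| + 1 - Real.log β) := by ring
    _ ≤ β * (2 * |Real.log α| + 1 + |Real.log C|) :=
      mul_le_mul_of_nonneg_left (by linarith) hβ.1.le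
    _ ≤ _ := mul_le_mul_of_nonneg_right hβα h4

end Parameters

/-! ### Comparison of the two tests under `H_1` -/

section Comparison

variable {K : ℕ} {p : RLTParams} {m : Fin K → Measure ℝ}

/-- The expected number of time units under `H_1` until a test stops. -/
def meanTime (m : Fin K → Measure ℝ) (ρ : Measure (Equiv.Perm (Fin K)))
    (G : ℕ → (ℕ → LStep K) → ℝ) (A B : ℝ) : ℝ≥0∞ :=
  ∑' t, (Measure.infinitePi fun _ : ℕ => stepLaw m ρ) (alive G A B t)

theorem meanTime_negLaw (hm : ∀ k, SymmLLR (m k)) (ρ : Measure (Equiv.Perm (Fin K)))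
    [IsProbabilityMeasure ρ] {G G' : ℕ → (ℕ → LStep K) → ℝ}
    (h : ∀ t ω, G t (flipPath ω) = -G' t ω) {A B : ℝ} (hG : IsTest G A B) :
    meanTime (negLaw m) ρ G A B = meanTime m ρ G' B A :=
  tsum_congr fun t => by
    rw [measure_negLaw ρ hm (hG.measurableSet_alive t), preimage_alive h]

theorem RLTParams.meanTime_le (hφ : 0 < p.φ) (hΔ : 0 < p.Δ) (hA : 0 < p.A) (hB : 0 < p.B)
    (hδ : relStep p.φ p.Δ p.r ≤ 1 / 4) (hm : ∀ k, SymmLLR (m k))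
    (hb : ∀ k, ∀ᵐ x ∂(m k), |x| ≤ p.φ) (ρ : Measure (Equiv.Perm (Fin K)))
    [IsProbabilityMeasure ρ] (hI : 0 < ∑ k, ∫ x, x ∂(m k)) :
    meanTime m ρ p.stat p.A p.B ≤ ENNReal.ofReal (p.potentialBound K
      (relStep p.φ p.Δ p.r / (1 - relStep p.φ p.Δ p.r)) / ∑ k, ∫ x, x ∂(m k)) := by
  have hδ0 := relStep_nonneg hφ hΔ p.r
  refine RLTParams.tsum_alive_le hφ hΔ hA hB (div_nonneg hδ0 (by linarith)) ?_ hm hb ρ hI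
  rw [← relStep_mul hΔ p.r]
  have : 1 - relStep p.φ p.Δ p.r ≠ 0 := by linarith
  field_simp
  ring

/-- After exchanging the hypotheses, `α` is the probability of a downward exit under `H_1`; the
exponential error bound is then solved for the threshold. -/
theorem RLTParams.threshold_le (hφ : 0 < p.φ) (hΔ : 0 < p.Δ) (hA : 0 < p.A) (hB : 0 < p.B)
    (hδ : relStep p.φ p.Δ p.r ≤ 1 / 4) (hm : ∀ k, SymmLLR (m k))
    (ρ : Measure (Equiv.Perm (Fin K))) [IsProbabilityMeasure ρ] {α : ℝ}
    (hα : α ∈ Set.Ioo (0 : ℝ) 1)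
    (hup : (Measure.infinitePi fun _ : ℕ => stepLaw (negLaw m) ρ) {ω | ∃ t, p.A ≤ p.stat t ω} =
      ENNReal.ofReal α) :
    p.A ≤ |Real.log α| / (1 - 2 * relStep p.φ p.Δ p.r ^ 2) := by
  have hδ0 := relStep_nonneg hφ hΔ p.r
  set δ := relStep p.φ p.Δ p.r
  have hT := p.isTest_stat (K := K) hA hB
  have hε : p.φ / max (p.r : ℝ) 1 ≤ δ * p.Δ := by
    rw [← relStep_mul hΔ p.r]
    exact mul_le_mul_of_nonneg_left (mul_le_of_le_one_right hΔ.le (Real.tanh_lt_one _).le) hδ0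
  rw [measure_negLaw ρ hm hT.measurableSet_exists_up, preimage_up (stat_flipPath p)] at hup
  have h := RLTParams.measure_down_le (p := p.flip) hφ hΔ hB hA hδ hδ0 hε hm ρ
  have h2 : ENNReal.ofReal α ≤ ENNReal.ofReal (Real.exp (-((1 - 2 * δ ^ 2) * p.A))) :=
    hup ▸ h
  rw [ENNReal.ofReal_le_ofReal_iff (Real.exp_pos _).le] at h2
  have h3 := Real.log_le_log hα.1 h2
  rw [Real.log_exp] at h3
  have h4 : 0 < 1 - 2 * δ ^ 2 := by nlinarith
  rw [le_div_iff₀ h4, abs_of_neg (Real.log_neg hα.1 hα.2)]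
  linarith

/-- The comparison of the RLT-SPRT with the SPRT under `H_1`. -/
theorem RLTParams.meanTime_sub_le (hφ : 0 < p.φ) (hΔ : 0 < p.Δ) (hpA : 0 < p.A) (hpB : 0 < p.B)
    (hδ : relStep p.φ p.Δ p.r ≤ 1 / 4) (hm : ∀ k, SymmLLR (m k))
    (hb : ∀ k, ∀ᵐ x ∂(m k), |x| ≤ p.φ) (ρ : Measure (Equiv.Perm (Fin K)))
    [IsProbabilityMeasure ρ] (hI : 0 < ∑ k, ∫ x, x ∂(m k)) {A B α β C : ℝ} (hA : 0 < A)
    (hB : 0 < B) (hα : α ∈ Set.Ioo (0 : ℝ) 1) (hβ : β ∈ Set.Ioo (0 : ℝ) 1) (hαβ : α ≤ C * β)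
    (hβα : β ≤ C * α)
    (hup : (Measure.infinitePi fun _ : ℕ => stepLaw (negLaw m) ρ)
      {ω | ∃ t, A ≤ frozenWalk stepSum A B t ω} = ENNReal.ofReal α)
    (hdown : (Measure.infinitePi fun _ : ℕ => stepLaw m ρ)
      {ω | ∃ t, frozenWalk stepSum A B t ω ≤ -B} = ENNReal.ofReal β)
    (hup' : (Measure.infinitePi fun _ : ℕ => stepLaw (negLaw m) ρ) {ω | ∃ t, p.A ≤ p.stat t ω} =
      ENNReal.ofReal α)
    (hfin : meanTime m ρ (frozenWalk stepSum A B) A B ≠ ⊤) :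
    (meanTime m ρ p.stat p.A p.B).toReal -
        (meanTime m ρ (frozenWalk stepSum A B) A B).toReal ≤
      |Real.log α| * relStep p.φ p.Δ p.r * (1 + 8 * relStep p.φ p.Δ p.r) /
          (∑ k, ∫ x, x ∂(m k)) +
        K * (p.Δ + p.φ) / (∑ k, ∫ x, x ∂(m k)) +
        2 * relStep p.φ p.Δ p.r * K * (p.φ + 2) / (∑ k, ∫ x, x ∂(m k)) +
        smallErrorTerm C (∑ k, ∫ x, x ∂(m k)) α := by
  have hmp := fun k => (hm k).prob
  have hnp := SymmLLR.isProbabilityMeasure_negLaw hm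
  have hδ0 := relStep_nonneg hφ hΔ p.r
  have hle := p.meanTime_le hφ hΔ hpA hpB hδ hm hb ρ hI
  have hth := p.threshold_le hφ hΔ hpA hpB hδ hm ρ hα hup'
  have hsprt := expected_sprt_ge measurable_stepSum (stepLaw_negLaw_eq_withDensity ρ hm)
    (ae_abs_stepSum_le ρ hm hb) hA hB hα.1 hα.2 hβ.1
    (by rw [integral_stepSum ρ hb]; exact hI.le) hup hdown hfin
  rw [integral_stepSum ρ hb] at hsprt
  change _ ≤ _ * (meanTime m ρ (frozenWalk stepSum A B) A B).toReal at hsprt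
  have hrate := rate_bound hα hβ hαβ hβα
  have hfac := threshold_factor_le hδ0 hδ
  have htanh := mul_one_sub_tanh_le hΔ
  set δ := relStep p.φ p.Δ p.r
  set I := ∑ k, ∫ x, x ∂(m k)
  set a := |Real.log α|
  set S := (meanTime m ρ (frozenWalk stepSum A B) A B).toReal
  have ha : 0 ≤ a := abs_nonneg _
  have h1δ : 0 < 1 - δ := by linarith
  have hc0 : 0 ≤ δ / (1 - δ) := div_nonneg hδ0 h1δ.le
  have hc2 : δ / (1 - δ) ≤ 2 * δ := by
    rw [div_le_iff₀ h1δ]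
    nlinarith
  have hU0 : 0 ≤ p.potentialBound K (δ / (1 - δ)) := by
    have : p.Δ * Real.tanh (p.Δ / 2) ≤ p.Δ := mul_le_of_le_one_right hΔ.le (Real.tanh_lt_one _).le
    have : 0 ≤ p.Δ + p.φ - p.Δ * Real.tanh (p.Δ / 2) := by linarith
    unfold potentialBound
    positivity
  have hT : (meanTime m ρ p.stat p.A p.B).toReal ≤ p.potentialBound K (δ / (1 - δ)) / I :=
    ENNReal.toReal_le_of_le_ofReal (div_nonneg hU0 hI.le) hle
  have hU : p.potentialBound K (δ / (1 - δ)) ≤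
      a * (1 + δ * (1 + 8 * δ)) + K * (p.Δ + p.φ) + 2 * δ * K * (p.φ + 2) := by
    have h1 : (1 + δ / (1 - δ)) * p.A ≤ a * (1 + δ * (1 + 8 * δ)) := by
      calc (1 + δ / (1 - δ)) * p.A ≤ (1 + δ / (1 - δ)) * (a / (1 - 2 * δ ^ 2)) :=
            mul_le_mul_of_nonneg_left hth (by linarith)
        _ = a * ((1 + δ / (1 - δ)) / (1 - 2 * δ ^ 2)) := by ring
        _ ≤ _ := mul_le_mul_of_nonneg_left hfac ha
    -- The correction part of the boundary term. It vanishes with `δ` and becomes `e₂`, while `K (Δ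
    -- + φ)` remains as the constant term.
    have h2 : δ / (1 - δ) * (p.Δ + p.φ - p.Δ * Real.tanh (p.Δ / 2)) ≤ 2 * δ * (p.φ + 2) := by
      calc _ ≤ δ / (1 - δ) * (p.φ + 2) := mul_le_mul_of_nonneg_left (by linarith) hc0
        _ ≤ _ := mul_le_mul_of_nonneg_right hc2 (by linarith)
    have h3 := mul_le_mul_of_nonneg_left h2 (Nat.cast_nonneg (α := ℝ) K)
    unfold potentialBound
    linarith
  have hS : (a - β * a - β + β * Real.log β) / I ≤ S := by
    rw [div_le_iff₀ hI]; linarith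
  calc _ ≤ (a * (1 + δ * (1 + 8 * δ)) + K * (p.Δ + p.φ) + 2 * δ * K * (p.φ + 2)) / I -
        (a - β * a - β + β * Real.log β) / I :=
        sub_le_sub (hT.trans (div_le_div_of_nonneg_right hU hI.le)) hS
    _ = a * δ * (1 + 8 * δ) / I + K * (p.Δ + p.φ) / I + 2 * δ * K * (p.φ + 2) / I +
        (β * a + β - β * Real.log β) / I := by ring
    _ ≤ _ := by
      unfold smallErrorTerm
      have := div_le_div_of_nonneg_right hrate hI.le
      linarith

end Comparison

/-! ### Assembly -/

section Main

variable {K : ℕ} {Y : Fin K → Type*} [∀ k, MeasurableSpace (Y k)]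
  (μ : Fin 2 → (k : Fin K) → Measure (Y k)) [∀ i k, IsProbabilityMeasure (μ i k)]
  (ρ : Measure (Equiv.Perm (Fin K))) [IsProbabilityMeasure ρ]

theorem infoNumber_llr_one {φ : ℝ} (hb : ∀ k, ∀ᵐ x ∂(llrLaw μ 1 k), |x| ≤ φ)
    (hI : 0 < ∑ k, ∫ x, x ∂(llrLaw μ 1 k)) :
    infoNumber μ ρ 1 = (∑ k, ∫ x, x ∂(llrLaw μ 1 k)) / K := by
  rw [infoNumber_eq μ ρ 1 hb, abs_of_pos hI]

theorem infoNumber_llr_zero (hsymm : ∀ k, (μ 1 k).map (fun y => llr (μ 1 k) (μ 0 k) y) =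
      (μ 0 k).map (fun y => -llr (μ 1 k) (μ 0 k) y)) {φ : ℝ}
    (hb : ∀ k, ∀ᵐ x ∂(llrLaw μ 1 k), |x| ≤ φ) (hI : 0 < ∑ k, ∫ x, x ∂(llrLaw μ 1 k)) :
    infoNumber μ ρ 0 = (∑ k, ∫ x, x ∂(llrLaw μ 1 k)) / K := by
  have h := llrLaw_zero_eq_negLaw μ hsymm
  have hb0 : ∀ k, ∀ᵐ x ∂(llrLaw μ 0 k), |x| ≤ φ := by
    intro k
    rw [h]
    refine (ae_map_iff (p := fun x : ℝ => |x| ≤ φ) measurable_neg.aemeasurable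
      (measurableSet_le measurable_norm measurable_const)).2 ?_
    simpa using hb k
  have e : ∀ k, ∫ x, x ∂(llrLaw μ 0 k) = -∫ x, x ∂(llrLaw μ 1 k) := by
    intro k
    rw [h, negLaw, integral_map (f := fun x : ℝ => x) measurable_neg.aemeasurable
      measurable_id.aestronglyMeasurable, integral_neg]
  rw [infoNumber_eq μ ρ 0 hb0]
  simp_rw [e]
  rw [Finset.sum_neg_distrib, abs_neg, abs_of_pos hI]

theorem law_sprtDecides1 (i : Fin 2) {A B : ℝ} (hA : 0 < A) (hB : 0 < B) :
    law μ ρ i (sprtDecides1 μ A B) = (Measure.infinitePi fun _ : ℕ => stepLaw (llrLaw μ i) ρ)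
      {ω | ∃ t, A ≤ frozenWalk stepSum A B t ω} := by
  have hS := isTest_frozenWalk (measurable_stepSum (K := K)) hA hB
  rw [← law_preimage μ ρ i hS.measurableSet_exists_up]
  congr 1
  ext ω
  exact sprtDecides_iff μ hA hB (P := fun y => A ≤ y) (fun y hy h => absurd h.2 (not_lt.2 hy)) ω

theorem law_sprtDecides0 (i : Fin 2) {A B : ℝ} (hA : 0 < A) (hB : 0 < B) :
    law μ ρ i (sprtDecides0 μ A B) = (Measure.infinitePi fun _ : ℕ => stepLaw (llrLaw μ i) ρ)
      {ω | ∃ t, frozenWalk stepSum A B t ω ≤ -B} := by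
  have hS := isTest_frozenWalk (measurable_stepSum (K := K)) hA hB
  rw [← law_preimage μ ρ i hS.measurableSet_exists_down]
  congr 1
  ext ω
  exact sprtDecides_iff μ hA hB (P := fun y => y ≤ -B) (fun y hy h => absurd h.1 (not_lt.2 hy)) ω

theorem law_rltDecides1 (p : RLTParams) (i : Fin 2) (hA : 0 < p.A) (hB : 0 < p.B) :
    law μ ρ i (rltDecides1 μ p.φ p.Δ p.r p.A p.B) =
      (Measure.infinitePi fun _ : ℕ => stepLaw (llrLaw μ i) ρ) {ω | ∃ t, p.A ≤ p.stat t ω} := by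
  rw [← law_preimage μ ρ i (p.isTest_stat (K := K) hA hB).measurableSet_exists_up]
  congr 1
  ext ω
  exact rltDecides_iff μ p hA hB (P := fun y => p.A ≤ y)
    (fun y hy h => absurd h.2 (not_lt.2 hy)) ω

theorem law_rltDecides0 (p : RLTParams) (i : Fin 2) (hA : 0 < p.A) (hB : 0 < p.B) :
    law μ ρ i (rltDecides0 μ p.φ p.Δ p.r p.A p.B) =
      (Measure.infinitePi fun _ : ℕ => stepLaw (llrLaw μ i) ρ) {ω | ∃ t, p.stat t ω ≤ -p.B} := by
  rw [← law_preimage μ ρ i (p.isTest_stat (K := K) hA hB).measurableSet_exists_down]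
  congr 1
  ext ω
  exact rltDecides_iff μ p hA hB (P := fun y => y ≤ -p.B)
    (fun y hy h => absurd h.1 (not_lt.2 hy)) ω

variable {p : RLTParams}

/-- The comparison of the RLT-SPRT with the centralized SPRT under both hypotheses. -/
theorem expTime_comparison (hac10 : ∀ k, μ 1 k ≪ μ 0 k) (hac01 : ∀ k, μ 0 k ≪ μ 1 k)
    (hsymm : ∀ k, (μ 1 k).map (fun y => llr (μ 1 k) (μ 0 k) y) =
      (μ 0 k).map (fun y => -llr (μ 1 k) (μ 0 k) y))
    (hφ : 0 < p.φ) (hΔ : 0 < p.Δ) (hpA : 0 < p.A) (hpB : 0 < p.B)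
    (hδ : relStep p.φ p.Δ p.r ≤ 1 / 4) (hb : ∀ k, ∀ᵐ x ∂(llrLaw μ 1 k), |x| ≤ p.φ)
    (hI : 0 < ∑ k, ∫ x, x ∂(llrLaw μ 1 k)) {A B α β C : ℝ} (hA : 0 < A)
    (hB : 0 < B) (hα : α ∈ Set.Ioo (0 : ℝ) 1) (hβ : β ∈ Set.Ioo (0 : ℝ) 1) (hαβ : α ≤ C * β)
    (hβα : β ≤ C * α)
    (h1 : law μ ρ 0 (sprtDecides1 μ A B) = ENNReal.ofReal α)
    (h2 : law μ ρ 1 (sprtDecides0 μ A B) = ENNReal.ofReal β)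
    (h3 : law μ ρ 0 (rltDecides1 μ p.φ p.Δ p.r p.A p.B) = ENNReal.ofReal α)
    (h4 : law μ ρ 1 (rltDecides0 μ p.φ p.Δ p.r p.A p.B) = ENNReal.ofReal β) :
    (∀ i, expTime μ ρ i (sprtTime μ A B) ≠ ⊤ ∧
      expTime μ ρ i (rltTime μ p.φ p.Δ p.r p.A p.B) ≠ ⊤ ∧
      0 ≤ (expTime μ ρ i (rltTime μ p.φ p.Δ p.r p.A p.B)).toReal -
        (expTime μ ρ i (sprtTime μ A B)).toReal) ∧
    (expTime μ ρ 1 (rltTime μ p.φ p.Δ p.r p.A p.B)).toReal -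
        (expTime μ ρ 1 (sprtTime μ A B)).toReal ≤
      |Real.log α| * relStep p.φ p.Δ p.r * (1 + 8 * relStep p.φ p.Δ p.r) /
          (∑ k, ∫ x, x ∂(llrLaw μ 1 k)) +
        K * (p.Δ + p.φ) / (∑ k, ∫ x, x ∂(llrLaw μ 1 k)) +
        2 * relStep p.φ p.Δ p.r * K * (p.φ + 2) / (∑ k, ∫ x, x ∂(llrLaw μ 1 k)) +
        smallErrorTerm C (∑ k, ∫ x, x ∂(llrLaw μ 1 k)) α ∧
    (expTime μ ρ 0 (rltTime μ p.φ p.Δ p.r p.A p.B)).toReal -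
        (expTime μ ρ 0 (sprtTime μ A B)).toReal ≤
      |Real.log β| * relStep p.φ p.Δ p.r * (1 + 8 * relStep p.φ p.Δ p.r) /
          (∑ k, ∫ x, x ∂(llrLaw μ 1 k)) +
        K * (p.Δ + p.φ) / (∑ k, ∫ x, x ∂(llrLaw μ 1 k)) +
        2 * relStep p.φ p.Δ p.r * K * (p.φ + 2) / (∑ k, ∫ x, x ∂(llrLaw μ 1 k)) +
        smallErrorTerm C (∑ k, ∫ x, x ∂(llrLaw μ 1 k)) β := by
  have hm := symmLLR_llrLaw μ hac10 hac01 hsymm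
  have hx := measurable_stepSum (K := K)
  have hS := isTest_frozenWalk hx hA hB
  have hG := p.isTest_stat (K := K) hpA hpB
  rw [law_sprtDecides1 μ ρ 0 hA hB] at h1
  rw [law_sprtDecides0 μ ρ 1 hA hB] at h2
  rw [law_rltDecides1 μ ρ p 0 hpA hpB] at h3
  rw [law_rltDecides0 μ ρ p 1 hpA hpB] at h4
  have t1 := fun i => expTime_eq_tsum μ ρ i hS (sprtTime_le_iff μ hA hB)
  have t2 := fun i => expTime_eq_tsum μ ρ i hG (rltTime_le_iff μ p hpA hpB)
  have hneg := llrLaw_zero_eq_negLaw μ hsymm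
  set m := llrLaw μ 1 with hm_def
  have hmp := fun k => (hm k).prob
  have hnp := SymmLLR.isProbabilityMeasure_negLaw hm
  have s1 : expTime μ ρ 1 (sprtTime μ A B) = meanTime m ρ (frozenWalk stepSum A B) A B := t1 1
  have r1 : expTime μ ρ 1 (rltTime μ p.φ p.Δ p.r p.A p.B) = meanTime m ρ p.stat p.A p.B := t2 1
  have s0' : expTime μ ρ 0 (sprtTime μ A B) =
      meanTime (negLaw m) ρ (frozenWalk stepSum A B) A B := by rw [← hneg]; exact t1 0
  have r0' : expTime μ ρ 0 (rltTime μ p.φ p.Δ p.r p.A p.B) =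
      meanTime (negLaw m) ρ p.stat p.A p.B := by rw [← hneg]; exact t2 0
  rw [hneg] at h1 h3
  have s0 := s0'.trans (meanTime_negLaw hm ρ (frozenWalk_flipPath A B) hS)
  have r0 := r0'.trans (meanTime_negLaw hm ρ (stat_flipPath p) hG)
  have f1 : meanTime m ρ p.stat p.A p.B ≠ ⊤ :=
    ne_top_of_le_ne_top ENNReal.ofReal_ne_top (p.meanTime_le hφ hΔ hpA hpB hδ hm hb ρ hI)
  have f0 : meanTime m ρ p.flip.stat p.B p.A ≠ ⊤ :=
    ne_top_of_le_ne_top ENNReal.ofReal_ne_top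
      (p.flip.meanTime_le hφ hΔ hpB hpA hδ hm hb ρ hI)
  obtain ⟨w1, w0⟩ := wald_wolfowitz hx (stepLaw_negLaw_eq_withDensity ρ hm)
    (isRatioLaw_stepLaw ρ hm hb hI) hA hB hG (h3.trans h1.symm).le (h4.trans h2.symm).le
    ((r0'.symm.trans r0).trans_ne f0) f1
  have w1' : expTime μ ρ 1 (sprtTime μ A B) ≤ expTime μ ρ 1 (rltTime μ p.φ p.Δ p.r p.A p.B) := by
    rw [s1, r1]; exact w1
  have w0' : expTime μ ρ 0 (sprtTime μ A B) ≤ expTime μ ρ 0 (rltTime μ p.φ p.Δ p.r p.A p.B) := by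
    rw [s0', r0']; exact w0
  have g1 : expTime μ ρ 1 (rltTime μ p.φ p.Δ p.r p.A p.B) ≠ ⊤ := r1 ▸ f1
  have g0 : expTime μ ρ 0 (rltTime μ p.φ p.Δ p.r p.A p.B) ≠ ⊤ := r0 ▸ f0
  refine ⟨?_, ?_, ?_⟩
  · intro i
    fin_cases i
    · exact ⟨ne_top_of_le_ne_top g0 w0', g0, sub_nonneg.2 (ENNReal.toReal_mono g0 w0')⟩
    · exact ⟨ne_top_of_le_ne_top g1 w1', g1, sub_nonneg.2 (ENNReal.toReal_mono g1 w1')⟩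
  · rw [r1, s1]
    exact p.meanTime_sub_le hφ hΔ hpA hpB hδ hm hb ρ hI hA hB hα hβ hαβ hβα h1 h2 h3
      (s1 ▸ ne_top_of_le_ne_top g1 w1')
  · rw [r0, s0]
    -- The claim under `H_0` is the one under `H_1` for the exchanged thresholds, with `α` and `β`
    -- exchanged as well.
    refine p.flip.meanTime_sub_le hφ hΔ hpB hpA hδ hm hb ρ hI hB hA hβ hα hβα hαβ ?_ ?_ ?_
      (s0 ▸ ne_top_of_le_ne_top g0 w0')
    · have hS' := isTest_frozenWalk hx hB hA
      rw [measure_negLaw ρ hm hS'.measurableSet_exists_up, preimage_up (frozenWalk_flipPath B A)]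
      exact h2
    · rwa [measure_negLaw ρ hm hS.measurableSet_exists_up,
        preimage_up (frozenWalk_flipPath A B)] at h1
    · have hG' := p.flip.isTest_stat (K := K) hpB hpA
      rw [measure_negLaw ρ hm hG'.measurableSet_exists_up, preimage_up (stat_flipPath p.flip)]
      exact h4

end Main

end Sensing

end

theorem theorem2 {K : ℕ} {Y : Fin K → Type*} [∀ k, MeasurableSpace (Y k)]
    (μ : Fin 2 → (k : Fin K) → Measure (Y k)) [∀ i k, IsProbabilityMeasure (μ i k)]
    (hac10 : ∀ k, μ 1 k ≪ μ 0 k) (hac01 : ∀ k, μ 0 k ≪ μ 1 k)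
    (hne : ∃ k, μ 0 k ≠ μ 1 k)
    (φ : ℝ) (hφ : ∀ k, ∀ᵐ y ∂(μ 0 k), |llr (μ 1 k) (μ 0 k) y| < φ)
    (hsymm : ∀ k, (μ 1 k).map (fun y => llr (μ 1 k) (μ 0 k) y) =
      (μ 0 k).map (fun y => -llr (μ 1 k) (μ 0 k) y))
    (ρ : Measure (Equiv.Perm (Fin K))) [IsProbabilityMeasure ρ]
    (Δ₀ : ℝ) (hΔ₀ : 0 < Δ₀) :
    ∃ (e₁ e₂ : ℝ → ℕ → ℝ) (R₀ : ℝ),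
      Tendsto (fun p : ℝ × ℕ => e₁ p.1 p.2) (Sensing.largeParams Δ₀) (𝓝 0) ∧
      Tendsto (fun p : ℝ × ℕ => e₂ p.1 p.2) (Sensing.largeParams Δ₀) (𝓝 0) ∧
      ∀ C : ℝ, ∃ e₃ : ℝ → ℝ, Tendsto e₃ (𝓝[>] 0) (𝓝 0) ∧
        ∀ (Δ : ℝ) (r : ℕ), Δ₀ ≤ Δ → R₀ ≤ max Δ r →
        ∀ α β : ℝ, α ∈ Set.Ioo 0 1 → β ∈ Set.Ioo 0 1 → α ≤ C * β → β ≤ C * α →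
        ∀ A B A' B' : ℝ, 0 < A → 0 < B → 0 < A' → 0 < B' →
          Sensing.law μ ρ 0 (Sensing.sprtDecides1 μ A B) = ENNReal.ofReal α →
          Sensing.law μ ρ 1 (Sensing.sprtDecides0 μ A B) = ENNReal.ofReal β →
          Sensing.law μ ρ 0 (Sensing.rltDecides1 μ φ Δ r A' B') = ENNReal.ofReal α →
          Sensing.law μ ρ 1 (Sensing.rltDecides0 μ φ Δ r A' B') = ENNReal.ofReal β →
          (∀ i, Sensing.expTime μ ρ i (Sensing.sprtTime μ A B) ≠ ⊤ ∧
            Sensing.expTime μ ρ i (Sensing.rltTime μ φ Δ r A' B') ≠ ⊤ ∧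
            0 ≤ (Sensing.expTime μ ρ i (Sensing.rltTime μ φ Δ r A' B')).toReal
              - (Sensing.expTime μ ρ i (Sensing.sprtTime μ A B)).toReal) ∧
          (Sensing.expTime μ ρ 1 (Sensing.rltTime μ φ Δ r A' B')).toReal
              - (Sensing.expTime μ ρ 1 (Sensing.sprtTime μ A B)).toReal
            ≤ |Real.log α| / (K * Sensing.infoNumber μ ρ 1 * (Δ * Real.tanh (Δ / 2)))
                * (φ / max (r : ℝ) 1) * (1 + e₁ Δ r)
              + (Δ + φ) / Sensing.infoNumber μ ρ 1 + e₂ Δ r + e₃ α ∧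
          (Sensing.expTime μ ρ 0 (Sensing.rltTime μ φ Δ r A' B')).toReal
              - (Sensing.expTime μ ρ 0 (Sensing.sprtTime μ A B)).toReal
            ≤ |Real.log β| / (K * Sensing.infoNumber μ ρ 0 * (Δ * Real.tanh (Δ / 2)))
                * (φ / max (r : ℝ) 1) * (1 + e₁ Δ r)
              + (Δ + φ) / Sensing.infoNumber μ ρ 0 + e₂ Δ r + e₃ β := by
  have hne' := hne
  obtain ⟨k₀, -⟩ := hne
  have hK : (0 : ℝ) < K := by exact_mod_cast Fin.pos k₀
  -- An almost sure statement under a probability measure holds at some point.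
  have hφ0 : 0 < φ := by
    obtain ⟨y, hy⟩ := (hφ k₀).exists
    exact (abs_nonneg _).trans_lt hy
  have hm := Sensing.symmLLR_llrLaw μ hac10 hac01 hsymm
  have hb : ∀ k, ∀ᵐ x ∂(Sensing.llrLaw μ 1 k), |x| ≤ φ := fun k =>
    (Sensing.ae_llrLaw_abs_lt μ hac10 hφ k).mono fun x hx => hx.le
  have hI := Sensing.sum_integral_llrLaw_pos μ hac10 hac01 hne' hφ hsymm
  have hI1 := Sensing.infoNumber_llr_one μ ρ hb hI
  have hI0 := Sensing.infoNumber_llr_zero μ ρ hsymm hb hI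
  set S := ∑ k, ∫ x, x ∂(Sensing.llrLaw μ 1 k)
  have ht := Sensing.tendsto_relStep hφ0 hΔ₀
  -- With `δ` for `relStep`: `e₁ = 8 δ`, and `e₂` is the correction part of the boundary term. `R₀`
  -- is chosen so that `δ ≤ 1 / 4`. Only `e₃` involves `C`.
  refine ⟨fun Δ r => 8 * Sensing.relStep φ Δ r,
    fun Δ r => 2 * Sensing.relStep φ Δ r * K * (φ + 2) / S,
    4 * Sensing.relStepConst φ Δ₀, by simpa using ht.const_mul 8, ?_, fun C =>
    ⟨Sensing.smallErrorTerm C S, Sensing.tendsto_smallErrorTerm C S, ?_⟩⟩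
  · have := (((ht.const_mul 2).mul_const (K : ℝ)).mul_const (φ + 2)).div_const S
    simpa using this
  intro Δ r hΔ hR α β hα hβ hαβ hβα A B A' B' hA hB hA' hB' h1 h2 h3 h4
  have hΔ0 := hΔ₀.trans_le hΔ
  have hδ := Sensing.relStep_le_quarter hφ0 hΔ₀ hΔ hR
  obtain ⟨hfin, c1, c0⟩ := Sensing.expTime_comparison μ ρ hac10 hac01 hsymm
    (p := ⟨φ, Δ, r, A', B'⟩) hφ0 hΔ0 hA' hB' hδ hb hI hA hB hα hβ hαβ hβα h1 h2 h3 h4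
  -- The sum `S` of the drifts is `K` times the average information number, and `δ` contains the
  -- factor `1 / (Δ tanh (Δ / 2))` of the main term.
  have conv : ∀ a : ℝ, a * Sensing.relStep φ Δ r * (1 + 8 * Sensing.relStep φ Δ r) / S =
      a / (K * (S / K) * (Δ * Real.tanh (Δ / 2))) * (φ / max (r : ℝ) 1) *
        (1 + 8 * Sensing.relStep φ Δ r) := by
    intro a
    rw [mul_div_cancel₀ S hK.ne']
    simp only [Sensing.relStep]
    ring
  have conv2 : K * (Δ + φ) / S = (Δ + φ) / (S / K) := by
    rw [div_div_eq_mul_div, mul_comm]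
  rw [hI1, hI0]
  refine ⟨hfin, ?_, ?_⟩
  · rw [← conv, ← conv2]; exact c1
  · rw [← conv, ← conv2]; exact c0
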